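/- A clause is a finite set of literals over variables indexed by the natural numbers, and a CNF formula is a finite set of clauses; it is a 2CNF formula if every clause has at most two literals. A formula is \emph{minimal unsatisfiable} if it is unsatisfiable and each of its proper subsets is satisfiable. A \emph{read-once resolution step} on a set $U$ of clauses picks $\pi_1,\pi_2\in U$ and a variable $x$ with $x\in\pi_1$ and $\neg x\in\pi_2$, and replaces $U$ by $(U\setminus\{\pi_1,\pi_2\})\cup\{\pi\}$, where $\pi=(\pi_1\setminus\{x\})\cup(\pi_2\setminus\{\neg x\})$ is the resolvent. A formula $\Phi$ has a \emph{read-once refutation} (is in ROR) if a finite, possibly empty, sequence of such steps leads from $\Phi$ to a set that contains the empty clause $\sqcup$. Write formulas as words over a fixed finite alphabet by listing the clauses, and in each clause the literals, in any order (repetitions allowed), a literal being written as its variable index in binary followed by its sign, and each clause being closed by an end marker. \textbf{Corollary.} The read-once refutation problem for minimal unsatisfiable 2CNF formulas is in $\mathbf{P}$: the language of all words that encode a minimal unsatisfiable 2CNF formula in ROR is decided by a deterministic (multi-stack) Turing machine in a number of steps bounded by a polynomial in the length of the input word. In particular, given a minimal unsatisfiable 2CNF formula, it can be decided in polynomial time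 whether it has a read-once refutation. -/

import Mathlib

namespace ReadOnce

/-! ### CNF formulas -/

/-- A literal: `(x, true)` is the variable `x` and `(x, false)` is its complement. -/
abbrev Literal : Type := ℕ × Bool

/-- A clause is the disjunction of a finite set of literals; `∅` is the empty clause. -/
abbrev Clause : Type := Finset Literal

/-- A CNF formula is a finite set of clauses. -/
abbrev CNF : Type := Finset Clause

/-- Every clause has at most two literals. -/
def IsTwoCNF (Φ : CNF) : Prop := ∀ c ∈ Φ, c.card ≤ 2

def Satisfiable (Φ : CNF) : Prop :=
  ∃ v : ℕ → Bool, ∀ c ∈ Φ, ∃ l ∈ c, v l.1 = l.2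

/-- Unsatisfiable, while every proper sub-formula is satisfiable. -/
def MinimalUnsat (Φ : CNF) : Prop :=
  ¬ Satisfiable Φ ∧ ∀ Ψ : CNF, Ψ ⊂ Φ → Satisfiable Ψ

/-! ### Read-once resolution -/

/-- `r` is the resolvent of the parents `c = α ∨ x` and `d = ¬x ∨ β` on some variable `x`. -/
def IsResolvent (c d r : Clause) : Prop :=
  ∃ x : ℕ, (x, true) ∈ c ∧ (x, false) ∈ d ∧ r = c.erase (x, true) ∪ d.erase (x, false)

/-- One read-once resolution step on the current set of clauses: the two parents are deleted and
the resolvent is added. -/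
def ReadOnceStep (U V : CNF) : Prop :=
  ∃ c ∈ U, ∃ d ∈ U, ∃ r : Clause, IsResolvent c d r ∧ V = (U \ {c, d}) ∪ {r}

/-- `Φ` has a read-once resolution derivation of the clause `c`. -/
def ReadOnceDerives (Φ : CNF) (c : Clause) : Prop :=
  ∃ U : CNF, Relation.ReflTransGen ReadOnceStep Φ U ∧ c ∈ U

/-- `Φ` has a read-once resolution refutation. -/
def ROR (Φ : CNF) : Prop := ReadOnceDerives Φ ∅

/-! ### The decision problem as a language of words -/

/-- The input alphabet: two binary digits, the two signs that end a literal, and the end of a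
clause. -/
inductive Symb : Type
  | digit (b : Bool)
  | sign (b : Bool)
  | clauseEnd
  deriving DecidableEq, Fintype

/-- A literal is written as the binary digits of its variable, followed by its sign. -/
def encodeLiteral (l : Literal) : List Symb :=
  (Computability.encodeNat l.1).map Symb.digit ++ [Symb.sign l.2]

/-- A clause is written as the list of its literals, in any order, followed by an end marker. -/
def encodeClause (c : List Literal) : List Symb :=
  c.flatMap encodeLiteral ++ [Symb.clauseEnd]

/-- A formula is written as the list of its clauses, in any order. -/
def encodeFormula (φ : List (List Literal)) : List Symb :=
  φ.flatMap encodeClause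

/-- The set of clauses presented by a list of lists of literals. -/
def toCNF (φ : List (List Literal)) : CNF :=
  (φ.map List.toFinset).toFinset

/-- The read-once refutation problem for minimal unsatisfiable 2CNF formulas: the words that
present a minimal unsatisfiable 2CNF formula with a read-once resolution refutation. -/
def rorMinimalUnsatTwoCNF : Set (List Symb) :=
  {w | ∃ φ : List (List Literal), encodeFormula φ = w ∧
    IsTwoCNF (toCNF φ) ∧ MinimalUnsat (toCNF φ) ∧ ROR (toCNF φ)}

open Classical in
/-- The class **P**: membership in the language `L` is computed, with answer `true` or `false` on
every input word, by a deterministic multi-stack Turing machine in a number of steps bounded by a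
polynomial in the length of the word. -/
def InP {Γ : Type} (L : Set (List Γ)) : Prop :=
  Nonempty (Turing.TM2ComputableInPolyTime (id : List Γ → List Γ) Computability.encodeBool
    (fun w => decide (w ∈ L)))

end ReadOnce

/-! The core is a criterion that only counts occurrences (`MinimalUnsat.ror_iff`): a minimal
unsatisfiable 2CNF formula has a read-once refutation exactly when at most two variables occur in
exactly three clauses (`FewCubic`).

Necessity (`MReach.exists_odd`, `MinimalUnsat.card_odd_le`). By minimality a refutation consumes all
n clauses, so it has n - 1 steps. A step removes two literal occurrences, and one more for every
literal that the two parents have in common and that is merged in the resolvent. There are at most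
2n occurrences to begin with and none at the end, hence at most two merges. Only a merge changes the
parity of the degree of a variable, and all degrees end at zero; so at most two variables have odd
degree.

Sufficiency (`MinimalUnsat.refutable`), by induction on the number of clauses. A unit clause a is
refuted by a read-once derivation of its complement. A variable in only two clauses is resolved away
(`MinimalUnsat.eliminate`), which preserves the other degrees unless literals merge, and then an
empty or unit clause appears. Otherwise all n variables have degree at least three. Some p and its
complement imply each other in the implication graph, and a chain of implications from p to its
complement contains a lasso: a path through distinct variables that closes at the complement of an
earlier literal. A lasso is a read-once derivation of the complement of its start. The lassos from p
and from its complement together contain all clauses, each has at most n clauses, and the degrees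
force at least 2n - 1 clauses in all; so they share at most one clause. If they share none, the two
derivations combine; if they share one, `refutable_of_cycle` rearranges the implications so that it
is used once.

Polynomial time. Minimal unsatisfiability of a 2CNF formula reduces to reachability in the
implication graphs of the formula and of its subformulas with one clause removed
(`not_satisfiable_iff`, `minimalUnsat_of_erase`). All conditions are expressed by one fixed formula
`Form` about the reversed input word, with quantifiers over positions and an operator that iterates
a definable map on sets of positions. Such a formula is evaluated by a stack program in polynomial
time (`Form.evalSpec`), and stack programs compile to multi-stack Turing machines without loss of
time (`Cmd.Runs.stepsIn`). -/

namespace ReadOnce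

/-! ### Structured programs over stacks -/

open Function Turing

/-- Structured programs over a family of stacks indexed by `K`: `pop k f` pops the stack `k` and
continues according to the symbol found, and `loop k f` pops `k` and runs the body on the symbol
found until `k` is empty. -/
inductive Cmd (K Γ : Type) : Type
  | skip : Cmd K Γ
  | push (k : K) (a : Γ) : Cmd K Γ
  | pop (k : K) (f : Option Γ → Cmd K Γ) : Cmd K Γ
  | seq (c d : Cmd K Γ) : Cmd K Γ
  | loop (k : K) (f : Γ → Cmd K Γ) : Cmd K Γ

namespace Cmd

variable {K Γ : Type}

/-- `Runs c S S' t`: started in the state `S`, the program `c` stops in the state `S'` after at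
most `t` steps. -/
inductive Runs [DecidableEq K] : Cmd K Γ → (K → List Γ) → (K → List Γ) → ℕ → Prop
  | skip (S) : Runs skip S S 1
  | push (k a S) : Runs (push k a) S (update S k (a :: S k)) 1
  | pop {k f S S' t} (h : Runs (f (S k).head?) (update S k (S k).tail) S' t) :
      Runs (pop k f) S S' (t + 1)
  | seq {c d S S' S'' t t'} (h : Runs c S S' t) (h' : Runs d S' S'' t') :
      Runs (seq c d) S S'' (t + t')
  | loop_nil {k f S} (h : S k = []) : Runs (loop k f) S S 1
  | loop_cons {k f S S' S'' a l t t'} (h : S k = a :: l) (h₁ : Runs (f a) (update S k l) S' t)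
      (h₂ : Runs (loop k f) S' S'' t') : Runs (loop k f) S S'' (t + t' + 1)
  | mono {c S S' t t'} (h : Runs c S S' t) (ht : t ≤ t') : Runs c S S' t'

/-- The program positions of a program. -/
def Lab : Cmd K Γ → Type
  | skip => Unit
  | push _ _ => Unit
  | pop _ f => Option (Σ o : Option Γ, Lab (f o))
  | seq c d => Lab c ⊕ Lab d
  | loop _ f => Option (Σ a : Γ, Lab (f a))

theorem finite_lab [Finite Γ] (c : Cmd K Γ) : Finite (Lab c) := by
  induction c with
  | skip => exact inferInstanceAs (Finite Unit)
  | push k a => exact inferInstanceAs (Finite Unit)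
  | pop k f ih =>
    have := ih
    exact inferInstanceAs (Finite (Option (Σ o : Option Γ, Lab (f o))))
  | seq c d ihc ihd => exact inferInstanceAs (Finite (Lab c ⊕ Lab d))
  | loop k f ih =>
    have := ih
    exact inferInstanceAs (Finite (Option (Σ a : Γ, Lab (f a))))

/-- The position at which a program starts. -/
def entry : ∀ c : Cmd K Γ, Lab c
  | skip => ()
  | push _ _ => ()
  | pop _ _ => none
  | seq c _ => Sum.inl (entry c)
  | loop _ _ => none

/-- All stacks used by a program belong to `F`. -/
def Within (F : Finset K) : Cmd K Γ → Prop
  | skip => True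
  | push k _ => k ∈ F
  | pop k f => k ∈ F ∧ ∀ o, Within F (f o)
  | seq c d => Within F c ∧ Within F d
  | loop k f => k ∈ F ∧ ∀ a, Within F (f a)

theorem Within.mono {F G : Finset K} (h : F ⊆ G) {c : Cmd K Γ} (hc : Within F c) :
    Within G c := by
  induction c with
  | skip => trivial
  | push k a => exact h hc
  | pop k f ih => exact ⟨h hc.1, fun o => ih o (hc.2 o)⟩
  | seq c d ihc ihd => exact ⟨ihc hc.1, ihd hc.2⟩
  | loop k f ih => exact ⟨h hc.1, fun a => ih a (hc.2 a)⟩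

/-- The index type of the stacks may be infinite, but a machine has finitely many. Branching is over
the finite alphabet only, so a program mentions finitely many stacks. -/
theorem exists_within [DecidableEq K] [Fintype Γ] (c : Cmd K Γ) : ∃ F : Finset K, Within F c := by
  induction c with
  | skip => exact ⟨∅, trivial⟩
  | push k a => exact ⟨{k}, Finset.mem_singleton_self k⟩
  | pop k f ih =>
    choose F hF using ih
    exact ⟨insert k (Finset.univ.biUnion F), Finset.mem_insert_self _ _, fun o =>
      (hF o).mono ((Finset.subset_biUnion_of_mem F (Finset.mem_univ o)).trans
        (Finset.subset_insert _ _))⟩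
  | seq c d ihc ihd =>
    obtain ⟨F, hF⟩ := ihc
    obtain ⟨G, hG⟩ := ihd
    exact ⟨F ∪ G, hF.mono Finset.subset_union_left, hG.mono Finset.subset_union_right⟩
  | loop k f ih =>
    choose F hF using ih
    exact ⟨insert k (Finset.univ.biUnion F), Finset.mem_insert_self _ _, fun o =>
      (hF o).mono ((Finset.subset_biUnion_of_mem F (Finset.mem_univ o)).trans
        (Finset.subset_insert _ _))⟩

/-- The stack alphabets of the compiled machine: `none` is the output stack. -/
abbrev StackAlphabet (F : Finset K) (Γ : Type) : Option F → Type
  | none => Bool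
  | some _ => Γ

/-- The statement at each position of a compiled program. -/
def code {F : Finset K} (ι : K → F) {Λ : Type} :
    ∀ (c : Cmd K Γ) (_ : Lab c → Λ) (_ : Λ), Lab c → TM2.Stmt (StackAlphabet F Γ) Λ (Option Γ)
  | skip, _, exit, _ => .goto fun _ => exit
  | push k a, _, exit, _ => .push (some (ι k)) (fun _ => a) (.goto fun _ => exit)
  | pop k f, emb, exit, l =>
    match l with
    | none => .pop (some (ι k)) (fun _ o => o) (.goto fun o => emb (some ⟨o, entry (f o)⟩))
    | some ⟨o, l⟩ => code ι (f o) (fun l => emb (some ⟨o, l⟩)) exit l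
  | seq c d, emb, exit, l =>
    match l with
    | .inl l => code ι c (fun l => emb (.inl l)) (emb (.inr (entry d))) l
    | .inr l => code ι d (fun l => emb (.inr l)) exit l
  | loop k f, emb, exit, l =>
    match l with
    | none => .pop (some (ι k)) (fun _ o => o)
        (.goto fun o => o.elim exit fun a => emb (some ⟨a, entry (f a)⟩))
    | some ⟨a, l⟩ => code ι (f a) (fun l => emb (some ⟨a, l⟩)) (emb none) l

/-- The stacks of the compiled machine in a state of the program. -/
def machineStk (F : Finset K) (S : K → List Γ) : ∀ k, List (StackAlphabet F Γ k)
  | none => []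
  | some k => S k

theorem machineStk_some {F : Finset K} {ι : K → F} (hι : ∀ k ∈ F, (ι k : K) = k)
    (S : K → List Γ) {k : K} (hk : k ∈ F) : machineStk F S (some (ι k)) = S k :=
  congrArg S (hι k hk)

theorem machineStk_update [DecidableEq K] {F : Finset K} {ι : K → F} (hι : ∀ k ∈ F, (ι k : K) = k)
    (S : K → List Γ) {k : K} (hk : k ∈ F) (l : List Γ) :
    machineStk F (update S k l) = update (machineStk F S) (some (ι k)) l := by
  funext k'
  rcases k' with _ | k'
  · rfl
  · by_cases h : k' = ι k
    · subst h
      rw [update_self]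
      change update S k l (ι k : K) = l
      rw [hι k hk, update_self]
    · have h' : (k' : K) ≠ k := fun e => h (Subtype.ext (e.trans (hι k hk).symm))
      rw [update_of_ne (by simpa using h)]
      exact update_of_ne h' _ _

/-- The machine with transition function `f` goes from `a` to `b` within `t` steps. -/
def StepsIn {α : Type} (f : α → Option α) (a b : α) (t : ℕ) : Prop :=
  ∃ n ≤ t, (flip bind f)^[n] (some a) = some b

theorem StepsIn.single {α : Type} {f : α → Option α} {a b : α} (h : f a = some b) :
    StepsIn f a b 1 := ⟨1, le_rfl, h⟩

theorem StepsIn.trans {α : Type} {f : α → Option α} {a b c : α} {s t : ℕ}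
    (h : StepsIn f a b s) (h' : StepsIn f b c t) : StepsIn f a c (s + t) := by
  obtain ⟨n, hn, e⟩ := h
  obtain ⟨m, hm, e'⟩ := h'
  exact ⟨m + n, by omega, by rw [iterate_add_apply, e, e']⟩

theorem StepsIn.mono {α : Type} {f : α → Option α} {a b : α} {s t : ℕ}
    (h : StepsIn f a b s) (hst : s ≤ t) : StepsIn f a b t := by
  obtain ⟨n, hn, e⟩ := h
  exact ⟨n, hn.trans hst, e⟩

/-- Induction on the run. The embedding of positions and the exit are arbitrary so that the
statement applies to a subprogram inside a larger one. The register is arbitrary before and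
unspecified after, because every command that reads it has just overwritten it. -/
theorem Runs.stepsIn [DecidableEq K] {F : Finset K} {ι : K → F} (hι : ∀ k ∈ F, (ι k : K) = k)
    {Λ : Type} (M : Λ → TM2.Stmt (StackAlphabet F Γ) Λ (Option Γ)) {c : Cmd K Γ}
    {S S' : K → List Γ} {t : ℕ} (h : Runs c S S' t) (hc : Within F c) (emb : Lab c → Λ) (exit : Λ)
    (hM : ∀ l, M (emb l) = code ι c emb exit l) (v : Option Γ) :
    ∃ v', StepsIn (TM2.step M) ⟨some (emb (entry c)), v, machineStk F S⟩
      ⟨some exit, v', machineStk F S'⟩ t := by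
  induction h generalizing exit v with
  | skip S =>
    refine ⟨v, .single ?_⟩
    simp [TM2.step, hM, code]
  | push k a S =>
    refine ⟨v, .single ?_⟩
    rw [machineStk_update hι S hc]
    have : machineStk F S (some (ι k)) = S k := machineStk_some hι S hc
    simp only [TM2.step, hM, code, TM2.stepAux]
    simp only [this]
  | @pop k f S S' t h ih =>
    obtain ⟨v', hv'⟩ := ih (hc.2 _) (fun l => emb (some ⟨_, l⟩)) exit (fun l => hM _)
      (S k).head?
    refine ⟨v', ?_⟩
    rw [add_comm]
    refine StepsIn.trans (.single ?_) hv'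
    rw [machineStk_update hι S hc.1]
    refine congrArg some ((congrArg (fun q => TM2.stepAux q v _) (hM none)).trans ?_)
    exact congrArg (fun l : List Γ => (⟨some (emb (some ⟨l.head?, entry (f l.head?)⟩)), l.head?,
      update (machineStk F S) (some (ι k)) l.tail⟩ : TM2.Cfg (StackAlphabet F Γ) Λ (Option Γ)))
      (machineStk_some hι S hc.1)
  | @seq c d S S' S'' t t' h h' ih ih' =>
    obtain ⟨v', hv'⟩ := ih hc.1 (fun l => emb (.inl l)) (emb (.inr (entry d))) (fun l => hM _) v
    obtain ⟨v'', hv''⟩ := ih' hc.2 (fun l => emb (.inr l)) exit (fun l => hM _) v'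
    exact ⟨v'', hv'.trans hv''⟩
  | @loop_nil k f S h =>
    refine ⟨none, .single ?_⟩
    have : machineStk F S (some (ι k)) = [] := (machineStk_some hι S hc.1).trans h
    have e : update (machineStk F S) (some (ι k)) [] = machineStk F S := by
      rw [← this, update_eq_self]
    refine congrArg some ((congrArg (fun q => TM2.stepAux q v _) (hM none)).trans ?_)
    refine (congrArg (fun l : List Γ => (⟨some (l.head?.elim exit fun a =>
      emb (some ⟨a, entry (f a)⟩)), l.head?,
      update (machineStk F S) (some (ι k)) l.tail⟩ : TM2.Cfg (StackAlphabet F Γ) Λ (Option Γ)))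
      this).trans ?_
    exact congrArg (TM2.Cfg.mk _ _) e
  | @loop_cons k f S S' S'' a l t t' h h₁ h₂ ih₁ ih₂ =>
    obtain ⟨v', hv'⟩ := ih₁ (hc.2 a) (fun l => emb (some ⟨a, l⟩)) (emb none) (fun l => hM _)
      (some a)
    obtain ⟨v'', hv''⟩ := ih₂ hc emb exit hM v'
    refine ⟨v'', ((StepsIn.trans (.single ?_) hv').trans hv'').mono (by omega)⟩
    rw [machineStk_update hι S hc.1]
    refine congrArg some ((congrArg (fun q => TM2.stepAux q v _) (hM none)).trans ?_)
    exact congrArg (fun l : List Γ => (⟨some (l.head?.elim exit fun a =>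
      emb (some ⟨a, entry (f a)⟩)), l.head?,
      update (machineStk F S) (some (ι k)) l.tail⟩ : TM2.Cfg (StackAlphabet F Γ) Λ (Option Γ)))
      ((machineStk_some hι S hc.1).trans h)
  | mono h ht ih =>
    obtain ⟨v', hv'⟩ := ih hc emb exit hM v
    exact ⟨v', hv'.mono ht⟩

open Classical in
/-- The machine that runs the program `c`, then moves the answer from the stack `res` to the
output stack; `yes` is the symbol that stands for `true`. -/
noncomputable def machine [DecidableEq K] [Fintype Γ] (c : Cmd K Γ) (F : Finset K) (inp res : F)
    (yes : Γ) : FinTM2 :=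
  let ι : K → F := fun k => if h : k ∈ F then ⟨k, h⟩ else inp
  letI : Finite (Lab c) := finite_lab c
  { K := Option F
    k₀ := some inp
    k₁ := none
    Γ := StackAlphabet F Γ
    Λ := Option (Lab c)
    main := some (entry c)
    ΛFin := Fintype.ofFinite _
    σ := Option Γ
    initialState := none
    Γk₀Fin := inferInstanceAs (Fintype Γ)
    m := fun l => match l with
      | none => .pop (some res) (fun _ o => o) (.push none (fun o => decide (o = some yes))
          -- The prescribed halting configuration carries the initial register value.
          (.load (fun _ => none) .halt))
      | some l => code ι c some none l }

/-- A language is in **P** if a program with polynomial running time decides it: the program is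
started with the input on the stack `inp`, and it stops with nothing but its answer on the
stack `res`. -/
theorem inP_of_runs [DecidableEq K] [Fintype Γ] (L : Set (List Γ)) (c : Cmd K Γ) (inp res : K)
    (yes : Γ) (p : Polynomial ℕ)
    (h : ∀ w : List Γ, ∃ a : Γ, (a = yes ↔ w ∈ L) ∧
      Runs c (update (fun _ => []) inp w) (update (fun _ => []) res [a]) (p.eval w.length)) :
    InP L := by
  classical
  obtain ⟨F₀, hF₀⟩ := exists_within c
  set F : Finset K := insert inp (insert res F₀) with hF
  have hcF : Within F c := hF₀.mono ((Finset.subset_insert _ _).trans (Finset.subset_insert _ _))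
  have hinp : inp ∈ F := by simp [hF]
  have hres : res ∈ F := by simp [hF]
  refine ⟨{ tm := machine c F ⟨inp, hinp⟩ ⟨res, hres⟩ yes
            inputAlphabet := Equiv.refl _
            outputAlphabet := Equiv.refl _
            -- The extra step is the final block, which transfers the answer to the output stack and
            -- halts.
            time := p + 1
            outputsFun := fun w => Classical.choice ?_ }⟩
  obtain ⟨a, ha, hr⟩ := h w
  set ι : K → F := fun k => if h : k ∈ F then ⟨k, h⟩ else ⟨inp, hinp⟩ with hι
  have hι' : ∀ k ∈ F, (ι k : K) = k := fun k hk => by simp [hι, hk]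
  obtain ⟨v', hv'⟩ := hr.stepsIn hι' (machine c F ⟨inp, hinp⟩ ⟨res, hres⟩ yes).m hcF
    some none (fun l => rfl) none
  have hlast : StepsIn (TM2.step (machine c F ⟨inp, hinp⟩ ⟨res, hres⟩ yes).m)
      ⟨some none, v', machineStk F (update (fun _ => []) res [a])⟩
      (haltList (machine c F ⟨inp, hinp⟩ ⟨res, hres⟩ yes) [decide (w ∈ L)]) 1 := by
    refine .single (congrArg some ?_)
    have h₁ : machineStk F (update (fun _ => []) res [a]) (some ⟨res, hres⟩) = [a] :=
      (update_self res [a] (fun _ : K => ([] : List Γ)) :)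
    have h₂ : update (machineStk F (update (fun _ => []) res [a]))
        (some (⟨res, hres⟩ : F)) [] = fun _ => [] := by
      funext k
      rcases k with _ | k
      · rfl
      · by_cases hk : k = ⟨res, hres⟩
        · subst hk
          exact update_self _ _ _
        · refine (update_of_ne (by simpa using hk) _ _).trans ?_
          exact (update_of_ne (fun e => hk (Subtype.ext e)) [a] (fun _ : K => ([] : List Γ)) :)
    refine (congrArg (fun l : List Γ => (⟨none, none,
      update (update (machineStk F (update (fun _ => []) res [a])) (some (⟨res, hres⟩ : F)) l.tail)
        none [decide (l.head? = some yes)]⟩ :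
        TM2.Cfg (StackAlphabet F Γ) (Option (Lab c)) (Option Γ))) h₁).trans ?_
    refine congrArg (TM2.Cfg.mk _ _) ?_
    refine (congrArg (fun g => update g none _) h₂).trans ?_
    funext k
    rcases k with _ | k
    · refine (update_self _ _ _).trans ?_
      have hb : decide ((some a : Option Γ) = some yes) = decide (w ∈ L) := by simp [← ha]
      exact congrArg (fun b => [b]) hb
    · rfl
  have hinit : initList (machine c F ⟨inp, hinp⟩ ⟨res, hres⟩ yes) w =
      ⟨some (some (entry c)), none, machineStk F (update (fun _ => []) inp w)⟩ := by
    refine congrArg (TM2.Cfg.mk _ _) ?_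
    funext k
    rcases k with _ | k
    · rfl
    · by_cases hk : k = ⟨inp, hinp⟩
      · subst hk
        refine (dif_pos rfl).trans ?_
        exact (update_self inp w (fun _ : K => ([] : List Γ)) :).symm
      · refine (dif_neg (by simpa [machine] using hk)).trans ?_
        exact (update_of_ne (fun e => hk (Subtype.ext e)) w (fun _ : K => ([] : List Γ)) :).symm
  choose n hn e using hv'.trans hlast
  refine ⟨⟨⟨n, ?_⟩, by simpa using hn⟩⟩
  have e' := (congrArg (fun q => (flip bind (TM2.step
    (machine c F ⟨inp, hinp⟩ ⟨res, hres⟩ yes).m))^[n] (some q)) hinit).trans e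
  have hw : List.map (Equiv.refl Γ).invFun (id w) = w := by simp
  exact (congrArg (fun q => (flip bind (TM2.step
    (machine c F ⟨inp, hinp⟩ ⟨res, hres⟩ yes).m))^[n] (some (initList
      (machine c F ⟨inp, hinp⟩ ⟨res, hres⟩ yes) q))) hw).trans e'

end Cmd

end ReadOnce

namespace ReadOnce

open Function

/-! ### A logic of words whose formulas are evaluated in polynomial time -/

/-- The stacks of the evaluator. -/
inductive Stk : Type
  | input | word | tmp | off | res
  | var (i : ℕ)
  | ctl (i : ℕ)
  | aux (i : ℕ)
  deriving DecidableEq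

/-- The word (`none`), or the value of a variable. -/
def Stk.src : Option ℕ → Stk
  | none => .word
  | some i => .var i

open Stk Cmd

/-- Formulas about a word `v` with variables that range over lists of symbols. A list stands for
its length where a number is expected. At depth `d`, quantifiers bind the variable `d`.
* `atom s a t c`: the entry of `s` at the sum of the variables in `t` and `c` is the symbol `a`;
* `ex s φ`: some number below the length of `s` satisfies `φ`;
* `iter φ ψ`: the set variable `d`, initially empty, is replaced as many times as `v` has letters
  by the set of positions `d + 1` that satisfy `φ`; the result satisfies `ψ`. -/
inductive Form : Type
  | atom (s : Option ℕ) (a : Symb) (t : List ℕ) (c : ℕ) : Form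
  | neg (φ : Form) : Form
  | and (φ ψ : Form) : Form
  | ex (s : Option ℕ) (φ : Form) : Form
  | iter (φ ψ : Form) : Form

/-- The list that stands for a number. -/
def unary (p : ℕ) : List Symb := List.replicate p Symb.clauseEnd

@[simp] theorem length_unary (p : ℕ) : (unary p).length = p := List.length_replicate

/-- The list that stands for a set of positions below `n`. -/
noncomputable def bits (n : ℕ) (P : ℕ → Prop) : List Symb :=
  open Classical in (List.range n).map fun p => Symb.sign (decide (P p))

namespace Form

/-- The entry of a list named by `s`. -/
def get (v : List Symb) (E : ℕ → List Symb) : Option ℕ → List Symb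
  | none => v
  | some i => E i

/-- Satisfaction of a formula at depth `d`. -/
def holds (v : List Symb) : Form → ℕ → (ℕ → List Symb) → Prop
  | atom s a t c, _, E => (get v E s)[(t.map fun i => (E i).length).sum + c]? = some a
  | neg φ, d, E => ¬ holds v φ d E
  | and φ ψ, d, E => holds v φ d E ∧ holds v ψ d E
  | ex s φ, d, E => ∃ p < (get v E s).length, holds v φ (d + 1) (update E d (unary p))
  | iter φ ψ, d, E => holds v ψ (d + 1) (update E d
      ((fun L => bits v.length fun p =>
        holds v φ (d + 2) (update (update E d L) (d + 1) (unary p)))^[v.length] []))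

end Form

/-! ### Elementary programs -/

section programs

/-- Pop everything from `k` and push it onto `j`. -/
def move (k j : Stk) : Cmd Stk Symb := loop k fun a => push j a

/-- Empty the stack `k`. -/
def clear (k : Stk) : Cmd Stk Symb := loop k fun _ => skip

/-- Push a copy of `k` onto `j`. -/
def copy (k j : Stk) : Cmd Stk Symb :=
  seq (move k tmp) (loop tmp fun a => seq (push k a) (push j a))

theorem runs_congr {c : Cmd Stk Symb} {S S' S'' : Stk → List Symb} {t : ℕ} (h : Runs c S S' t)
    (e : S' = S'') : Runs c S S'' t := e ▸ h

theorem move_runs {k j : Stk} (hkj : k ≠ j) (S : Stk → List Symb) :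
    Runs (move k j) S (update (update S k []) j ((S k).reverse ++ S j)) (2 * (S k).length + 1) := by
  generalize hl : S k = l
  induction l generalizing S with
  | nil =>
    refine runs_congr (.loop_nil hl) ?_
    funext i
    simp only [update_apply]
    split_ifs <;> simp_all
  | cons a l ih =>
    refine runs_congr (.mono (.loop_cons hl (.push j a _) (ih _ ?_)) ?_) ?_
    · simp [hkj]
    · simp only [List.length_cons]; omega
    · funext i
      simp only [update_apply]
      split_ifs <;> simp_all

theorem clear_runs (k : Stk) (S : Stk → List Symb) :
    Runs (clear k) S (update S k []) (2 * (S k).length + 1) := by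
  generalize hl : S k = l
  induction l generalizing S with
  | nil =>
    refine runs_congr (.loop_nil hl) ?_
    rw [← hl, update_eq_self]
  | cons a l ih =>
    refine runs_congr (.mono (.loop_cons hl (.skip _) (ih _ ?_)) ?_) ?_
    · simp
    · simp only [List.length_cons]; omega
    · simp

/-- Emptying `k` into `tmp` reverses it; unloading `tmp` onto both stacks reverses it back, which
restores `k`. -/
theorem copy_runs {k j : Stk} (hkj : k ≠ j) (hk : k ≠ tmp) (hj : j ≠ tmp) (S : Stk → List Symb)
    (hS : S tmp = []) :
    Runs (copy k j) S (update S j (S k ++ S j)) (5 * (S k).length + 2) := by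
  have key : ∀ (l : List Symb) (S : Stk → List Symb), S tmp = l →
      Runs (loop tmp fun a => seq (push k a) (push j a)) S
        (update (update (update S tmp []) k (l.reverse ++ S k)) j (l.reverse ++ S j))
        (3 * l.length + 1) := by
    intro l
    induction l with
    | nil =>
      intro S hl
      refine runs_congr (.loop_nil hl) ?_
      funext i
      simp only [update_apply]
      split_ifs <;> simp_all
    | cons a l ih =>
      intro S hl
      refine runs_congr (.mono (.loop_cons hl (.seq (.push k a _) (.push j a _)) (ih _ ?_)) ?_) ?_
      · simp [hk.symm, hj.symm]
      · simp only [List.length_cons]; omega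
      · funext i
        simp only [update_apply]
        split_ifs <;> simp_all
  refine runs_congr (.mono (.seq (move_runs hk S) (key _ _ rfl)) ?_) ?_
  · simp [hS]; omega
  · funext i
    simp only [update_apply]
    split_ifs <;> simp_all

/-- Push onto `off` a list whose length is the sum of the variables in `t` and `c`. -/
def pushOffset : List ℕ → ℕ → Cmd Stk Symb
  | [], 0 => skip
  | [], c + 1 => seq (push off .clauseEnd) (pushOffset [] c)
  | i :: t, c => seq (copy (var i) off) (pushOffset t c)

/-- The stack `off` serves as a unary counter. It receives copies of variables with unknown symbols,
so only the length of what is pushed is specified. -/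
theorem pushOffset_runs (n : ℕ) (t : List ℕ) (c : ℕ) (S : Stk → List Symb) (hS : S tmp = [])
    (hn : ∀ i, (S (var i)).length ≤ n) :
    ∃ l : List Symb, l.length = (t.map fun i => (S (var i)).length).sum + c ∧
      Runs (pushOffset t c) S (update S off (l ++ S off)) (t.length * (5 * n + 2) + c + 1) := by
  induction t generalizing S with
  | nil =>
    induction c generalizing S with
    | zero =>
      refine ⟨[], rfl, ?_⟩
      rw [pushOffset]
      refine runs_congr (.mono (.skip _) (by simp)) ?_
      simp
    | succ c ih =>
      obtain ⟨l, hl, hr⟩ := ih (update S off (.clauseEnd :: S off)) (by simpa using hS)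
        (by simpa using hn)
      refine ⟨l ++ [.clauseEnd], by simp at hl ⊢; omega, ?_⟩
      rw [pushOffset]
      refine runs_congr (.mono (.seq (.push _ _ _) hr) ?_) ?_
      · simp; omega
      · simp
  | cons i t ih =>
    obtain ⟨l, hl, hr⟩ := ih (update S off (S (var i) ++ S off)) (by simpa using hS)
      (by simpa using hn)
    refine ⟨l ++ S (var i), by simp at hl ⊢; omega, ?_⟩
    rw [pushOffset]
    refine runs_congr (.mono (.seq (copy_runs (by simp) (by simp) (by simp) S hS) hr) ?_) ?_
    · have := hn i
      simp only [List.length_cons]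
      nlinarith
    · simp

/-- Pop `off` empty, moving one symbol from `k` to `tmp` each time. -/
def skipOffset (k : Stk) : Cmd Stk Symb :=
  loop off fun _ => pop k fun o => o.elim skip fun b => push tmp b

/-- The skipped symbols wait on `tmp` in reversed order, ready to be moved back. If `k` runs out
early, the rest of the counter is discarded without effect, which agrees with the truncation in
`take` and `drop`. -/
theorem skipOffset_runs {k : Stk} (hk : k ≠ tmp) (hk' : k ≠ off) (S : Stk → List Symb) :
    Runs (skipOffset k) S (update (update (update S off []) tmp
      (((S k).take (S off).length).reverse ++ S tmp)) k ((S k).drop (S off).length))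
      (3 * (S off).length + 1) := by
  generalize hl : S off = l
  induction l generalizing S with
  | nil =>
    refine runs_congr (.loop_nil hl) ?_
    funext i
    simp only [update_apply]
    split_ifs <;> simp_all
  | cons a l ih =>
    rcases hb : S k with _ | ⟨b, l'⟩
    · refine runs_congr (.mono (.loop_cons hl (.pop (S' := update S off l) (t := 1) ?_)
        (ih _ ?_)) ?_) ?_
      · simp only [update_of_ne hk', hb]
        refine runs_congr (.skip _) ?_
        funext i
        simp only [update_apply]
        split_ifs <;> simp_all
      · simp
      · simp only [List.length_cons]; omega
      · funext i
        simp only [update_apply]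
        split_ifs <;> simp_all
    · refine runs_congr (.mono (.loop_cons hl (.pop (t := 1)
        (S' := update (update (update S off l) k l') tmp (b :: S tmp)) ?_) (ih _ ?_)) ?_) ?_
      · simp only [update_of_ne hk', hb]
        refine runs_congr (.push _ _ _) ?_
        funext i
        simp only [update_apply]
        split_ifs <;> simp_all
      · simp [hk'.symm]
      · simp only [List.length_cons]; omega
      · funext i
        simp only [update_apply]
        split_ifs <;> simp_all
end programs

end ReadOnce

namespace ReadOnce

open Function Stk Cmd

/-! ### Correctness and running time of the evaluator -/

namespace Form

/-- The program that evaluates a formula at depth `d` and pushes the answer onto `res`. -/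
def eval : Form → ℕ → Cmd Stk Symb
  | atom s a t c, _ =>
    seq (pushOffset t c) (seq (skipOffset (src s)) (seq
      (pop (src s) fun o => o.elim (push res (.sign false)) fun b =>
        seq (push (src s) b) (push res (.sign (decide (b = a)))))
      (move tmp (src s))))
  | neg φ, d => seq (eval φ d) (pop res fun o => push res (.sign (decide (o ≠ some (.sign true)))))
  | and φ ψ, d => seq (eval φ d)
      (pop res fun o => if o = some (.sign true) then eval ψ d else push res (.sign false))
  | ex s φ, d =>
    seq (copy (src s) (ctl d)) (seq (push res (.sign false)) (seq
      (loop (ctl d) fun _ => seq (eval φ (d + 1)) (seq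
        (pop res fun o => if o = some (.sign true) then pop res fun _ => push res (.sign true)
          else skip)
        (push (var d) .clauseEnd)))
      (clear (var d))))
  | iter φ ψ, d =>
    seq (copy word (ctl d)) (seq
      (loop (ctl d) fun _ => seq (copy word (ctl (d + 1))) (seq
        (loop (ctl (d + 1)) fun _ => seq (eval φ (d + 2)) (seq
          (pop res fun o => o.elim skip (push (aux d)))
          (push (var (d + 1)) .clauseEnd)))
        (seq (clear (var (d + 1))) (seq (clear (var d)) (move (aux d) (var d))))))
      (seq (eval ψ (d + 1)) (clear (var d))))

open Polynomial in
/-- The running time of the evaluator. -/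
noncomputable def time : Form → ℕ[X]
  | atom _ _ t c => ((t.length : ℕ[X]) * (5 * X + 2) + (c : ℕ[X]) + 1) +
    (3 * ((t.length : ℕ[X]) * X + (c : ℕ[X])) + 1)
      + 4 + (2 * X + 1)
  | neg φ => time φ + 2
  | and φ ψ => time φ + time ψ + 2
  | ex _ φ => (5 * X + 2) + 1 + (X * (time φ + 5) + 1) + (2 * X + 1)
  | iter φ ψ => (5 * X + 2) + (X * ((5 * X + 2) + (X * (time φ + 4) + 1) + (2 * X + 1) + (2 * X + 1)
      + (2 * X + 1) + 1) + 1) + time ψ + (2 * X + 1)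

/-- The states in which a formula at depth `d` can be evaluated. -/
structure Good (d : ℕ) (S : Stk → List Symb) : Prop where
  tmp : S tmp = []
  off : S off = []
  var : ∀ i, d ≤ i → S (var i) = []
  ctl : ∀ i, d ≤ i → S (ctl i) = []
  aux : ∀ i, d ≤ i → S (aux i) = []
  le : ∀ i, (S (.var i)).length ≤ (S word).length

/-- The values of the variables in a state. -/
def env (S : Stk → List Symb) (i : ℕ) : List Symb := S (var i)

theorem get_eq (S : Stk → List Symb) (s : Option ℕ) : get (S word) (env S) s = S (src s) := by
  cases s <;> rfl

theorem env_update_var (S : Stk → List Symb) (i : ℕ) (l : List Symb) :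
    env (update S (var i) l) = update (env S) i l := by
  funext j
  simp [env, update_apply]

theorem env_update (S : Stk → List Symb) (k : Stk) (l : List Symb) (hk : ∀ i, var i ≠ k) :
    env (update S k l) = env S := by
  funext j
  simp [env, hk]

theorem src_ne (s : Option ℕ) : src s ≠ tmp ∧ src s ≠ off ∧ src s ≠ res ∧ ∀ i, src s ≠ ctl i := by
  cases s <;> simp [src]

theorem sum_le_length_mul (n : ℕ) (f : ℕ → ℕ) (hf : ∀ i, f i ≤ n) (t : List ℕ) :
    (t.map f).sum ≤ t.length * n := by
  induction t with
  | nil => simp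
  | cons i t ih =>
    have := hf i
    simp only [List.map_cons, List.sum_cons, List.length_cons]
    nlinarith

theorem Good.src_le {d : ℕ} {S : Stk → List Symb} (h : Good d S) (s : Option ℕ) :
    (S (src s)).length ≤ (S word).length := by
  cases s
  · exact le_rfl
  · exact h.le _

open Classical in
/-- The specification of the evaluator for the formula `φ`. -/
def EvalSpec (φ : Form) : Prop :=
  ∀ d S, Good d S → Runs (eval φ d) S
    (update S res (.sign (decide (holds (S word) φ d (env S))) :: S res))
    ((time φ).eval (S word).length)

open Classical in
-- The offset counts down to the entry in question, which is then on top of its stack. It is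
-- inspected and put back, and the skipped symbols return from `tmp`.
theorem evalSpec_atom (s : Option ℕ) (a : Symb) (t : List ℕ) (c : ℕ) :
    EvalSpec (atom s a t c) := by
  intro d S hS
  obtain ⟨l, hl, hr⟩ := pushOffset_runs (S word).length t c S hS.tmp hS.le
  obtain ⟨n1, n2, n3, n4⟩ := src_ne s
  have hlen := hS.src_le s
  have hsum := sum_le_length_mul _ (fun i => (S (.var i)).length) hS.le t
  rw [eval]
  have hr2 := skipOffset_runs n1 n2 (update S off (l ++ S off))
  have key : Runs (pop (src s) fun o => o.elim (push res (.sign false)) fun b =>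
      seq (push (src s) b) (push res (.sign (decide (b = a)))))
      (update (update S tmp ((S (src s)).take l.length).reverse) (src s)
        ((S (src s)).drop l.length))
      (update (update (update S tmp ((S (src s)).take l.length).reverse) (src s)
        ((S (src s)).drop l.length)) res
        (.sign (decide ((S (src s))[l.length]? = some a)) :: S res)) 3 := by
    rcases hd : (S (src s)).drop l.length with _ | ⟨b, l'⟩
    · have : (S (src s))[l.length]? = none := by
        rw [← List.head?_drop, hd]; rfl
      refine .mono (.pop (t := 1) ?_) (by omega)
      simp only [update_self, List.head?_nil, Option.elim, List.tail_nil, this]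
      refine runs_congr (.push _ _ _) ?_
      funext i
      simp only [update_apply]
      split_ifs <;> simp_all
    · have : (S (src s))[l.length]? = some b := by
        rw [← List.head?_drop, hd]; rfl
      refine .mono (.pop (t := 2) ?_) (by omega)
      simp only [update_self, List.head?_cons, Option.elim, List.tail_cons, this]
      refine runs_congr (.seq (.push _ _ _) (.push _ _ _)) ?_
      funext i
      simp only [update_apply]
      split_ifs <;> simp_all
  have hr4 := move_runs (k := tmp) (j := src s) n1.symm
    (update (update (update S tmp ((S (src s)).take l.length).reverse) (src s)
        ((S (src s)).drop l.length)) res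
        (.sign (decide ((S (src s))[l.length]? = some a)) :: S res))
  have e1 : (update (update (update (update S off (l ++ S off)) off []) tmp
      (((update S off (l ++ S off) (src s)).take (update S off (l ++ S off) off).length).reverse ++
        update S off (l ++ S off) tmp)) (src s)
      ((update S off (l ++ S off) (src s)).drop (update S off (l ++ S off) off).length)) =
      (update (update S tmp ((S (src s)).take l.length).reverse) (src s)
        ((S (src s)).drop l.length)) := by
    have h1 := hS.tmp
    have h2 := hS.off
    funext i
    simp only [update_apply]
    split_ifs <;> simp_all
  rw [e1] at hr2
  refine runs_congr (.mono (.seq hr (.seq hr2 (.seq key hr4))) ?_) ?_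
  · simp only [time, Polynomial.eval_add, Polynomial.eval_mul, Polynomial.eval_natCast,
      Polynomial.eval_X, Polynomial.eval_one, Polynomial.eval_ofNat, update_self, n1.symm,
      ne_eq, not_false_eq_true, update_of_ne, List.length_reverse, List.length_take,
      List.length_append, hS.off, List.length_nil, reduceCtorEq, Nat.cast_id]
    rw [hl]
    have : min ((t.map fun i => (S (.var i)).length).sum + c) (S (src s)).length
        ≤ (S word).length := (min_le_right _ _).trans hlen
    omega
  · have h1 := hS.tmp
    simp only [holds, get_eq, ← show ∀ i, (S (.var i)) = env S i from fun _ => rfl]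
    rw [← hl]
    funext i
    simp only [update_apply]
    split_ifs <;> simp_all

open Classical in
theorem evalSpec_neg {φ : Form} (h : EvalSpec φ) : EvalSpec (neg φ) := by
  intro d S hS
  rw [eval]
  refine runs_congr (.mono (.seq (h d S hS) (.pop (.push _ _ _))) ?_) ?_
  · simp [time]
  · by_cases hφ : holds (S word) φ d (env S) <;> simp [holds, hφ]

open Classical in
theorem evalSpec_and {φ ψ : Form} (h : EvalSpec φ) (h' : EvalSpec ψ) : EvalSpec (and φ ψ) := by
  intro d S hS
  rw [eval]
  by_cases hφ : holds (S word) φ d (env S)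
  · refine runs_congr (.mono (.seq (h d S hS) (.pop (S' := update S res
      (.sign (decide (holds (S word) ψ d (env S))) :: S res))
      (t := (time ψ).eval (S word).length) ?_)) ?_) ?_
    · simpa [hφ] using h' d S hS
    · simp [time]; omega
    · simp [holds, hφ]
  · refine runs_congr (.mono (.seq (h d S hS) (.pop (S' := update S res (.sign false :: S res))
      (t := 1) ?_)) ?_) ?_
    · simpa [hφ] using Runs.push res (.sign false) S
    · simp only [time, Polynomial.eval_add, Polynomial.eval_ofNat]; omega
    · simp [holds, hφ]

/-- Inside a quantifier the stacks of index `d` are occupied while those above are still empty, so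
the body can be evaluated one level deeper. Nothing is required of `res`, which lets partial answers
pile up there. -/
theorem good_succ {d : ℕ} {S : Stk → List Symb} (hS : Good d S) (l L R : List Symb)
    (hp : L.length ≤ (S word).length) :
    Good (d + 1) (update (update (update S (ctl d) l) (var d) L) res R) := by
  obtain ⟨h1, h2, h3, h4, h5, h6⟩ := hS
  refine ⟨by simpa, by simpa, fun i hi => ?_, fun i hi => ?_, fun i hi => ?_, fun i => ?_⟩
  · simpa [show i ≠ d by omega] using h3 i (by omega)
  · simpa [show i ≠ d by omega] using h4 i (by omega)
  · simpa using h5 i (by omega)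
  · by_cases hi : i = d
    · subst hi; simpa using hp
    · simpa [hi] using h6 i

open Classical in
-- Loop invariant: the values below `p` have been tried, `var d` holds `p` in unary, and the top of
-- `res` is the disjunction `b` of the answers so far. The remaining length of `ctl d` bounds the
-- values still to be tried.
theorem ex_loop_runs {φ : Form} (h : EvalSpec φ) {d : ℕ} {S : Stk → List Symb} (hS : Good d S)
    (l : List Symb) (p : ℕ) (hp : p + l.length ≤ (S word).length) (b : Bool) (R : List Symb) :
    Runs (loop (ctl d) fun _ => seq (eval φ (d + 1)) (seq
        (pop res fun o => if o = some (.sign true) then pop res fun _ => push res (.sign true)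
          else skip)
        (push (var d) .clauseEnd)))
      (update (update (update S (ctl d) l) (var d) (unary p)) res (.sign b :: R))
      (update (update S (var d) (unary (p + l.length))) res (.sign (decide (b = true ∨
        ∃ q, p ≤ q ∧ q < p + l.length ∧ holds (S word) φ (d + 1) (update (env S) d (unary q)))) ::
        R))
      (l.length * ((time φ).eval (S word).length + 5) + 1) := by
  induction l generalizing p b with
  | nil =>
    refine runs_congr (.mono (.loop_nil (by simp)) (by simp)) ?_
    have : ¬ ∃ q, p ≤ q ∧ q < p + ([] : List Symb).length ∧
        holds (S word) φ (d + 1) (update (env S) d (unary q)) := by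
      rintro ⟨q, h1, h2, -⟩
      simp at h2; omega
    have h2 := hS.ctl d le_rfl
    funext i
    simp only [update_apply, this]
    split_ifs <;> simp_all
  | cons a l ih =>
    simp only [List.length_cons] at hp ⊢
    have hG := good_succ hS l (unary p) (.sign b :: R) (by simp; omega)
    have hr := h (d + 1) _ hG
    have he : env (update (update (update S (ctl d) l) (var d) (unary p)) res (.sign b :: R)) =
        update (env S) d (unary p) := by
      rw [env_update _ _ _ (by simp), env_update_var, env_update _ _ _ (by simp)]
    rw [he] at hr
    simp only [ne_eq, reduceCtorEq, not_false_eq_true, update_of_ne, update_self, update_idem]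
      at hr
    have e0 : update (update (update (update S (ctl d) (a :: l)) (var d) (unary p)) res
        (.sign b :: R)) (ctl d) l =
        update (update (update S (ctl d) l) (var d) (unary p)) res (.sign b :: R) := by
      funext i
      simp only [update_apply]
      split_ifs <;> simp_all
    set H := holds (S word) φ (d + 1) (update (env S) d (unary p)) with hH
    have hstep : Runs (pop res fun o => if o = some (.sign true) then
        pop res fun _ => push res (.sign true) else skip)
        (update (update (update S (ctl d) l) (var d) (unary p)) res
          (.sign (decide H) :: .sign b :: R))
        (update (update (update S (ctl d) l) (var d) (unary p)) res
          (.sign (decide (b = true ∨ H)) :: R)) 3 := by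
      by_cases hH' : H
      · refine .mono (.pop (t := 2) ?_) le_rfl
        simp only [hH', update_self, List.head?_cons, decide_true, if_true, List.tail_cons,
          update_idem, or_true]
        refine .pop ?_
        simpa using Runs.push res (.sign true)
          (update (update (update S (ctl d) l) (var d) (unary p)) res R)
      · refine .mono (.pop (t := 1) ?_) (by omega)
        simpa [hH'] using Runs.skip _
    have ih' := ih (p + 1) (by omega) (decide (b = true ∨ H))
    have hbody := Runs.seq hr (.seq hstep (.push (var d) .clauseEnd _))
    rw [← e0] at hbody
    refine Runs.mono (.loop_cons (a := a) (l := l) (by simp) hbody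
      (t' := l.length * ((time φ).eval (S word).length + 5) + 1) ?_) ?_
    · have e1 : p + 1 + l.length = p + (l.length + 1) := by omega
      -- The answer for the value `p` passes from the accumulated bit into the range of the
      -- quantifier.
      have e2 : ((decide (b = true ∨ H)) = true ∨ ∃ q, p + 1 ≤ q ∧ q < p + (l.length + 1) ∧
            holds (S word) φ (d + 1) (update (env S) d (unary q))) =
          (b = true ∨ ∃ q, p ≤ q ∧ q < p + (l.length + 1) ∧
            holds (S word) φ (d + 1) (update (env S) d (unary q))) := by
        refine propext ⟨?_, ?_⟩
        · rintro (h | ⟨q, h1, h2, h3⟩)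
          · rcases of_decide_eq_true h with h | h
            · exact .inl h
            · exact .inr ⟨p, le_rfl, by omega, h⟩
          · exact .inr ⟨q, by omega, h2, h3⟩
        · rintro (h | ⟨q, h1, h2, h3⟩)
          · exact .inl (decide_eq_true (.inl h))
          · rcases h1.eq_or_lt with rfl | h1
            · exact .inl (decide_eq_true (.inr h3))
            · exact .inr ⟨q, h1, h2, h3⟩
      rw [e1] at ih'
      simp only [e2] at ih'
      convert ih' using 1
      funext i
      simp only [update_apply]
      split_ifs <;> simp_all [unary, List.replicate_succ]
    · have : (l.length + 1) * ((time φ).eval (S word).length + 5) =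
        l.length * ((time φ).eval (S word).length + 5) + ((time φ).eval (S word).length + 5) := by
        ring
      omega

open Classical in
theorem evalSpec_ex {φ : Form} (s : Option ℕ) (h : EvalSpec φ) : EvalSpec (ex s φ) := by
  intro d S hS
  obtain ⟨n1, n2, n3, n4⟩ := src_ne s
  have hlen := hS.src_le s
  rw [eval]
  have hc := copy_runs (k := src s) (j := ctl d) (n4 d) n1 (by simp) S hS.tmp
  have hl := ex_loop_runs h hS (S (src s)) 0 (by simpa using hlen) false (S res)
  have hcl := clear_runs (var d) (update (update S (var d) (unary (0 + (S (src s)).length))) res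
    (.sign (decide (false = true ∨ ∃ q, 0 ≤ q ∧ q < 0 + (S (src s)).length ∧
      holds (S word) φ (d + 1) (update (env S) d (unary q)))) :: S res))
  have h1 := hS.ctl d le_rfl
  have h2 := hS.var d le_rfl
  refine runs_congr (.mono (.seq hc (.seq (.push _ _ _) (.seq
    (t := (S word).length * ((time φ).eval (S word).length + 5) + 1) ?_ hcl))) ?_) ?_
  · refine .mono ?_ (Nat.add_le_add_right (Nat.mul_le_mul_right _ hlen) 1)
    convert hl using 1
    funext i
    simp only [update_apply]
    split_ifs <;> simp_all [unary]
  · simp [time]; omega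
  · have e : (holds (S word) (ex s φ) d (env S)) = (false = true ∨ ∃ q, 0 ≤ q ∧
        q < 0 + (S (src s)).length ∧
        holds (S word) φ (d + 1) (update (env S) d (unary q))) := by
      simp [holds, get_eq]
    simp only [e]
    funext i
    simp only [update_apply]
    split_ifs <;> simp_all

open Classical in
-- The new set is collected on `aux d` because `φ` still consults the old one on `var d`. The bits
-- pile up in reversed order; the later move to `var d` corrects this.
theorem comprehension_loop_runs {φ : Form} (h : EvalSpec φ) {d : ℕ} {S : Stk → List Symb}
    (hS : Good (d + 1) S) (l : List Symb) (p : ℕ) (hp : p + l.length ≤ (S word).length)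
    (Q : List Symb) :
    Runs (loop (ctl (d + 1)) fun _ => seq (eval φ (d + 2)) (seq
          (pop res fun o => o.elim skip (push (aux d)))
          (push (var (d + 1)) .clauseEnd)))
      (update (update (update (update S (aux d) Q) (ctl (d + 1)) l) (var (d + 1)) (unary p))
        res (S res))
      (update (update (update S (aux d) (((List.range' p l.length).map fun q => Symb.sign (decide
        (holds (S word) φ (d + 2) (update (env S) (d + 1) (unary q))))).reverse ++ Q))
        (var (d + 1)) (unary (p + l.length))) res (S res))
      (l.length * ((time φ).eval (S word).length + 4) + 1) := by
  induction l generalizing p Q with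
  | nil =>
    refine runs_congr (.mono (.loop_nil (by simp)) (by simp)) ?_
    have h2 := hS.ctl (d + 1) le_rfl
    funext i
    simp only [update_apply]
    split_ifs <;> simp_all
  | cons a l ih =>
    simp only [List.length_cons] at hp ⊢
    have hS' : Good (d + 1) (update S (aux d) Q) := by
      obtain ⟨h1, h2, h3, h4, h5, h6⟩ := hS
      refine ⟨by simpa, by simpa, by simpa, by simpa, fun i hi => ?_, by simpa⟩
      simpa [show i ≠ d by omega] using h5 i hi
    have hG := good_succ hS' l (unary p) (S res) (by simp; omega)
    have hr := h (d + 2) _ hG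
    have he : env (update (update (update (update S (aux d) Q) (ctl (d + 1)) l) (var (d + 1))
        (unary p)) res (S res)) = update (env S) (d + 1) (unary p) := by
      rw [env_update _ _ _ (by simp), env_update_var, env_update _ _ _ (by simp),
        env_update _ _ _ (by simp)]
    rw [he] at hr
    simp only [ne_eq, reduceCtorEq, not_false_eq_true, update_of_ne, update_self, update_idem]
      at hr
    have e0 : update (update (update (update (update S (aux d) Q) (ctl (d + 1)) (a :: l))
        (var (d + 1)) (unary p)) res (S res)) (ctl (d + 1)) l =
        update (update (update (update S (aux d) Q) (ctl (d + 1)) l) (var (d + 1)) (unary p))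
        res (S res) := by
      funext i
      simp only [update_apply]
      split_ifs <;> simp_all
    set H := holds (S word) φ (d + 2) (update (env S) (d + 1) (unary p)) with hH
    have hstep : Runs (pop res fun o => o.elim skip (push (aux d)))
        (update (update (update (update S (aux d) Q) (ctl (d + 1)) l) (var (d + 1)) (unary p))
        res (.sign (decide H) :: S res))
        (update (update (update (update S (aux d) (.sign (decide H) :: Q)) (ctl (d + 1)) l)
          (var (d + 1)) (unary p)) res (S res)) 2 := by
      refine .pop ?_
      simp only [update_self, List.head?_cons, Option.elim, List.tail_cons, update_idem]
      refine runs_congr (.push _ _ _) ?_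
      funext i
      simp only [update_apply]
      split_ifs <;> simp_all
    have ih' := ih (p + 1) (by omega) (.sign (decide H) :: Q)
    have hbody := Runs.seq hr (.seq hstep (.push (var (d + 1)) .clauseEnd _))
    rw [← e0] at hbody
    refine Runs.mono (.loop_cons (a := a) (l := l) (by simp) hbody
      (t' := l.length * ((time φ).eval (S word).length + 4) + 1) ?_) ?_
    · have e1 : p + 1 + l.length = p + (l.length + 1) := by omega
      rw [e1] at ih'
      convert ih' using 1
      · funext i
        simp only [update_apply]
        split_ifs <;> simp_all [unary, List.replicate_succ]
      · rw [List.range'_succ, List.map_cons, List.reverse_cons, List.append_assoc,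
          List.singleton_append]
    · have : (l.length + 1) * ((time φ).eval (S word).length + 4) =
        l.length * ((time φ).eval (S word).length + 4) + ((time φ).eval (S word).length + 4) := by
        ring
      omega

theorem length_bits (n : ℕ) (P : ℕ → Prop) : (bits n P).length = n := by
  simp [bits]

theorem iter_body_runs {φ : Form} (h : EvalSpec φ) {d : ℕ} {S : Stk → List Symb}
    (hS : Good d S) (l L : List Symb) (hL : L.length ≤ (S word).length) :
    Runs (seq (copy word (ctl (d + 1))) (seq
        (loop (ctl (d + 1)) fun _ => seq (eval φ (d + 2)) (seq
          (pop res fun o => o.elim skip (push (aux d)))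
          (push (var (d + 1)) .clauseEnd)))
        (seq (clear (var (d + 1))) (seq (clear (var d)) (move (aux d) (var d))))))
      (update (update S (ctl d) l) (var d) L)
      (update (update S (ctl d) l) (var d) (bits (S word).length fun p =>
        holds (S word) φ (d + 2) (update (update (env S) d L) (d + 1) (unary p))))
      ((5 * (S word).length + 2) + ((S word).length * ((time φ).eval (S word).length + 4) + 1) +
        (2 * (S word).length + 1) + (2 * (S word).length + 1) + (2 * (S word).length + 1)) := by
  have hG := good_succ hS l L (S res) hL
  have eG : update (update (update S (ctl d) l) (var d) L) res (S res) =
      update (update S (ctl d) l) (var d) L := by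
    funext i
    simp only [update_apply]
    split_ifs <;> simp_all
  rw [eG] at hG
  set S₁ := update (update S (ctl d) l) (var d) L with hS₁
  have hw : S₁ word = S word := by simp [hS₁]
  have hr : S₁ res = S res := by simp [hS₁]
  have henv : env S₁ = update (env S) d L := by
    rw [hS₁, env_update_var, env_update _ _ _ (by simp)]
  have hc := copy_runs (k := word) (j := ctl (d + 1)) (by simp) (by simp) (by simp) S₁ hG.tmp
  have hl := comprehension_loop_runs h hG (S word) 0 (by simp [hw]) []
  rw [henv, hw, hr, ← List.range_eq_range', ← bits.eq_def] at hl
  set B := bits (S word).length fun p =>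
        holds (S word) φ (d + 2) (update (update (env S) d L) (d + 1) (unary p)) with hB
  have hBl : B.length = (S word).length := length_bits _ _
  have hvd : S (var d) = [] := hS.var d le_rfl
  have hvd' : S (var (d + 1)) = [] := hS.var (d + 1) (by omega)
  have had : S (aux d) = [] := hS.aux d le_rfl
  have hcd : S (ctl d) = [] := hS.ctl d le_rfl
  have hcd' : S (ctl (d + 1)) = [] := hS.ctl (d + 1) (by omega)
  have e1 : update S₁ (ctl (d + 1)) (S₁ word ++ S₁ (ctl (d + 1))) =
      update (update (update (update S₁ (aux d) []) (ctl (d + 1)) (S word)) (var (d + 1)) (unary 0))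
        res (S res) := by
    funext i
    simp only [update_apply, hS₁]
    split_ifs <;> simp_all [unary]
  rw [← e1] at hl
  refine runs_congr (.mono (.seq hc (.seq hl (.seq (clear_runs _ _) (.seq (clear_runs _ _)
    (move_runs (by simp) _))))) ?_) ?_
  · simp [hS₁, hBl]; omega
  · funext i
    simp only [update_apply, hS₁]
    split_ifs <;> simp_all

/-- Every iterate is empty or a list of bits as long as the word. So the states stay good, and each
of the `(S word).length` rounds has the same polynomial bound `T`. -/
theorem evalSpec_iter {φ ψ : Form} (h : EvalSpec φ) (h' : EvalSpec ψ) : EvalSpec (iter φ ψ) := by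
  classical
  intro d S hS
  set f : List Symb → List Symb := fun L => bits (S word).length fun p =>
    holds (S word) φ (d + 2) (update (update (env S) d L) (d + 1) (unary p)) with hf
  have hfl : ∀ n, (f^[n] []).length ≤ (S word).length := by
    intro n
    cases n with
    | zero => simp
    | succ n => rw [iterate_succ_apply']; exact (length_bits _ _).le
  set T := (5 * (S word).length + 2) + ((S word).length * ((time φ).eval (S word).length + 4) + 1) +
        (2 * (S word).length + 1) + (2 * (S word).length + 1) + (2 * (S word).length + 1) with hT
  have key : ∀ (l : List Symb) (n : ℕ), Runs (loop (ctl d) fun _ =>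
        seq (copy word (ctl (d + 1))) (seq
        (loop (ctl (d + 1)) fun _ => seq (eval φ (d + 2)) (seq
          (pop res fun o => o.elim skip (push (aux d)))
          (push (var (d + 1)) .clauseEnd)))
        (seq (clear (var (d + 1))) (seq (clear (var d)) (move (aux d) (var d))))))
      (update (update S (ctl d) l) (var d) (f^[n] []))
      (update S (var d) (f^[n + l.length] [])) (l.length * (T + 1) + 1) := by
    intro l
    induction l with
    | nil =>
      intro n
      refine runs_congr (.mono (.loop_nil (by simp)) (by simp)) ?_
      have := hS.ctl d le_rfl
      funext i
      simp only [update_apply]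
      split_ifs <;> simp_all
    | cons a l ih =>
      intro n
      have hb := iter_body_runs h hS l _ (hfl n)
      have ih' := ih (n + 1)
      have e : n + 1 + l.length = n + (l.length + 1) := by omega
      rw [iterate_succ_apply', e] at ih'
      have e0 : update (update (update S (ctl d) (a :: l)) (var d) (f^[n] [])) (ctl d) l =
          update (update S (ctl d) l) (var d) (f^[n] []) := by
        funext i
        simp only [update_apply]
        split_ifs <;> simp_all
      rw [← e0] at hb
      refine .mono (.loop_cons (a := a) (l := l) (by simp) hb ih') ?_
      simp only [List.length_cons]
      have : (l.length + 1) * (T + 1) = l.length * (T + 1) + (T + 1) := by ring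
      omega
  have hG := good_succ hS [] (f^[(S word).length] []) (S res) (hfl _)
  have hc := copy_runs (k := word) (j := ctl d) (by simp) (by simp) (by simp) S hS.tmp
  have hvd : S (var d) = [] := hS.var d le_rfl
  have hcd : S (ctl d) = [] := hS.ctl d le_rfl
  have hk := key (S word) 0
  rw [zero_add] at hk
  have e1 : update (update S (ctl d) (S word)) (var d) (f^[0] []) =
      update S (ctl d) (S word ++ S (ctl d)) := by
    funext i
    simp only [update_apply]
    split_ifs <;> simp_all
  rw [e1] at hk
  have e2 : update (update (update S (ctl d) []) (var d) (f^[(S word).length] [])) res (S res) =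
      update S (var d) (f^[(S word).length] []) := by
    funext i
    simp only [update_apply]
    split_ifs <;> simp_all
  rw [e2] at hG
  have hψ := h' (d + 1) _ hG
  rw [eval]
  refine runs_congr (.mono (.seq hc (.seq hk (.seq hψ (clear_runs _ _)))) ?_) ?_
  · have := hfl (S word).length
    simp only [time, Polynomial.eval_add, Polynomial.eval_mul, Polynomial.eval_X,
      Polynomial.eval_one, Polynomial.eval_ofNat, ne_eq, reduceCtorEq, not_false_eq_true,
      update_of_ne, update_self, ← hT]
    omega
  · rw [env_update_var]
    simp only [holds, ← hf, ne_eq, reduceCtorEq, not_false_eq_true, update_of_ne]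
    funext i
    simp only [update_apply]
    split_ifs <;> simp_all

theorem evalSpec (φ : Form) : EvalSpec φ := by
  induction φ with
  | atom s a t c => exact evalSpec_atom s a t c
  | neg φ h => exact evalSpec_neg h
  | and φ ψ h h' => exact evalSpec_and h h'
  | ex s φ h => exact evalSpec_ex s h
  | iter φ ψ h h' => exact evalSpec_iter h h'

/-- A sentence that holds of the reversed words of a language puts the language in **P**. -/
theorem inP_of_holds (L : Set (List Symb)) (φ : Form)
    (h : ∀ w, w ∈ L ↔ holds w.reverse φ 0 fun _ => []) : InP L := by
  classical
  -- Moving the input to the working stack reverses it, which is why formulas speak about reversed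
  -- words. The final `clear` leaves nothing but the answer.
  refine inP_of_runs L (seq (move input word) (seq (eval φ 0) (clear word))) input res
    (.sign true) (4 * Polynomial.X + 2 + time φ) fun w => ?_
  refine ⟨.sign (decide (holds w.reverse φ 0 fun _ => [])), by simp [h], ?_⟩
  have h1 := move_runs (k := input) (j := word) (by simp) (update (fun _ => []) input w)
  have e1 : update (update (update (fun _ => []) input w) input []) word
      ((update (fun _ => []) input w input).reverse ++ update (fun _ => []) input w word) =
      update (fun _ => []) word w.reverse := by
    funext i
    simp only [update_apply]
    split_ifs <;> simp_all
  rw [e1] at h1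
  have h2 := evalSpec φ 0 (update (fun _ => []) word w.reverse)
    ⟨by simp, by simp, by simp, by simp, by simp, by simp⟩
  refine runs_congr (.mono (.seq h1 (.seq h2 (clear_runs _ _))) ?_) ?_
  · simp; omega
  · have : env (update (fun _ => []) word w.reverse) = fun _ => [] := by
      funext i; simp [env]
    rw [this]
    funext i
    simp only [update_apply]
    split_ifs <;> simp_all

end Form

end ReadOnce

namespace ReadOnce

/-! ### Read-once resolution on multisets of clauses -/

/-- The complement of a literal. -/
def Literal.opp (l : Literal) : Literal := (l.1, !l.2)

open Literal

@[simp] theorem opp_opp (l : Literal) : opp (opp l) = l := by simp [opp]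

@[simp] theorem opp_fst (l : Literal) : (opp l).1 = l.1 := rfl

theorem opp_ne (l : Literal) : opp l ≠ l := by
  rcases l with ⟨x, b⟩
  cases b <;> simp [opp]

theorem ne_opp (l : Literal) : l ≠ opp l := (opp_ne l).symm

theorem opp_injective : Function.Injective opp :=
  Function.LeftInverse.injective opp_opp

theorem eq_or_eq_opp {l m : Literal} (h : l.1 = m.1) : l = m ∨ l = opp m := by
  rcases l with ⟨x, b⟩
  rcases m with ⟨y, c⟩
  obtain rfl : x = y := h
  cases b <;> cases c <;> simp [opp]

theorem eq_opp_comm {l m : Literal} : l = opp m ↔ m = opp l :=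
  ⟨fun h => by rw [h, opp_opp], fun h => by rw [h, opp_opp]⟩

/-- An assignment satisfies a clause. -/
def SatClause (v : ℕ → Bool) (c : Clause) : Prop := ∃ l ∈ c, v l.1 = l.2

/-- The literal `l` is true under `v`. -/
theorem val_opp (v : ℕ → Bool) (l : Literal) : v (opp l).1 = (opp l).2 ↔ ¬ v l.1 = l.2 := by
  rcases l with ⟨x, b⟩
  cases b <;> simp [opp]

/-- A read-once resolution step on a multiset of clauses. -/
def MStep (M N : Multiset Clause) : Prop :=
  ∃ c d r M₀, IsResolvent c d r ∧ M = c ::ₘ d ::ₘ M₀ ∧ N = r ::ₘ M₀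

/-- Reachability by read-once resolution steps. -/
abbrev MReach : Multiset Clause → Multiset Clause → Prop := Relation.ReflTransGen MStep

theorem IsResolvent.sound {c d r : Clause} (h : IsResolvent c d r) {v : ℕ → Bool}
    (hc : SatClause v c) (hd : SatClause v d) : SatClause v r := by
  obtain ⟨x, hxc, hxd, rfl⟩ := h
  obtain ⟨l, hl, hv⟩ := hc
  obtain ⟨m, hm, hv'⟩ := hd
  by_cases h : l = (x, true)
  · have : m ≠ (x, false) := by
      rintro rfl
      subst h
      simp at hv hv'
      simp [hv] at hv'
    exact ⟨m, by simp [this, hm], hv'⟩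
  · exact ⟨l, by simp [h, hl], hv⟩

theorem MReach.sound {M N : Multiset Clause} (h : MReach M N) {v : ℕ → Bool}
    (hM : ∀ c ∈ M, SatClause v c) : ∀ c ∈ N, SatClause v c := by
  induction h with
  | refl => exact hM
  | tail _ h ih =>
    obtain ⟨c, d, r, M₀, hr, rfl, rfl⟩ := h
    intro e he
    rcases Multiset.mem_cons.1 he with rfl | he
    · exact hr.sound (ih _ (by simp)) (ih _ (by simp))
    · exact ih _ (by simp [he])

theorem MReach.add_right {M N : Multiset Clause} (h : MReach M N) (P : Multiset Clause) :
    MReach (M + P) (N + P) := by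
  induction h with
  | refl => exact .refl
  | tail _ h ih =>
    obtain ⟨c, d, r, M₀, hr, rfl, rfl⟩ := h
    exact ih.tail ⟨c, d, r, M₀ + P, hr, by simp, by simp⟩

/-- This trims a derivation to what its result depends on. Going back over a step, keep both parents
if the resolvent is wanted and neither otherwise. -/
theorem MReach.exists_le {M N : Multiset Clause} (h : MReach M N) :
    ∀ N' ≤ N, ∃ M' ≤ M, MReach M' N' := by
  induction h with
  | refl => exact fun N' h => ⟨N', h, .refl⟩
  | tail _ h ih =>
    obtain ⟨c, d, r, M₀, hr, rfl, rfl⟩ := h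
    intro N' hN'
    by_cases hmem : r ∈ N'
    · obtain ⟨N'', rfl⟩ := Multiset.exists_cons_of_mem hmem
      obtain ⟨M', hM', hR⟩ := ih (c ::ₘ d ::ₘ N'')
        (Multiset.cons_le_cons _ (Multiset.cons_le_cons _ ((Multiset.cons_le_cons_iff r).1 hN')))
      exact ⟨M', hM', hR.tail ⟨c, d, r, N'', hr, rfl, rfl⟩⟩
    · have : N' ≤ M₀ := (Multiset.le_cons_of_notMem hmem).1 hN'
      exact ih N' (this.trans ((Multiset.le_cons_self _ _).trans (Multiset.le_cons_self _ _)))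

/-- A set forgets repetitions and a multiset does not, so the multiset derivation may carry more
copies; hence an inequality. -/
theorem exists_mReach_of_readOnceStep {Φ U : CNF} (h : Relation.ReflTransGen ReadOnceStep Φ U) :
    ∃ M, MReach Φ.val M ∧ U.val ≤ M := by
  induction h with
  | refl => exact ⟨_, .refl, le_rfl⟩
  | @tail U V _ h ih =>
    obtain ⟨M, hM, hU⟩ := ih
    obtain ⟨c, hc, d, hd, r, hr, rfl⟩ := h
    by_cases hcd : c = d
    -- A clause that resolves with itself is a tautology, and the resolvent is that clause again. So
    -- the step gains nothing.
    · subst hcd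
      refine ⟨M, hM, le_trans ?_ hU⟩
      obtain ⟨x, hx, hx', rfl⟩ := hr
      have : c.erase (x, true) ∪ c.erase (x, false) = c := by
        ext l
        simp only [Finset.mem_union, Finset.mem_erase]
        constructor
        · rintro (h | h) <;> exact h.2
        · intro h
          by_cases hl : l = (x, true)
          · exact .inr ⟨by simp [hl], h⟩
          · exact .inl ⟨hl, h⟩
      rw [this]
      exact Finset.val_le_iff.2 (by
        intro e he
        simp only [Finset.mem_union, Finset.mem_sdiff, Finset.mem_singleton] at he
        rcases he with he | rfl
        · exact he.1
        · exact hc)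
    · have hle : c ::ₘ d ::ₘ (U \ {c, d}).val ≤ U.val := by
        rw [Multiset.le_iff_subset]
        · intro e he
          simp only [Multiset.mem_cons, Finset.mem_val, Finset.mem_sdiff] at he
          rcases he with rfl | rfl | he
          exacts [hc, hd, he.1]
        · rw [Multiset.nodup_cons, Multiset.nodup_cons]
          refine ⟨?_, ?_, Finset.nodup _⟩
          · rw [Multiset.mem_cons, Finset.mem_val]; simp [hcd]
          · rw [Finset.mem_val]; simp
      obtain ⟨P, hP⟩ := Multiset.le_iff_exists_add.1 (hle.trans hU)
      refine ⟨r ::ₘ ((U \ {c, d}).val + P), hM.tail ⟨c, d, r, (U \ {c, d}).val + P, hr, ?_, rfl⟩,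
        ?_⟩
      · rw [hP]; simp
      · rw [Multiset.le_iff_subset (Finset.nodup _)]
        intro e he
        simp only [Finset.mem_val, Finset.mem_union, Finset.mem_singleton] at he
        rcases he with he | rfl
        · simp only [Multiset.mem_cons, Multiset.mem_add, Finset.mem_val]
          exact .inr (.inl he)
        · simp

/-- A multiset of clauses has a read-once refutation. -/
def Refutable (M : Multiset Clause) : Prop := ∃ N, MReach M (∅ ::ₘ N)

theorem Refutable.not_satisfiable {M : Multiset Clause} (h : Refutable M) (v : ℕ → Bool) :
    ¬ ∀ c ∈ M, SatClause v c := by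
  obtain ⟨N, hN⟩ := h
  intro hv
  obtain ⟨l, hl, -⟩ := hN.sound hv ∅ (by simp)
  simp at hl

/-! ### Minimal unsatisfiability under resolution steps -/

theorem MinimalUnsat.sat_erase {Φ : CNF} (h : MinimalUnsat Φ) {c : Clause} (hc : c ∈ Φ) :
    ∃ v, ∀ d ∈ Φ, d ≠ c → SatClause v d := by
  obtain ⟨v, hv⟩ := h.2 _ (Finset.erase_ssubset hc)
  exact ⟨v, fun d hd hdc => hv d (Finset.mem_erase.2 ⟨hdc, hd⟩)⟩

/-- Satisfiability passes to subsets, so removing one clause at a time suffices. This is also what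
keeps the test for minimality polynomial. -/
theorem minimalUnsat_of_erase {Φ : CNF} (h : ¬ Satisfiable Φ)
    (h' : ∀ c ∈ Φ, ∃ v, ∀ d ∈ Φ, d ≠ c → SatClause v d) : MinimalUnsat Φ := by
  refine ⟨h, fun Ψ hΨ => ?_⟩
  obtain ⟨c, hc, hcΨ⟩ := Finset.exists_of_ssubset hΨ
  obtain ⟨v, hv⟩ := h' c hc
  exact ⟨v, fun d hd => hv d (hΨ.1 hd) (by rintro rfl; exact hcΨ hd)⟩

/-- A resolvent follows from its parents; as a third clause of the formula it would be redundant. -/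
theorem MinimalUnsat.resolvent_notMem {Φ : CNF} (h : MinimalUnsat Φ) {c d r : Clause}
    (hr : IsResolvent c d r) (hc : c ∈ Φ) (hd : d ∈ Φ) (hrc : r ≠ c) (hrd : r ≠ d) : r ∉ Φ := by
  intro hrΦ
  obtain ⟨v, hv⟩ := h.sat_erase hrΦ
  refine h.1 ⟨v, fun e he => ?_⟩
  by_cases her : e = r
  · exact her ▸ hr.sound (hv c hc hrc.symm) (hv d hd hrd.symm)
  · exact hv e he her

/-- Without the resolvent, what is left is part of the formula without `c`. Without another clause
`e`, a model of the rest of `Φ` satisfies both parents and hence the resolvent. Unsatisfiability has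
to be assumed, since deleting the parents can lose it. -/
theorem MinimalUnsat.step {Φ : CNF} (h : MinimalUnsat Φ) {c d r : Clause}
    (hr : IsResolvent c d r) (hc : c ∈ Φ) (hd : d ∈ Φ)
    (hunsat : ¬ Satisfiable ((Φ \ {c, d}) ∪ {r})) : MinimalUnsat ((Φ \ {c, d}) ∪ {r}) := by
  refine minimalUnsat_of_erase hunsat fun e he => ?_
  simp only [Finset.mem_union, Finset.mem_sdiff, Finset.mem_insert, Finset.mem_singleton,
    not_or] at he
  by_cases her : e = r
  · subst her
    obtain ⟨v, hv⟩ := h.sat_erase hc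
    refine ⟨v, fun f hf hfr => ?_⟩
    simp only [Finset.mem_union, Finset.mem_sdiff, Finset.mem_insert, Finset.mem_singleton,
      not_or] at hf
    rcases hf with hf | hf
    · exact hv f hf.1 hf.2.1
    · exact absurd hf hfr
  · obtain ⟨he, hec, hed⟩ := he.resolve_right her
    obtain ⟨v, hv⟩ := h.sat_erase he
    refine ⟨v, fun f hf hfe => ?_⟩
    simp only [Finset.mem_union, Finset.mem_sdiff, Finset.mem_insert, Finset.mem_singleton,
      not_or] at hf
    rcases hf with hf | rfl
    · exact hv f hf.1 hfe
    · exact hr.sound (hv c hc (Ne.symm hec)) (hv d hd (Ne.symm hed))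

/-- The rest of the refutation shows that each intermediate multiset is unsatisfiable, so it stays
minimal unsatisfiable. Then a new resolvent is never already present, no duplicates arise, and the
multiset steps are steps on sets. -/
theorem ror_of_refutable {Φ : CNF} (h : MinimalUnsat Φ) (hΦ : Refutable Φ.val) : ROR Φ := by
  obtain ⟨N, hN⟩ := hΦ
  generalize hM : Φ.val = M at hN
  induction hN using Relation.ReflTransGen.head_induction_on generalizing Φ with
  | refl =>
    refine ⟨Φ, .refl, ?_⟩
    rw [← Finset.mem_val, hM]
    simp
  | @head M M' hstep hN ih =>
    obtain ⟨c, d, r, M₀, hr, rfl, rfl⟩ := hstep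
    have hc : c ∈ Φ := by rw [← Finset.mem_val, hM]; simp
    have hd : d ∈ Φ := by rw [← Finset.mem_val, hM]; simp
    have hnd : (c ::ₘ d ::ₘ M₀).Nodup := hM ▸ Φ.nodup
    simp only [Multiset.nodup_cons, Multiset.mem_cons, not_or] at hnd
    obtain ⟨⟨hcd, hcM⟩, hdM, hM₀⟩ := hnd
    have hval : (Φ \ {c, d}).val = M₀ := by
      refine (Multiset.Nodup.ext (Finset.nodup _) hM₀).2 fun e => ?_
      have : e ∈ Φ ↔ e = c ∨ e = d ∨ e ∈ M₀ := by rw [← Finset.mem_val, hM]; simp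
      simp only [Finset.mem_val, Finset.mem_sdiff, this, Finset.mem_insert, Finset.mem_singleton]
      constructor
      · tauto
      · intro he
        refine ⟨by tauto, ?_⟩
        rintro (rfl | rfl) <;> contradiction
    have hrM : r ∉ M₀ := by
      intro hrM
      have hrΦ : r ∈ Φ := by rw [← Finset.mem_val, hM]; simp [hrM]
      refine h.resolvent_notMem hr hc hd ?_ ?_ hrΦ <;> rintro rfl <;> contradiction
    have hval' : ((Φ \ {c, d}) ∪ {r}).val = r ::ₘ M₀ := by
      refine (Multiset.Nodup.ext (Finset.nodup _) (by simp [hrM, hM₀])).2 fun e => ?_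
      rw [Multiset.mem_cons, ← hval]
      simp only [Finset.mem_val, Finset.mem_union, Finset.mem_singleton]
      tauto
    have hunsat : ¬ Satisfiable ((Φ \ {c, d}) ∪ {r}) := by
      rintro ⟨v, hv⟩
      refine Refutable.not_satisfiable ⟨N, hN⟩ v fun e he => hv e ?_
      rwa [← Finset.mem_val, hval']
    obtain ⟨U, hU, hU'⟩ := ih (h.step hr hc hd hunsat) hval'
    exact ⟨U, hU.head ⟨c, hc, d, hd, r, hr, rfl⟩, hU'⟩

/-! ### Variables of odd degree -/

/-- The number of literals of a clause that belong to the variable `x`. -/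
def degIn (x : ℕ) (c : Clause) : ℕ := (c.filter fun l => l.1 = x).card

/-- The set `V` collects the variables of merged literals. A step lowers the number of clauses by
one and the number of occurrences by two plus the number of merges; the endpoint has one clause and
no occurrence. The resolved variable loses two occurrences, so parities change only through merges.
-/
theorem MReach.exists_odd {M : Multiset Clause} (h : MReach M {∅}) :
    ∃ V : Finset ℕ, V.card + 2 * M.card ≤ (M.map Finset.card).sum + 2 ∧
      ∀ x ∉ V, Even ((M.map (degIn x)).sum) := by
  induction h using Relation.ReflTransGen.head_induction_on with
  | refl => exact ⟨∅, by simp, by simp [degIn]⟩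
  | @head M M' hstep hN ih =>
    obtain ⟨c, d, r, M₀, ⟨x, hxc, hxd, hr⟩, rfl, rfl⟩ := hstep
    obtain ⟨V, hV, hV'⟩ := ih
    set I := c.erase (x, true) ∩ d.erase (x, false) with hI
    have hc : (c.erase (x, true)).card + 1 = c.card := Finset.card_erase_add_one hxc
    have hd : (d.erase (x, false)).card + 1 = d.card := Finset.card_erase_add_one hxd
    have hcard : r.card + I.card = (c.erase (x, true)).card + (d.erase (x, false)).card := by
      rw [hr, hI, Finset.card_union_add_card_inter]
    -- The literals in `I` are those that the two parents contribute twice and the resolvent keeps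
    -- once.
    refine ⟨V ∪ I.image Prod.fst, ?_, fun y hy => ?_⟩
    · have h1 := Finset.card_union_le V (I.image Prod.fst)
      have h2 : (I.image Prod.fst).card ≤ I.card := Finset.card_image_le
      simp only [Multiset.card_cons, Multiset.map_cons, Multiset.sum_cons] at hV ⊢
      omega
    · simp only [Finset.mem_union, not_or, Finset.mem_image, not_exists, not_and] at hy
      have hev := hV' y hy.1
      simp only [Multiset.map_cons, Multiset.sum_cons] at hev ⊢
      have e1 : degIn y r + (I.filter fun l => l.1 = y).card =
          degIn y (c.erase (x, true)) + degIn y (d.erase (x, false)) := by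
        simp only [degIn, hr, hI, Finset.filter_union, Finset.filter_inter_distrib]
        rw [Finset.card_union_add_card_inter]
      have e2 : (I.filter fun l => l.1 = y) = ∅ := by
        rw [Finset.filter_eq_empty_iff]
        exact fun l hl => hy.2 l hl
      have e3 : ∀ (c : Clause) (b : Bool), (x, b) ∈ c →
          degIn y c = degIn y (c.erase (x, b)) + if x = y then 1 else 0 := by
        intro c b hb
        simp only [degIn]
        conv_lhs => rw [← Finset.insert_erase hb]
        rw [Finset.filter_insert]
        split_ifs with hxy
        · rw [Finset.card_insert_of_notMem (by simp)]
        · rfl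
      rw [e2, Finset.card_empty] at e1
      rw [e3 c true hxc, e3 d false hxd]
      rw [show degIn y (c.erase (x, true)) + (if x = y then 1 else 0) +
          (degIn y (d.erase (x, false)) + (if x = y then 1 else 0) + (M₀.map (degIn y)).sum) =
          (degIn y r + (M₀.map (degIn y)).sum) + 2 * (if x = y then 1 else 0) by omega]
      exact hev.add (even_two_mul _)

/-- The number of clauses in which the variable `x` occurs. -/
def deg (Φ : CNF) (x : ℕ) : ℕ := (Φ.filter fun c => ∃ l ∈ c, l.1 = x).card

/-- A tautological clause would be redundant. Hence counting literals over a variable is the same as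
counting clauses that contain it. -/
theorem MinimalUnsat.opp_notMem {Φ : CNF} (h : MinimalUnsat Φ) {c : Clause} (hc : c ∈ Φ)
    {l : Literal} (hl : l ∈ c) : opp l ∉ c := by
  intro hl'
  obtain ⟨v, hv⟩ := h.sat_erase hc
  refine h.1 ⟨v, fun e he => ?_⟩
  by_cases hec : e = c
  · subst hec
    by_cases hvl : v l.1 = l.2
    · exact ⟨l, hl, hvl⟩
    · exact ⟨opp l, hl', (val_opp v l).2 hvl⟩
  · exact hv e he hec

theorem MinimalUnsat.degIn_eq {Φ : CNF} (h : MinimalUnsat Φ) {c : Clause} (hc : c ∈ Φ) (x : ℕ) :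
    degIn x c = if ∃ l ∈ c, l.1 = x then 1 else 0 := by
  split_ifs with hx
  · obtain ⟨l, hl, rfl⟩ := hx
    rw [degIn, Finset.card_eq_one]
    refine ⟨l, Finset.eq_singleton_iff_unique_mem.2 ⟨by simp [hl], fun m hm => ?_⟩⟩
    rw [Finset.mem_filter] at hm
    rcases eq_or_eq_opp hm.2 with rfl | rfl
    · rfl
    · exact absurd hm.1 (h.opp_notMem hc hl)
  · rw [degIn, Finset.card_eq_zero, Finset.filter_eq_empty_iff]
    exact fun l hl hlx => hx ⟨l, hl, hlx⟩

theorem MinimalUnsat.sum_degIn {Φ : CNF} (h : MinimalUnsat Φ) (x : ℕ) :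
    ∑ c ∈ Φ, degIn x c = deg Φ x := by
  rw [deg, Finset.card_filter]
  exact Finset.sum_congr rfl fun c hc => h.degIn_eq hc x

/-- A read-once refutable minimal unsatisfiable 2CNF formula has at most two variables of odd
degree. -/
theorem MinimalUnsat.card_odd_le {Φ : CNF} (h : MinimalUnsat Φ) (h2 : IsTwoCNF Φ) (hR : ROR Φ)
    (V : Finset ℕ) (hV : ∀ x ∈ V, Odd (deg Φ x)) : V.card ≤ 2 := by
  obtain ⟨U, hU, hmem⟩ := hR
  obtain ⟨M, hM, hUM⟩ := exists_mReach_of_readOnceStep hU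
  -- Keep only the clauses from which the empty clause descends.
  obtain ⟨M', hM', hR'⟩ := hM.exists_le {∅}
    ((Multiset.singleton_le.2 hmem).trans hUM)
  have hnd : M'.Nodup := Multiset.nodup_of_le hM' Φ.nodup
  -- These clauses are unsatisfiable, so by minimality none of `Φ` is missing.
  obtain rfl : M' = Φ.val := by
    by_contra hne
    have hss : (⟨M', hnd⟩ : Finset Clause) ⊂ Φ :=
      lt_of_le_of_ne (Finset.val_le_iff.1 hM') fun e => hne (congrArg Finset.val e)
    obtain ⟨v, hv⟩ := h.2 _ hss
    exact Refutable.not_satisfiable ⟨0, hR'⟩ v fun c hc => hv c hc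
  obtain ⟨W, hW, hW'⟩ := hR'.exists_odd
  have hVW : V ⊆ W := by
    intro x hx
    by_contra hxW
    have := hW' x hxW
    rw [show (Φ.val.map (degIn x)).sum = ∑ c ∈ Φ, degIn x c from rfl, h.sum_degIn] at this
    exact Nat.not_even_iff_odd.2 (hV x hx) this
  -- With at most two literals per clause the inequality `hW` becomes the bound 2.
  have hsum : (Φ.val.map Finset.card).sum ≤ 2 * Φ.card := by
    rw [show (Φ.val.map Finset.card).sum = ∑ c ∈ Φ, c.card from rfl, mul_comm]
    exact Finset.sum_le_card_nsmul _ _ _ h2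
  have := Finset.card_le_card hVW
  have e : Multiset.card Φ.val = Φ.card := rfl
  omega

end ReadOnce

namespace ReadOnce

open Literal

/-! ### Deriving clauses and implications -/

/-- Some subclause of `c` has a read-once derivation from `M`. -/
def Der (M : Multiset Clause) (c : Clause) : Prop := ∃ c' ⊆ c, ∃ N, MReach M (c' ::ₘ N)

theorem MReach.add {M N P Q : Multiset Clause} (h : MReach M N) (h' : MReach P Q) :
    MReach (M + P) (N + Q) := by
  refine (h.add_right P).trans ?_
  rw [add_comm N P, add_comm N Q]
  exact h'.add_right N

theorem Der.mono {M N : Multiset Clause} {c : Clause} (h : Der M c) (hMN : M ≤ N) : Der N c := by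
  obtain ⟨c', hc, P, hP⟩ := h
  obtain ⟨Q, rfl⟩ := Multiset.le_iff_exists_add.1 hMN
  exact ⟨c', hc, P + Q, by simpa using hP.add_right Q⟩

theorem Der.weaken {M : Multiset Clause} {c d : Clause} (h : Der M c) (hcd : c ⊆ d) : Der M d := by
  obtain ⟨c', hc, P, hP⟩ := h
  exact ⟨c', hc.trans hcd, P, hP⟩

theorem Der.self (c : Clause) : Der {c} c := ⟨c, subset_rfl, 0, .refl⟩

/-- Allowing subclauses makes resolution unconditional: if the literal is missing from one derived
premise, that premise already lies in the target and the other derivation is discarded. -/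
theorem Der.resolve {M N : Multiset Clause} {c d : Clause} (h : Der M c) (h' : Der N d)
    (l : Literal) : Der (M + N) (c.erase l ∪ d.erase (opp l)) := by
  obtain ⟨c', hc, P, hP⟩ := h
  obtain ⟨d', hd, Q, hQ⟩ := h'
  by_cases hl : l ∈ c'
  · by_cases hl' : opp l ∈ d'
    · have hR := hP.add hQ
      have key : ∃ r ⊆ c.erase l ∪ d.erase (opp l),
          IsResolvent c' d' r ∨ IsResolvent d' c' r := by
        refine ⟨c'.erase l ∪ d'.erase (opp l),
          Finset.union_subset_union (Finset.erase_subset_erase _ hc)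
            (Finset.erase_subset_erase _ hd), ?_⟩
        rcases l with ⟨x, b⟩
        cases b
        · exact .inr ⟨x, hl', hl, Finset.union_comm _ _⟩
        · exact .inl ⟨x, hl, hl', rfl⟩
      obtain ⟨r, hrsub, hr⟩ := key
      refine ⟨r, hrsub, P + Q, hR.tail ?_⟩
      rcases hr with hr | hr
      · exact ⟨c', d', r, P + Q, hr, by rw [Multiset.cons_add, Multiset.add_cons], rfl⟩
      · exact ⟨d', c', r, P + Q, hr, by rw [Multiset.cons_add, Multiset.add_cons, Multiset.cons_swap],
          rfl⟩
    · refine Der.mono (M := N) ⟨d', fun m hm => ?_, Q, hQ⟩ (Multiset.le_add_left _ _)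
      exact Finset.mem_union_right _ (Finset.mem_erase.2 ⟨fun e => hl' (e ▸ hm), hd hm⟩)
  · refine Der.mono (M := M) ⟨c', fun m hm => ?_, P, hP⟩ (Multiset.le_add_right _ _)
    exact Finset.mem_union_left _ (Finset.mem_erase.2 ⟨fun e => hl (e ▸ hm), hc hm⟩)

theorem Der.refutable {M N : Multiset Clause} {p : Literal} (h : Der M {p}) (h' : Der N {opp p}) :
    Refutable (M + N) := by
  obtain ⟨c, hc, P, hP⟩ := h.resolve h' p
  have : c = ∅ := Finset.subset_empty.1 (by simpa using hc)
  exact ⟨P, this ▸ hP⟩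

theorem Refutable.mono {M N : Multiset Clause} (h : Refutable M) (hMN : M ≤ N) : Refutable N := by
  obtain ⟨P, hP⟩ := h
  obtain ⟨Q, rfl⟩ := Multiset.le_iff_exists_add.1 hMN
  exact ⟨P + Q, by simpa using hP.add_right Q⟩

/-- The implication `p → q` is trivial or has a read-once derivation from `M`. -/
def Imp (M : Multiset Clause) (p q : Literal) : Prop := p = q ∨ Der M {opp p, q}

theorem Imp.mono {M N : Multiset Clause} {p q : Literal} (h : Imp M p q) (hMN : M ≤ N) :
    Imp N p q := h.imp_right fun h => h.mono hMN

theorem Imp.trans {M N : Multiset Clause} {p q r : Literal} (h : Imp M p q) (h' : Imp N q r) :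
    Imp (M + N) p r := by
  rcases h with rfl | h
  · exact h'.mono (Multiset.le_add_left _ _)
  rcases h' with rfl | h'
  · exact .inr (h.mono (Multiset.le_add_right _ _))
  refine .inr ((h.resolve h' q).weaken fun m => ?_)
  simp only [Finset.mem_union, Finset.mem_erase, Finset.mem_insert, Finset.mem_singleton]
  tauto

/-- An implication and its contrapositive are the same clause, so a path may be read in either
direction with the same clauses. -/
theorem Imp.contra {M : Multiset Clause} {p q : Literal} (h : Imp M p q) :
    Imp M (opp q) (opp p) := by
  rcases h with rfl | h
  · exact .inl rfl
  · refine .inr ?_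
    rwa [opp_opp, Finset.pair_comm]

theorem Imp.unit {M : Multiset Clause} {p : Literal} (h : Imp M (opp p) p) : Der M {p} := by
  rcases h with h | h
  · exact absurd h (opp_ne p)
  · simpa using h

theorem Imp.unit_opp {M : Multiset Clause} {p : Literal} (h : Imp M p (opp p)) :
    Der M {opp p} := by
  rcases h with h | h
  · exact absurd h (ne_opp p)
  · simpa using h

theorem Der.imp {M N : Multiset Clause} {p q : Literal} (h : Der M {p}) (h' : Imp N p q) :
    Der (M + N) {q} := by
  rcases h' with rfl | h'
  · exact h.mono (Multiset.le_add_right _ _)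
  · refine (h.resolve h' p).weaken fun m => ?_
    simp only [Finset.mem_union, Finset.mem_erase, Finset.mem_insert, Finset.mem_singleton]
    tauto

theorem Der.exists_sat {M : Multiset Clause} {c : Clause} (h : Der M c) {v : ℕ → Bool}
    (hv : ∀ d ∈ M, SatClause v d) : SatClause v c := by
  obtain ⟨c', hc, P, hP⟩ := h
  obtain ⟨l, hl, hvl⟩ := hP.sound hv c' (by simp)
  exact ⟨l, hc hl, hvl⟩

/-! ### The implication graph -/

/-- The implication `p → q` is a clause of `Ψ`. -/
def Edge (Ψ : CNF) (p q : Literal) : Prop := ({opp p, q} : Clause) ∈ Ψ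

/-- There is a chain of implications from `p` to `q`. -/
abbrev Reach (Ψ : CNF) : Literal → Literal → Prop := Relation.ReflTransGen (Edge Ψ)

theorem Edge.contra {Ψ : CNF} {p q : Literal} (h : Edge Ψ p q) : Edge Ψ (opp q) (opp p) := by
  rw [Edge, opp_opp, Finset.pair_comm]
  exact h

theorem Reach.contra {Ψ : CNF} {p q : Literal} (h : Reach Ψ p q) : Reach Ψ (opp q) (opp p) := by
  induction h with
  | refl => exact .refl
  | tail _ h ih => exact .head h.contra ih

theorem Reach.mono {Ψ Φ : CNF} (hΨ : Ψ ⊆ Φ) {p q : Literal} (h : Reach Ψ p q) : Reach Φ p q :=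
  Relation.ReflTransGen.mono (p := Edge Φ) (fun _ _ h => hΨ h) _ _ h

theorem exists_eq_pair {c : Clause} (hc : c.card ≤ 2) {l : Literal} (hl : l ∈ c) :
    ∃ m ∈ c, c = {l, m} := by
  by_cases h : ∃ m ∈ c, m ≠ l
  · obtain ⟨m, hm, hml⟩ := h
    refine ⟨m, hm, (Finset.eq_of_subset_of_card_le ?_ ?_).symm⟩
    · simp [Finset.insert_subset_iff, hl, hm]
    · rwa [Finset.card_pair hml.symm]
  · push Not at h
    refine ⟨l, hl, ?_⟩
    ext m
    simp only [Finset.mem_insert, Finset.mem_singleton, or_self]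
    exact ⟨h m, fun e => e ▸ hl⟩

/-- If `a` does not imply its complement, a satisfying assignment can be changed to make `a`
true. -/
theorem exists_sat_of_not_reach {Ψ : CNF} (h2 : IsTwoCNF Ψ) {v : ℕ → Bool}
    (hv : ∀ c ∈ Ψ, SatClause v c) {a : Literal} (ha : ¬ Reach Ψ a (opp a)) :
    ∃ v' : ℕ → Bool, (∀ c ∈ Ψ, SatClause v' c) ∧ v' a.1 = a.2 := by
  classical
  -- If `a` reached both `l` and its complement, then contraposing the second path would continue
  -- the first one to the complement of `a`.
  have hcons : ∀ l, Reach Ψ a l → ¬ Reach Ψ a (opp l) := fun l h h' =>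
    ha (h.trans (by simpa using h'.contra))
  -- All consequences of `a` become true; variables without a consequence keep their value.
  set v' : ℕ → Bool := fun x =>
    if Reach Ψ a (x, true) then true else if Reach Ψ a (x, false) then false else v x with hv'
  have h1 : ∀ l, Reach Ψ a l → v' l.1 = l.2 := by
    rintro ⟨x, b⟩ h
    cases b
    · have : ¬ Reach Ψ a (x, true) := hcons _ h
      simp [hv', this, h]
    · simp [hv', h]
  have h3 : ∀ l, ¬ Reach Ψ a l → ¬ Reach Ψ a (opp l) → v' l.1 = v l.1 := by
    rintro ⟨x, b⟩ h h'
    cases b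
    · have h' : ¬ Reach Ψ a (x, true) := h'
      simp [hv', h, h']
    · have h' : ¬ Reach Ψ a (x, false) := h'
      simp [hv', h, h']
  refine ⟨v', fun c hc => ?_, h1 a .refl⟩
  obtain ⟨l, hl, hvl⟩ := hv c hc
  obtain ⟨m, hm, hcm⟩ := exists_eq_pair (h2 c hc) hl
  by_cases hr : Reach Ψ a l
  · exact ⟨l, hl, h1 l hr⟩
  by_cases hr' : Reach Ψ a (opp l)
  -- The old witness `l` became false, but then the clause is an implication that makes `m` a
  -- consequence of `a`.
  · refine ⟨m, hm, h1 m (hr'.tail ?_)⟩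
    rw [Edge, opp_opp, ← hcm]
    exact hc
  · exact ⟨l, hl, (h3 l hr hr').trans hvl⟩

theorem IsTwoCNF.mono {Ψ Φ : CNF} (h : IsTwoCNF Φ) (hΨ : Ψ ⊆ Φ) : IsTwoCNF Ψ :=
  fun c hc => h c (hΨ hc)

/-- Otherwise a model of the formula without `c` could be changed to make `l` true, and it would
satisfy `c` as well. -/
theorem MinimalUnsat.reach_opp {Φ : CNF} (h : MinimalUnsat Φ) (h2 : IsTwoCNF Φ) {c : Clause}
    (hc : c ∈ Φ) {l : Literal} (hl : l ∈ c) : Reach (Φ.erase c) l (opp l) := by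
  by_contra hr
  obtain ⟨v, hv⟩ := h.2 _ (Finset.erase_ssubset hc)
  obtain ⟨v', hv', hl'⟩ := exists_sat_of_not_reach (h2.mono (Finset.erase_subset _ _)) hv hr
  refine h.1 ⟨v', fun d hd => ?_⟩
  by_cases hdc : d = c
  · exact hdc ▸ ⟨l, hl, hl'⟩
  · exact hv' d (Finset.mem_erase.2 ⟨hdc, hd⟩)

/-- Both literals of a clause {p, q} imply their complements. The clause itself gives ¬p → q and ¬q
→ p, so ¬p → q → ¬q → p. The case q = p of a unit clause is included. -/
theorem MinimalUnsat.exists_reach {Φ : CNF} (h : MinimalUnsat Φ) (h2 : IsTwoCNF Φ)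
    (h0 : ∅ ∉ Φ) : ∃ c ∈ Φ, ∃ p ∈ c, Reach Φ p (opp p) ∧ Reach Φ (opp p) p := by
  obtain ⟨c, hc⟩ : Φ.Nonempty := by
    by_contra hne
    rw [Finset.not_nonempty_iff_eq_empty] at hne
    exact h.1 ⟨fun _ => true, by simp [hne]⟩
  obtain ⟨p, hp⟩ : c.Nonempty := by
    rw [Finset.nonempty_iff_ne_empty]
    rintro rfl
    exact h0 hc
  obtain ⟨q, hq, hcq⟩ := exists_eq_pair (h2 c hc) hp
  have h1 := (h.reach_opp h2 hc hp).mono (Finset.erase_subset _ _)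
  have h3 := (h.reach_opp h2 hc hq).mono (Finset.erase_subset _ _)
  have hE : Edge Φ (opp p) q := by rwa [Edge, opp_opp, ← hcq]
  refine ⟨c, hc, p, hp, h1, .head hE (h3.tail ?_)⟩
  simpa using hE.contra

theorem exists_minimalUnsat_subset {Φ : CNF} (h : ¬ Satisfiable Φ) :
    ∃ Ψ ⊆ Φ, MinimalUnsat Ψ := by
  induction Φ using Finset.strongInduction with
  | H Φ ih =>
    by_cases hs : ∃ Ψ ⊂ Φ, ¬ Satisfiable Ψ
    · obtain ⟨Ψ, hΨ, hu⟩ := hs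
      obtain ⟨Ψ', h', hm⟩ := ih Ψ hΨ hu
      exact ⟨Ψ', h'.trans hΨ.1, hm⟩
    · push Not at hs
      exact ⟨Φ, subset_rfl, h, hs⟩

theorem Reach.sat {Ψ : CNF} {p q : Literal} (h : Reach Ψ p q) {v : ℕ → Bool}
    (hv : ∀ c ∈ Ψ, SatClause v c) (hp : v p.1 = p.2) : v q.1 = q.2 := by
  induction h with
  | refl => exact hp
  | @tail q r _ h ih =>
    obtain ⟨l, hl, hvl⟩ := hv _ h
    simp only [Finset.mem_insert, Finset.mem_singleton] at hl
    rcases hl with rfl | rfl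
    · exact absurd ih ((val_opp v q).1 hvl)
    · exact hvl

/-- A 2CNF formula is unsatisfiable if and only if it contains the empty clause, or some literal
that occurs in it and its complement imply each other. -/
theorem not_satisfiable_iff {Φ : CNF} (h2 : IsTwoCNF Φ) :
    ¬ Satisfiable Φ ↔ ∅ ∈ Φ ∨ ∃ p, Reach Φ p (opp p) ∧ Reach Φ (opp p) p := by
  constructor
  · intro h
    obtain ⟨Ψ, hΨ, hm⟩ := exists_minimalUnsat_subset h
    by_cases h0 : ∅ ∈ Ψ
    · exact .inl (hΨ h0)
    · obtain ⟨c, hc, p, hp, h1, h3⟩ := hm.exists_reach (h2.mono hΨ) h0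
      exact .inr ⟨p, h1.mono hΨ, h3.mono hΨ⟩
  · rintro (h0 | ⟨p, h1, h3⟩) ⟨v, hv⟩
    · obtain ⟨l, hl, -⟩ := hv _ h0
      simp at hl
    · by_cases hp : v p.1 = p.2
      · exact (val_opp v p).1 (h1.sat hv hp) hp
      · exact hp (h3.sat hv ((val_opp v p).2 hp))

end ReadOnce

namespace ReadOnce

open Literal

/-! ### Lassos -/

theorem Reach.exists_path {Ψ : CNF} {p q : Literal} (h : Reach Ψ p q) :
    ∃ (m : ℕ) (f : ℕ → Literal), f 0 = p ∧ f m = q ∧ ∀ k < m, Edge Ψ (f k) (f (k + 1)) := by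
  induction h with
  | refl => exact ⟨0, fun _ => p, rfl, rfl, by simp⟩
  | @tail q r _ h ih =>
    obtain ⟨m, f, h0, hm, hf⟩ := ih
    refine ⟨m + 1, fun k => if k ≤ m then f k else r, by simp [h0], by simp, fun k hk => ?_⟩
    rcases Nat.lt_succ_iff_lt_or_eq.1 hk with hk' | rfl
    · simpa [hk'.le, Nat.succ_le_of_lt hk'] using hf k hk'
    · simpa [hm] using h

/-- A shortest path repeats no literal, since the part between two equal literals could be cut out.
-/
theorem Reach.exists_injective_path {Ψ : CNF} {p q : Literal} (h : Reach Ψ p q) :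
    ∃ (m : ℕ) (f : ℕ → Literal), f 0 = p ∧ f m = q ∧ (∀ k < m, Edge Ψ (f k) (f (k + 1))) ∧
      ∀ j k, j < k → k ≤ m → f j ≠ f k := by
  classical
  have hex := h.exists_path
  obtain ⟨f, h0, hm, hf⟩ := Nat.find_spec hex
  set m := Nat.find hex with hmdef
  refine ⟨m, f, h0, hm, hf, fun j k hjk hkm heq => ?_⟩
  refine Nat.find_min hex (m := m - (k - j)) (by omega)
    ⟨fun i => if i ≤ j then f i else f (i + (k - j)), by simp [h0], ?_, fun i hi => ?_⟩
  · by_cases hmj : m - (k - j) ≤ j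
    · have : m = k := by omega
      have e : m - (k - j) = j := by omega
      simp only [e, le_refl, if_true]
      rw [heq, ← this, hm]
    · simp only [hmj, if_false]
      rw [show m - (k - j) + (k - j) = m by omega, hm]
  · rcases lt_trichotomy i j with hij | rfl | hij
    · simpa [hij.le, Nat.succ_le_of_lt hij] using hf i (by omega)
    · have := hf k (by omega)
      simp only [le_refl, if_true, show ¬ i + 1 ≤ i by omega, if_false]
      rw [heq, show i + 1 + (k - i) = k + 1 by omega]
      exact this
    · have := hf (i + (k - j)) (by omega)
      simp only [show ¬ i ≤ j by omega, show ¬ i + 1 ≤ j by omega, if_false]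
      rw [show i + 1 + (k - j) = i + (k - j) + 1 by omega]
      exact this

/-- A chain of implications from `p` through pairwise distinct variables that ends with the
complement of an earlier literal. -/
structure Lasso (Ψ : CNF) (p : Literal) where
  /-- the literals -/
  f : ℕ → Literal
  /-- the number of implications -/
  m : ℕ
  /-- the position of the literal whose complement comes last -/
  i : ℕ
  lt : i < m
  zero : f 0 = p
  last : f m = opp (f i)
  edge : ∀ k < m, Edge Ψ (f k) (f (k + 1))
  ne : ∀ j k, j < k → k < m → (f j).1 ≠ (f k).1

/-- Follow a path without repetition and stop at the first literal whose complement has occurred. Up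
to there neither a literal nor its complement recurs, so the variables are distinct. -/
theorem Reach.exists_lasso {Ψ : CNF} {p : Literal} (h : Reach Ψ p (opp p)) :
    Nonempty (Lasso Ψ p) := by
  classical
  obtain ⟨m, f, h0, hm, hf, hinj⟩ := h.exists_injective_path
  have hex : ∃ k, k ≤ m ∧ ∃ i < k, f k = opp (f i) := by
    refine ⟨m, le_rfl, 0, ?_, by rw [hm, h0]⟩
    rcases Nat.eq_zero_or_pos m with rfl | h
    · exact absurd (h0.symm.trans hm) (ne_opp p)
    · exact h
  obtain ⟨hkm, i, hi, hki⟩ := Nat.find_spec hex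
  refine ⟨⟨f, Nat.find hex, i, hi, h0, hki, fun k hk => hf k (by omega), fun j k hjk hk e => ?_⟩⟩
  rcases eq_or_eq_opp e with e | e
  · exact hinj j k hjk (by omega) e
  · exact Nat.find_min hex hk ⟨by omega, j, hjk, eq_opp_comm.1 e⟩

namespace Lasso

variable {Ψ : CNF} {p : Literal} (L : Lasso Ψ p)

/-- The clause of the `k`-th implication. -/
def clause (k : ℕ) : Clause := {opp (L.f k), L.f (k + 1)}

theorem clause_mem {k : ℕ} (hk : k < L.m) : L.clause k ∈ Ψ := L.edge k hk

theorem f_inj {j k : ℕ} (hj : j < L.m) (hk : k < L.m) (h : (L.f j).1 = (L.f k).1) : j = k := by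
  rcases lt_trichotomy j k with h' | h' | h'
  · exact absurd h (L.ne j k h' hk)
  · exact h'
  · exact absurd h.symm (L.ne k j h' hj)

/-- As the variables of `f j` and `f k` differ, equal clauses would make `f (j + 1)` the complement
of `f k`. Distinctness of variables then gives k = j + 1, and a literal would be its own complement.
So the derivation along a lasso is read-once. -/
theorem clause_ne {j k : ℕ} (hjk : j < k) (hk : k < L.m) : L.clause j ≠ L.clause k := by
  intro h
  have h1 : opp (L.f j) ∈ L.clause k := h ▸ by simp [clause]
  have h2 : opp (L.f k) ∈ L.clause j := h ▸ by simp [clause]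
  simp only [clause, Finset.mem_insert, Finset.mem_singleton] at h1 h2
  have hne := L.ne j k hjk hk
  have h1 := h1.resolve_left fun e => hne (congrArg Prod.fst (opp_injective e))
  have h2 := h2.resolve_left fun e => hne (congrArg Prod.fst (opp_injective e)).symm
  have h1' : (L.f j).1 = (L.f (k + 1)).1 := by rw [← h1]; rfl
  have h2' : (L.f k).1 = (L.f (j + 1)).1 := by rw [← h2]; rfl
  have hkj : k = j + 1 := L.f_inj hk (by omega) h2'
  rw [← hkj] at h2
  exact opp_ne _ h2

theorem clause_injOn : Set.InjOn L.clause (Finset.range L.m) := by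
  intro j hj k hk h
  simp only [Finset.coe_range, Set.mem_Iio] at hj hk
  rcases lt_trichotomy j k with h' | h' | h'
  · exact absurd h (L.clause_ne h' hk)
  · exact h'
  · exact absurd h.symm (L.clause_ne h' hj)

/-- The clauses of a lasso. -/
def clauses : CNF := (Finset.range L.m).image L.clause

theorem mem_clauses {c : Clause} : c ∈ L.clauses ↔ ∃ k < L.m, L.clause k = c := by
  simp [clauses]

theorem clauses_subset : L.clauses ⊆ Ψ := by
  intro c hc
  obtain ⟨k, hk, rfl⟩ := L.mem_clauses.1 hc
  exact L.clause_mem hk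

theorem card_clauses : L.clauses.card = L.m := by
  rw [clauses, Finset.card_image_of_injOn L.clause_injOn, Finset.card_range]

/-- The clauses of the implications from `a` to `b`. -/
def seg (a b : ℕ) : Multiset Clause := (Multiset.Ico a b).map L.clause

theorem seg_add {a b c : ℕ} (hab : a ≤ b) (hbc : b ≤ c) : L.seg a b + L.seg b c = L.seg a c := by
  rw [seg, seg, ← Multiset.map_add, Multiset.Ico_add_Ico_eq_Ico hab hbc, seg]

theorem seg_succ (a : ℕ) : L.seg a (a + 1) = {L.clause a} := by
  have : Multiset.Ico a (a + 1) = {a} := by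
    change (Finset.Ico a (a + 1)).val = _
    rw [Nat.Ico_succ_singleton, Finset.singleton_val]
  rw [seg, this, Multiset.map_singleton]

theorem clauses_val : L.clauses.val = L.seg 0 L.m := by
  rw [clauses, Finset.image_val_of_injOn L.clause_injOn, seg,
    Finset.range_eq_Ico]
  rfl

theorem seg_imp {a b : ℕ} (hab : a ≤ b) : Imp (L.seg a b) (L.f a) (L.f b) := by
  induction b, hab using Nat.le_induction with
  | base => exact .inl rfl
  | succ b hab ih =>
    rw [← L.seg_add hab (Nat.le_succ b)]
    refine ih.trans ?_
    rw [Nat.succ_eq_add_one, seg_succ]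
    exact .inr (Der.self _)

theorem der_loop : Der (L.seg L.i L.m) {opp (L.f L.i)} := by
  have := L.seg_imp L.lt.le
  rw [L.last] at this
  exact this.unit_opp

/-- The loop refutes the literal at which it is attached, and the stem, read backwards, carries this
to `p`. -/
theorem der : Der L.clauses.val {opp p} := by
  rw [clauses_val, ← L.seg_add (Nat.zero_le _) L.lt.le, add_comm]
  have := (L.seg_imp (Nat.zero_le L.i)).contra
  rw [L.zero] at this
  exact L.der_loop.imp this

theorem deg_le_card (y : ℕ) : deg L.clauses y ≤
    ((Finset.range L.m).filter fun k => (L.f k).1 = y ∨ (L.f (k + 1)).1 = y).card := by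
  refine (Finset.card_le_card fun c hc => ?_).trans (Finset.card_image_le (f := L.clause))
  simp only [Finset.mem_filter, mem_clauses] at hc
  obtain ⟨⟨k, hk, rfl⟩, l, hl, hly⟩ := hc
  refine Finset.mem_image.2 ⟨k, Finset.mem_filter.2 ⟨Finset.mem_range.2 hk, ?_⟩, rfl⟩
  simp only [clause, Finset.mem_insert, Finset.mem_singleton] at hl
  rcases hl with rfl | rfl
  · exact .inl hly
  · exact .inr hly

/-- The only variable that a lasso meets again is the one at `i`, and this happens at the last
position. -/
theorem succ_cases {k j : ℕ} (hk : k < L.m) (hj : j < L.m) (h : (L.f (k + 1)).1 = (L.f j).1) :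
    k + 1 = j ∨ (k + 1 = L.m ∧ j = L.i) := by
  by_cases hk' : k + 1 < L.m
  · exact .inl (L.f_inj hk' hj h)
  · have e : k + 1 = L.m := by omega
    rw [e, L.last, opp_fst] at h
    exact .inr ⟨e, L.f_inj hj L.lt h.symm⟩

theorem deg_start_le (hi : L.i ≠ 0) : deg L.clauses p.1 ≤ 1 := by
  refine (L.deg_le_card _).trans ((Finset.card_le_card (t := {0}) fun k hk => ?_).trans (by simp))
  have h0 : 0 < L.m := L.lt.trans_le' (Nat.zero_le _)
  simp only [Finset.mem_filter, Finset.mem_range, ← L.zero] at hk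
  obtain ⟨hk, h | h⟩ := hk
  · simp [L.f_inj hk h0 h]
  · rcases L.succ_cases hk h0 h with h | h
    · omega
    · exact absurd h.2.symm hi

theorem deg_le_two {j : ℕ} (hj : j < L.m) (hji : j ≠ L.i ∨ j = 0) :
    deg L.clauses (L.f j).1 ≤ 2 := by
  refine (L.deg_le_card _).trans ((Finset.card_le_card
    -- Besides clause `j` only the preceding clause can matter; for a cycle and j = 0 this is the
    -- closing clause. If j = 0 without a cycle, the truncated `j - 1` merely repeats `j`.
    (t := {j, if j = L.i then L.m - 1 else j - 1}) fun k hk => ?_).trans Finset.card_le_two)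
  simp only [Finset.mem_filter, Finset.mem_range] at hk
  simp only [Finset.mem_insert, Finset.mem_singleton]
  obtain ⟨hk, h | h⟩ := hk
  · exact .inl (L.f_inj hk hj h)
  · refine .inr ?_
    rcases L.succ_cases hk hj h with h | h
    · rw [if_neg (by omega)]
      omega
    · rw [if_pos h.2]
      omega

theorem deg_le_two_of_cycle (hi : L.i = 0) (y : ℕ) : deg L.clauses y ≤ 2 := by
  by_cases h : ∃ j < L.m, (L.f j).1 = y
  · obtain ⟨j, hj, rfl⟩ := h
    exact L.deg_le_two hj (by omega)
  · push Not at h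
    refine (L.deg_le_card _).trans ?_
    rw [Finset.filter_false_of_mem]
    · simp
    · intro k hk
      rw [Finset.mem_range] at hk
      rintro (h' | h')
      · exact h k hk h'
      · by_cases hk' : k + 1 < L.m
        · exact h _ hk' h'
        · have e : k + 1 = L.m := by omega
          rw [e, L.last, opp_fst] at h'
          exact h _ L.lt h'

end Lasso

/-! ### Lassos and degrees in minimal unsatisfiable formulas -/

/-- The variables of a formula. -/
def vars (Φ : CNF) : Finset ℕ := Φ.biUnion fun c => c.image Prod.fst

theorem mem_vars {Φ : CNF} {x : ℕ} : x ∈ vars Φ ↔ ∃ c ∈ Φ, ∃ l ∈ c, l.1 = x := by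
  simp only [vars, Finset.mem_biUnion, Finset.mem_image]

theorem Lasso.m_le {Ψ : CNF} {p : Literal} (L : Lasso Ψ p) : L.m ≤ (vars Ψ).card := by
  rw [← Finset.card_range L.m]
  refine Finset.card_le_card_of_injOn (fun j => (L.f j).1) (fun j hj => ?_) fun j hj k hk h => ?_
  · simp only [Finset.coe_range, Set.mem_Iio] at hj
    exact mem_vars.2 ⟨_, L.clause_mem hj, opp (L.f j), by simp [clause], rfl⟩
  · simp only [Finset.coe_range, Set.mem_Iio] at hj hk
    exact L.f_inj hj hk h

/-- The unit clause is refuted by a lasso that can be found among the other clauses, so it is used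
only once. -/
theorem MinimalUnsat.refutable_of_unit {Φ : CNF} (h : MinimalUnsat Φ) (h2 : IsTwoCNF Φ)
    {a : Literal} (ha : {a} ∈ Φ) : Refutable Φ.val := by
  obtain ⟨L⟩ := (h.reach_opp h2 ha (Finset.mem_singleton_self a)).exists_lasso
  refine ((Der.self {a}).refutable L.der).mono ?_
  have hnot : {a} ∉ L.clauses := fun hm => (Finset.mem_erase.1 (L.clauses_subset hm)).1 rfl
  rw [Multiset.singleton_add, ← Finset.insert_val_of_notMem hnot]
  exact Finset.val_le_iff.2 (Finset.insert_subset ha (L.clauses_subset.trans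
    (Finset.erase_subset _ _)))

theorem MinimalUnsat.sum_deg {Φ : CNF} (h : MinimalUnsat Φ) :
    ∑ x ∈ vars Φ, deg Φ x = ∑ c ∈ Φ, c.card := by
  rw [← Finset.sum_congr rfl fun x _ => h.sum_degIn x, Finset.sum_comm]
  refine Finset.sum_congr rfl fun c hc => ?_
  exact (Finset.card_eq_sum_card_fiberwise fun l hl => mem_vars.2 ⟨c, hc, l, hl, rfl⟩).symm

theorem deg_union_add_deg_inter (Φ Ψ : CNF) (y : ℕ) :
    deg (Φ ∪ Ψ) y + deg (Φ ∩ Ψ) y = deg Φ y + deg Ψ y := by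
  rw [deg, deg, Finset.filter_union, Finset.filter_inter_distrib,
    Finset.card_union_add_card_inter, deg, deg]

/-- The lassos derive contradictory unit clauses, so their clauses are jointly unsatisfiable and
minimality leaves no others. -/
theorem MinimalUnsat.union_clauses {Φ : CNF} (h : MinimalUnsat Φ) {p : Literal} (L₁ : Lasso Φ p)
    (L₂ : Lasso Φ (opp p)) : L₁.clauses ∪ L₂.clauses = Φ := by
  by_contra hne
  obtain ⟨v, hv⟩ := h.2 _ (lt_of_le_of_ne (Finset.union_subset L₁.clauses_subset L₂.clauses_subset)
    hne)
  obtain ⟨l, hl, hvl⟩ := L₁.der.exists_sat (v := v) fun d hd =>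
    hv d (Finset.mem_union_left _ hd)
  obtain ⟨m, hm, hvm⟩ := L₂.der.exists_sat (v := v) fun d hd =>
    hv d (Finset.mem_union_right _ hd)
  rw [Finset.mem_singleton] at hl hm
  subst hl hm
  exact (val_opp v (opp p)).1 hvm hvl

theorem pair_eq {a b c d : Literal} (h : ({a, b} : Clause) = {c, d}) :
    (a = c ∧ b = d) ∨ (a = d ∧ b = c) := by
  refine Set.pair_eq_pair_iff.1 ?_
  rw [← Finset.coe_pair, ← Finset.coe_pair, h]

end ReadOnce

namespace ReadOnce

open Literal

/-! ### Refuting formulas with few variables of degree three -/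

/-- At most two variables have degree three. -/
def FewCubic (Φ : CNF) : Prop := ∀ V : Finset ℕ, (∀ x ∈ V, deg Φ x = 3) → V.card ≤ 2

theorem val_add_val (C D : CNF) : C.val + D.val = (C ∪ D).val + (C ∩ D).val := by
  rw [Finset.union_val, Finset.inter_val, Multiset.union_add_inter]

theorem refutable_of_disjoint {Φ : CNF} {p : Literal} (L₁ : Lasso Φ p) (L₂ : Lasso Φ (opp p))
    (hU : L₁.clauses ∪ L₂.clauses = Φ) (hI : L₁.clauses ∩ L₂.clauses = ∅) :
    Refutable Φ.val := by
  have := L₂.der.refutable (p := opp (opp p)) (N := L₁.clauses.val) (by simpa using L₁.der)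
  refine this.mono (le_of_eq ?_)
  rw [add_comm, val_add_val, hU, hI]
  simp

/-- The parts of a cyclic lasso before and after a clause that stands for `P → Q`. -/
theorem Lasso.exists_split {Φ : CNF} {p : Literal} (L : Lasso Φ p) (hi : L.i = 0) {P Q : Literal}
    (hs : ({opp P, Q} : Clause) ∈ L.clauses) :
    ∃ D E : Multiset Clause, D + {{opp P, Q}} + E = L.clauses.val ∧ Imp D p P ∧
      Imp E Q (opp p) := by
  obtain ⟨k, hk, hkc⟩ := L.mem_clauses.1 hs
  have hsum : L.seg 0 k + {{opp P, Q}} + L.seg (k + 1) L.m = L.clauses.val := by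
    rw [← hkc, ← L.seg_succ, L.seg_add (Nat.zero_le _) (Nat.le_succ _),
      L.seg_add (Nat.zero_le _) hk, L.clauses_val]
  have h1 := L.seg_imp (Nat.zero_le k)
  have h2 := L.seg_imp (a := k + 1) (b := L.m) hk
  rw [L.zero] at h1
  rw [L.last, hi, L.zero] at h2
  rcases pair_eq hkc with ⟨e1, e2⟩ | ⟨e1, e2⟩
  · rw [opp_injective e1] at h1
    rw [e2] at h2
    exact ⟨_, _, hsum, h1, h2⟩
  -- The cycle passes the clause as ¬Q → ¬P. Contraposing the whole cycle exchanges the two parts.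
  · refine ⟨L.seg (k + 1) L.m, L.seg 0 k, ?_, ?_, ?_⟩
    · rw [← hsum]; abel
    · simpa [e2] using h2.contra
    · rw [← e1]; exact h1.contra

/-- The cycle `L₁` supplies `D`, which gives p → P, and `E`, which gives Q → ¬p, both without the
shared clause P → Q. Using them as detours, `L₂` can be completed so that the shared clause occurs
once. Which pieces are combined depends on the position `k` of this clause on `L₂` relative to the
start `L₂.i` of the loop. In the one position where no combination is given, three variables have
degree three. -/
theorem refutable_of_cycle {Φ : CNF} {p q : Literal} (hp : p = opp q) (L₁ : Lasso Φ p)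
    (L₂ : Lasso Φ q) (h3 : ∀ x ∈ vars Φ, 3 ≤ deg Φ x) (hV : FewCubic Φ) (hi : L₁.i = 0)
    (hU : L₁.clauses ∪ L₂.clauses = Φ) {s : Clause} (hI : L₁.clauses ∩ L₂.clauses = {s}) :
    Refutable Φ.val := by
  subst hp
  have hs : s ∈ L₁.clauses ∩ L₂.clauses := by simp [hI]
  rw [Finset.mem_inter] at hs
  obtain ⟨k, hk, hks⟩ := L₂.mem_clauses.1 hs.2
  set P := L₂.f k with hP
  set Q := L₂.f (k + 1) with hQ
  have hsPQ : s = {opp P, Q} := hks.symm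
  rw [hsPQ] at hs hI
  obtain ⟨D, E, hDE, hD, hE⟩ := L₁.exists_split hi hs.1
  rw [opp_opp] at hE
  have hD' := hD.contra
  rw [opp_opp] at hD'
  -- The union contains the shared clause once and the sum of the two lassos contains it twice.
  have hΦ : Φ.val = D + E + L₂.seg 0 k + {{opp P, Q}} + L₂.seg (k + 1) L₂.m := by
    have h1 := val_add_val L₁.clauses L₂.clauses
    rw [hU, hI, ← hDE, L₂.clauses_val, ← L₂.seg_add (Nat.zero_le k) hk.le,
      ← L₂.seg_add (Nat.le_succ k) hk, Nat.succ_eq_add_one, L₂.seg_succ, Lasso.clause, ← hP, ← hQ,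
      Finset.singleton_val] at h1
    have h2 : (D + E + L₂.seg 0 k + {{opp P, Q}} + L₂.seg (k + 1) L₂.m) + {{opp P, Q}} =
        Φ.val + {{opp P, Q}} := by
      rw [← h1]; abel
    exact (add_right_cancel h2).symm
  have hA := L₂.seg_imp (Nat.zero_le k)
  rw [L₂.zero, ← hP] at hA
  have hB := L₂.seg_imp (a := k + 1) (b := L₂.m) hk
  rw [L₂.last, ← hQ] at hB
  have hs' : Imp {{opp P, Q}} P Q := .inr (.self _)
  -- Here ¬P → ¬p by `D` and ¬p → P by the start of `L₂`; the shared clause is not used.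
  have hPunit : Der (D + L₂.seg 0 k) {P} := (hD'.trans hA).unit
  -- On the stem: the unit P is carried on to the loop, which refutes it there.
  rcases lt_trichotomy k L₂.i with hki | hki | hki
  · have h1 := L₂.seg_imp (a := k + 1) (b := L₂.i) hki
    rw [← hQ] at h1
    refine (((hPunit.imp hs').imp h1).refutable L₂.der_loop).mono ?_
    rw [hΦ, ← L₂.seg_add (a := k + 1) (b := L₂.i) hki L₂.lt.le]
    refine Multiset.le_iff_exists_add.2 ⟨E, ?_⟩
    abel
  -- First clause of the loop: going round the loop from P returns to ¬P.
  · rw [← hki, ← hP] at hB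
    refine (hPunit.refutable (hs'.trans hB).unit_opp).mono ?_
    rw [hΦ]
    refine Multiset.le_iff_exists_add.2 ⟨E, ?_⟩
    abel
  -- Last clause of the loop, with Q = ¬(f i): the stem backwards and `E` contraposed give Q → p →
  -- ¬Q, while the loop gives f i → P → Q.
  by_cases hkm : k + 1 = L₂.m
  · have hQe : Q = opp (L₂.f L₂.i) := by rw [hQ, hkm, L₂.last]
    have h1 := (L₂.seg_imp (Nat.zero_le L₂.i)).contra
    rw [L₂.zero, ← hQe] at h1
    have h2 := hE.contra
    rw [hQe, opp_opp] at h2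
    rw [hQe] at h1
    have h4 := (h1.trans h2).unit
    have h5 := (L₂.seg_imp hki.le).trans hs'
    rw [hQe] at h5
    refine (h4.refutable h5.unit_opp).mono ?_
    rw [hΦ, ← L₂.seg_add (Nat.zero_le L₂.i) hki.le, hkm, ← hQe]
    refine Multiset.le_iff_exists_add.2 ⟨D + L₂.seg L₂.m L₂.m, ?_⟩
    -- `D` is left over, and the part of `L₂` after the shared clause is empty.
    abel
  -- Both lassos are cycles: P gives Q, and Q → ¬p → ¬Q by `E` and the rest of `L₂` contraposed.
  -- Every clause is used.
  by_cases hi2 : L₂.i = 0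
  · rw [hi2, L₂.zero] at hB
    have h1 := hB.contra
    rw [opp_opp] at h1
    refine ((hPunit.imp hs').refutable (hE.trans h1).unit_opp).mono (le_of_eq ?_)
    rw [hΦ]
    abel
  -- Now 0 < i < k and k + 1 < m. The start of `L₂` has degree at most 2 + 1; P and Q have degree at
  -- most 2 + 2, less one for the clause counted twice.
  · exfalso
    have hdegle : ∀ y, deg Φ y + deg {({opp P, Q} : Clause)} y =
        deg L₁.clauses y + deg L₂.clauses y := by
      intro y
      have h := deg_union_add_deg_inter L₁.clauses L₂.clauses y
      rwa [hU, hI] at h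
    have h1 : ∀ y, deg L₁.clauses y ≤ 2 := L₁.deg_le_two_of_cycle hi
    have hvar : ∀ j < L₂.m, (L₂.f j).1 ∈ vars Φ := fun j hj =>
      mem_vars.2 ⟨_, L₂.clause_mem hj, opp (L₂.f j), by simp [Lasso.clause], rfl⟩
    have h0m : 0 < L₂.m := by omega
    have hp3 : deg Φ (L₂.f 0).1 = 3 := by
      have := hdegle (L₂.f 0).1
      have h4 : deg L₂.clauses (L₂.f 0).1 ≤ 1 :=
        (congrArg (fun l : Literal => deg L₂.clauses l.1) L₂.zero).le.trans (L₂.deg_start_le hi2)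
      have h5 := h1 (L₂.f 0).1
      have h6 := h3 _ (hvar 0 h0m)
      omega
    have hdegs : ∀ y, (y = P.1 ∨ y = Q.1) → deg {({opp P, Q} : Clause)} y = 1 := by
      intro y hy
      rw [deg, Finset.filter_true_of_mem, Finset.card_singleton]
      intro c hc
      rw [Finset.mem_singleton.1 hc]
      rcases hy with rfl | rfl
      · exact ⟨opp P, by simp, rfl⟩
      · exact ⟨Q, by simp, rfl⟩
    have hP3 : deg Φ P.1 = 3 := by
      have := hdegle P.1
      rw [hdegs _ (.inl rfl)] at this
      have h4 : deg L₂.clauses P.1 ≤ 2 := L₂.deg_le_two hk (.inl (by omega))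
      have h5 := h1 P.1
      have h6 := h3 _ (hvar k hk)
      rw [← hP] at h6
      omega
    have hQ3 : deg Φ Q.1 = 3 := by
      have := hdegle Q.1
      rw [hdegs _ (.inr rfl)] at this
      have h4 : deg L₂.clauses Q.1 ≤ 2 := L₂.deg_le_two (j := k + 1) (by omega) (.inl (by omega))
      have h5 := h1 Q.1
      have h6 := h3 _ (hvar (k + 1) (by omega))
      rw [← hQ] at h6
      omega
    have hcard := hV {(L₂.f 0).1, P.1, Q.1} (by
      intro x hx
      simp only [Finset.mem_insert, Finset.mem_singleton] at hx
      rcases hx with rfl | rfl | rfl <;> assumption)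
    rw [Finset.card_eq_three.2 ⟨_, _, _, L₂.ne 0 k (by omega) hk, L₂.ne 0 (k + 1) (by omega)
      (by omega), L₂.ne k (k + 1) (by omega) (by omega), rfl⟩] at hcard
    omega

/-- A pure literal can be made true at no cost, so its clauses would be redundant. -/
theorem MinimalUnsat.pos_vars {Φ : CNF} (h : MinimalUnsat Φ) {c : Clause} (hc : c ∈ Φ) {l : Literal}
    (hl : l ∈ c) : ∃ d ∈ Φ, opp l ∈ d := by
  by_contra hne
  push Not at hne
  obtain ⟨v, hv⟩ := h.sat_erase hc
  refine h.1 ⟨Function.update v l.1 l.2, fun d hd => ?_⟩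
  by_cases hld : l ∈ d
  · exact ⟨l, hld, by simp⟩
  · obtain ⟨m, hm, hvm⟩ := hv d hd (by rintro rfl; exact hld hl)
    refine ⟨m, hm, ?_⟩
    rw [Function.update_of_ne, hvm]
    intro e
    rcases eq_or_eq_opp e with rfl | rfl
    · exact hld hm
    · exact hne d hd hm

/-- Counting degrees bounds the overlap of the two lassos by one clause. If they share one, one of
them is a cycle, since otherwise the start p would have degree at most two. -/
theorem MinimalUnsat.refutable_of_three_le {Φ : CNF} (h : MinimalUnsat Φ) (h2 : IsTwoCNF Φ)
    (h0 : ∅ ∉ Φ) (h1 : ∀ a : Literal, {a} ∉ Φ) (h3 : ∀ x ∈ vars Φ, 3 ≤ deg Φ x)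
    (hV : FewCubic Φ) : Refutable Φ.val := by
  obtain ⟨c, hc, p, hpc, hp, hp'⟩ := h.exists_reach h2 h0
  obtain ⟨L₁⟩ := hp.exists_lasso
  obtain ⟨L₂⟩ : Nonempty (Lasso Φ (opp p)) := Reach.exists_lasso (by simpa using hp')
  have hU := h.union_clauses L₁ L₂
  have hcard : Φ.card + (L₁.clauses ∩ L₂.clauses).card = L₁.m + L₂.m := by
    rw [← L₁.card_clauses, ← L₂.card_clauses, ← Finset.card_union_add_card_inter L₁.clauses, hU]
  have hm₁ := L₁.m_le
  have hm₂ := L₂.m_le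
  have hcc : ∀ c ∈ Φ, c.card = 2 := by
    intro c hc
    have h4 := h2 c hc
    have h5 : c.card ≠ 0 := fun e => h0 (Finset.card_eq_zero.1 e ▸ hc)
    have h6 : c.card ≠ 1 := fun e => by
      obtain ⟨a, rfl⟩ := Finset.card_eq_one.1 e
      exact h1 a hc
    omega
  have hsum : ∑ x ∈ vars Φ, deg Φ x = 2 * Φ.card := by
    rw [h.sum_deg, Finset.sum_congr rfl hcc, Finset.sum_const, smul_eq_mul, mul_comm]
  -- All degrees are at least four except for at most two that equal three.
  have hlow : 4 * (vars Φ).card ≤ ∑ x ∈ vars Φ, deg Φ x + 2 := by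
    have h4 := hV ((vars Φ).filter fun x => deg Φ x = 3) (by simp)
    have h5 : ∑ x ∈ vars Φ, 4 ≤ ∑ x ∈ vars Φ, (deg Φ x + if deg Φ x = 3 then 1 else 0) := by
      refine Finset.sum_le_sum fun x hx => ?_
      have := h3 x hx
      split_ifs <;> omega
    rw [Finset.sum_add_distrib, ← Finset.card_filter, Finset.sum_const, smul_eq_mul] at h5
    omega
  -- With n variables, `hlow` gives at least 2n - 1 clauses, while the lassos have at most 2n
  -- clauses counted with repetition.
  have hI : (L₁.clauses ∩ L₂.clauses).card ≤ 1 := by omega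
  rcases Nat.le_one_iff_eq_zero_or_eq_one.1 hI with hI | hI
  · exact refutable_of_disjoint L₁ L₂ hU (Finset.card_eq_zero.1 hI)
  obtain ⟨s, hs⟩ := Finset.card_eq_one.1 hI
  by_cases hi₁ : L₁.i = 0
  · exact refutable_of_cycle (opp_opp p).symm L₁ L₂ h3 hV hi₁ hU hs
  by_cases hi₂ : L₂.i = 0
  · exact refutable_of_cycle rfl L₂ L₁ h3 hV hi₂ (by rw [Finset.union_comm, hU])
      (by rw [Finset.inter_comm, hs])
  · exfalso
    have h4 := L₁.deg_start_le hi₁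
    have h5 := L₂.deg_start_le hi₂
    have h6 := deg_union_add_deg_inter L₁.clauses L₂.clauses p.1
    have h7 := h3 p.1 (mem_vars.2 ⟨c, hc, p, hpc, rfl⟩)
    rw [hU] at h6
    rw [opp_fst] at h5
    omega

/-! ### Elimination of a variable that occurs in two clauses -/

theorem degIn_erase_of_ne {c : Clause} {l : Literal} {y : ℕ} (hy : l.1 ≠ y) :
    degIn y (c.erase l) = degIn y c := by
  rw [degIn, degIn, Finset.filter_erase, Finset.erase_eq_of_notMem]
  simp [hy]

/-- Eliminating a variable that occurs in only two clauses. -/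
theorem MinimalUnsat.eliminate {Φ : CNF} (h : MinimalUnsat Φ) (h2 : IsTwoCNF Φ) {x : ℕ}
    (hx : x ∈ vars Φ) (hdeg : deg Φ x < 3) : ∃ Φ' : CNF, MStep Φ.val Φ'.val ∧ Φ'.card < Φ.card ∧
      MinimalUnsat Φ' ∧ IsTwoCNF Φ' ∧
      ((∅ ∉ Φ' ∧ ∀ a : Literal, {a} ∉ Φ') → FewCubic Φ → FewCubic Φ') := by
  obtain ⟨c, hc, d, hd, hxc, hxd⟩ : ∃ c ∈ Φ, ∃ d ∈ Φ, (x, true) ∈ c ∧ (x, false) ∈ d := by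
    obtain ⟨c, hc, ⟨y, b⟩, hl, hlx⟩ := mem_vars.1 hx
    obtain rfl : y = x := hlx
    obtain ⟨d, hd, hl'⟩ := h.pos_vars hc hl
    cases b
    · exact ⟨d, hd, c, hc, hl', hl⟩
    · exact ⟨c, hc, d, hd, hl, hl'⟩
  have hcd : c ≠ d := by
    rintro rfl
    exact h.opp_notMem hc hxc hxd
  have honly : ∀ e ∈ Φ, ∀ l ∈ e, l.1 = x → e = c ∨ e = d := by
    intro e he l hl hlx
    by_contra hne
    push Not at hne
    have : ({e, c, d} : Finset Clause) ⊆ Φ.filter fun c => ∃ l ∈ c, l.1 = x := by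
      intro f hf
      simp only [Finset.mem_insert, Finset.mem_singleton] at hf
      rcases hf with rfl | rfl | rfl
      exacts [Finset.mem_filter.2 ⟨he, l, hl, hlx⟩, Finset.mem_filter.2 ⟨hc, _, hxc, rfl⟩,
        Finset.mem_filter.2 ⟨hd, _, hxd, rfl⟩]
    have h4 := Finset.card_le_card this
    rw [Finset.card_eq_three.2 ⟨e, c, d, hne.1, hne.2, hcd, rfl⟩] at h4
    exact absurd hdeg (not_lt.2 h4)
  set r : Clause := c.erase (x, true) ∪ d.erase (x, false) with hr
  have hres : IsResolvent c d r := ⟨x, hxc, hxd, rfl⟩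
  have hxr : ∀ l ∈ r, l.1 ≠ x := by
    intro l hl hlx
    rw [hr, Finset.mem_union, Finset.mem_erase, Finset.mem_erase] at hl
    rcases hl with ⟨h1, hl⟩ | ⟨h1, hl⟩
    · rcases eq_or_eq_opp (m := (x, true)) hlx with rfl | rfl
      · exact h1 rfl
      · exact h.opp_notMem hc hxc hl
    · rcases eq_or_eq_opp (m := (x, false)) hlx with rfl | rfl
      · exact h1 rfl
      · exact h.opp_notMem hd hxd hl
  have hrc : r ≠ c := fun e => hxr _ (e ▸ hxc) rfl
  have hrd : r ≠ d := fun e => hxr _ (e ▸ hxd) rfl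
  have hrΦ := h.resolvent_notMem hres hc hd hrc hrd
  have hunsat : ¬ Satisfiable ((Φ \ {c, d}) ∪ {r}) := by
    rintro ⟨v, hv⟩
    obtain ⟨l, hl, hvl⟩ := hv r (by simp)
    have hl' := hl
    rw [hr, Finset.mem_union] at hl'
    -- The true literal `l` of the resolvent satisfies one parent; `x` is chosen to satisfy the
    -- other.
    refine h.1 ⟨Function.update v x (decide (l ∉ c)), fun e he => ?_⟩
    have hupd : ∀ m : Literal, m.1 ≠ x → v m.1 = m.2 →
        Function.update v x (decide (l ∉ c)) m.1 = m.2 := fun m hm hvm => by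
      rw [Function.update_of_ne hm, hvm]
    by_cases hec : e = c
    · subst hec
      by_cases hle : l ∈ e
      · exact ⟨l, hle, hupd l (hxr l hl) hvl⟩
      · exact ⟨_, hxc, by simp [hle]⟩
    by_cases hed : e = d
    · subst hed
      by_cases hlc : l ∈ c
      · exact ⟨_, hxd, by simp [hlc]⟩
      · exact ⟨l, Finset.mem_of_mem_erase
          (hl'.resolve_left fun h => hlc (Finset.mem_of_mem_erase h)), hupd l (hxr l hl) hvl⟩
    · obtain ⟨m, hm, hvm⟩ := hv e (by simp [he, hec, hed])
      refine ⟨m, hm, hupd m (fun hmx => ?_) hvm⟩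
      rcases honly e he m hm hmx with h | h
      exacts [hec h, hed h]
  have hΦc : Φ = insert c (insert d (Φ \ {c, d})) := by
    ext e
    simp only [Finset.mem_insert, Finset.mem_sdiff, Finset.mem_singleton]
    constructor
    · intro he; tauto
    · rintro (rfl | rfl | h)
      exacts [hc, hd, h.1]
  have hdn : d ∉ Φ \ {c, d} := by simp
  have hcn : c ∉ insert d (Φ \ {c, d}) := by simp [hcd]
  have hrn : r ∉ Φ \ {c, d} := fun h => hrΦ (Finset.sdiff_subset h)
  have hΦ' : (Φ \ {c, d}) ∪ {r} = insert r (Φ \ {c, d}) := by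
    rw [Finset.union_comm]; rfl
  have hm := h.step hres hc hd hunsat
  rw [hΦ'] at hm
  have hcard : r.card ≤ (c.erase (x, true)).card + (d.erase (x, false)).card :=
    Finset.card_union_le _ _
  rw [Finset.card_erase_of_mem hxc, Finset.card_erase_of_mem hxd] at hcard
  have hc2 := h2 c hc
  have hd2 := h2 d hd
  refine ⟨insert r (Φ \ {c, d}), ⟨c, d, r, (Φ \ {c, d}).val, hres, ?_, ?_⟩, ?_, hm, ?_, ?_⟩
  · conv_lhs => rw [hΦc]
    rw [Finset.insert_val_of_notMem hcn, Finset.insert_val_of_notMem hdn]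
  · rw [Finset.insert_val_of_notMem hrn]
  · conv_rhs => rw [hΦc]
    rw [Finset.card_insert_of_notMem hcn, Finset.card_insert_of_notMem hdn,
      Finset.card_insert_of_notMem hrn]
    omega
  · intro e he
    rcases Finset.mem_insert.1 he with rfl | he
    · omega
    · exact h2 e (Finset.sdiff_subset he)
  · rintro ⟨h0, h1⟩ hV V hV'
    refine hV V fun y hy => ?_
    rw [← hV' y hy, ← h.sum_degIn, ← hm.sum_degIn]
    have hyx : x ≠ y := by
      rintro rfl
      have h3 := hV' x hy
      have h4 : deg (insert r (Φ \ {c, d})) x = 0 := by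
        rw [deg, Finset.card_eq_zero, Finset.filter_eq_empty_iff]
        rintro e he ⟨l, hl, hlx⟩
        rcases Finset.mem_insert.1 he with rfl | he
        · exact hxr l hl hlx
        · rcases honly e (Finset.sdiff_subset he) l hl hlx with rfl | rfl <;> simp at he
      omega
    conv_lhs => rw [hΦc]
    rw [Finset.sum_insert hcn, Finset.sum_insert hdn, Finset.sum_insert hrn, ← add_assoc]
    congr 1
    -- A resolvent with two literals inherits one from each parent, so nothing is merged and all
    -- other degrees are unchanged.
    have hr0 : r.card ≠ 0 := fun e =>
      h0 (Finset.card_eq_zero.1 e ▸ Finset.mem_insert_self _ _)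
    have hr1 : r.card ≠ 1 := fun e => by
      obtain ⟨a, ha⟩ := Finset.card_eq_one.1 e
      exact h1 a (ha ▸ Finset.mem_insert_self _ _)
    have hdisj : Disjoint (c.erase (x, true)) (d.erase (x, false)) := by
      rw [← Finset.card_union_eq_card_add_card, Finset.card_erase_of_mem hxc,
        Finset.card_erase_of_mem hxd, ← hr]
      omega
    rw [← degIn_erase_of_ne (l := (x, true)) (c := c) hyx,
      ← degIn_erase_of_ne (l := (x, false)) (c := d) hyx, degIn, degIn, degIn, hr,
      Finset.filter_union, Finset.card_union_of_disjoint]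
    exact Finset.disjoint_filter_filter hdisj

theorem MinimalUnsat.refutable {Φ : CNF} (h : MinimalUnsat Φ) (h2 : IsTwoCNF Φ)
    (hV : FewCubic Φ) : Refutable Φ.val := by
  induction hn : Φ.card using Nat.strong_induction_on generalizing Φ with
  | _ n ih =>
    by_cases h0 : ∅ ∈ Φ
    · exact ⟨Φ.val.erase ∅, by rw [Multiset.cons_erase (show ∅ ∈ Φ.val from h0)]⟩
    by_cases h1 : ∃ a : Literal, {a} ∈ Φ
    · obtain ⟨a, ha⟩ := h1
      exact h.refutable_of_unit h2 ha
    push Not at h1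
    by_cases h3 : ∀ x ∈ vars Φ, 3 ≤ deg Φ x
    · exact h.refutable_of_three_le h2 h0 h1 h3 hV
    push Not at h3
    obtain ⟨x, hx, hdeg⟩ := h3
    obtain ⟨Φ', hstep, hcard, hm, h2', hV'⟩ := h.eliminate h2 hx hdeg
    -- If the resolvent is empty or a unit clause, degrees may have changed, but the induction
    -- hypothesis is not needed.
    have key : Refutable Φ'.val := by
      by_cases h0' : ∅ ∈ Φ'
      · exact ⟨Φ'.val.erase ∅, by rw [Multiset.cons_erase (show ∅ ∈ Φ'.val from h0')]⟩
      by_cases h1' : ∃ a : Literal, {a} ∈ Φ'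
      · obtain ⟨a, ha⟩ := h1'
        exact hm.refutable_of_unit h2' ha
      push Not at h1'
      exact ih _ (hn ▸ hcard) hm h2' (hV' ⟨h0', h1'⟩ hV) rfl
    obtain ⟨N, hN⟩ := key
    exact ⟨N, .head hstep hN⟩

/-- A minimal unsatisfiable 2CNF formula has a read-once refutation if and only if at most two of
its variables have degree three. -/
theorem MinimalUnsat.ror_iff {Φ : CNF} (h : MinimalUnsat Φ) (h2 : IsTwoCNF Φ) :
    ROR Φ ↔ FewCubic Φ :=
  ⟨fun hR V hV => h.card_odd_le h2 hR V fun x hx => by rw [hV x hx]; decide,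
    fun hV => ror_of_refutable h (h.refutable h2 hV)⟩

end ReadOnce

namespace ReadOnce

open Computability

/-! ### Reading a formula off its reversed word -/

/-- The digits at the head of a word. -/
def headDigits : List Symb → List Bool
  | .digit b :: s => b :: headDigits s
  | _ => []

/-- The literal whose sign is followed by `s` in a reversed word. -/
def literalOf (b : Bool) (s : List Symb) : Literal := (decodeNat (headDigits s).reverse, b)

/-- The literals at the head of a reversed word, up to the first end marker. -/
def headClause : List Symb → Clause
  | .sign b :: s => insert (literalOf b s) (headClause s)
  | .digit _ :: s => headClause s
  | _ => ∅

/-- The formula that a reversed word presents. -/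
def readCNF : List Symb → CNF
  | .clauseEnd :: s => insert (headClause s) (readCNF s)
  | _ :: s => readCNF s
  | [] => ∅

/-- The words that may follow a symbol in a reversed word. -/
def CanFollow : Symb → List Symb → Prop
  | .digit _, _ => True
  | .sign _, s => s[0]? ≠ some (.digit false)
  | .clauseEnd, s => ∀ b, s[0]? ≠ some (.digit b)

/-- All symbols of a reversed word are followed by words that may follow them. -/
def Chained : List Symb → Prop
  | [] => True
  | a :: s => CanFollow a s ∧ Chained s

/-- The reversed words that present formulas. -/
def Valid (v : List Symb) : Prop :=
  ((∀ b, v[0]? ≠ some (.digit b)) ∧ ∀ b, v[0]? ≠ some (.sign b)) ∧ Chained v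

/-- Binary digits are written with the least significant first, so the numerals are the words that
do not end with the digit 0. In a reversed word this says that a sign is not followed by 0, which is
local and can be tested. -/
theorem encodeNat_decodeNat {l : List Bool} (h : l.getLast? ≠ some false) :
    encodeNat (decodeNat l) = l := by
  have key : ∀ l : List Bool, l ≠ [] → l.getLast? ≠ some false →
      encodePosNum (decodePosNum l) = l := by
    intro l
    induction l with
    | nil => simp
    | cons b l ih =>
      intro _ h
      cases l with
      | nil => cases b <;> simp_all [decodePosNum, encodePosNum]
      | cons c l =>
        have := ih (by simp) (by simpa using h)
        cases b <;> simp [decodePosNum, encodePosNum, this]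
  cases l with
  | nil => rfl
  | cons b l =>
    have := key _ (by simp) h
    simp only [encodeNat, decodeNat, decodeNum]
    simp only [reduceCtorEq, if_false, Num.of_to_nat]
    simpa [encodeNum] using this

theorem getLast?_encodeNat (n : ℕ) : (encodeNat n).getLast? ≠ some false := by
  have key : ∀ n : PosNum, (encodePosNum n).getLast? = some true := by
    intro n
    induction n with
    | one => simp [encodePosNum]
    | bit0 n ih => simp [encodePosNum, List.getLast?_cons, ih]
    | bit1 n ih => simp [encodePosNum, List.getLast?_cons, ih]
  rw [encodeNat]
  cases (n : Num) with
  | zero => simp [encodeNum]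
  | pos p => simp [encodeNum, key]

theorem headDigits_append {l : List Bool} {s : List Symb} (hs : ∀ b, s[0]? ≠ some (.digit b)) :
    headDigits (l.map .digit ++ s) = l := by
  induction l with
  | nil =>
    cases s with
    | nil => rfl
    | cons a s => cases a <;> simp_all [headDigits]
  | cons b l ih => simp [headDigits, ih]

theorem exists_eq_headDigits_append (s : List Symb) :
    ∃ t, s = (headDigits s).map .digit ++ t ∧ ∀ b, t[0]? ≠ some (.digit b) := by
  induction s with
  | nil => exact ⟨[], rfl, by simp⟩
  | cons a s ih =>
    cases a with
    | digit b =>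
      obtain ⟨t, h, ht⟩ := ih
      refine ⟨t, ?_, ht⟩
      simp only [headDigits, List.map_cons, List.cons_append]
      rw [← h]
    | sign b => exact ⟨_, rfl, by simp⟩
    | clauseEnd => exact ⟨_, rfl, by simp⟩

theorem reverse_encodeLiteral (l : Literal) : (encodeLiteral l).reverse =
    .sign l.2 :: (encodeNat l.1).reverse.map .digit := by
  simp [encodeLiteral]

/-- The reversed word of a list of literals in front of `s`. -/
theorem reverse_flatMap_append (c : List Literal) {s : List Symb}
    (hs : ∀ b, s[0]? ≠ some (.digit b)) (hc : Chained s) :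
    (∀ b, ((c.flatMap encodeLiteral).reverse ++ s)[0]? ≠ some (.digit b)) ∧
    Chained ((c.flatMap encodeLiteral).reverse ++ s) ∧
    headClause ((c.flatMap encodeLiteral).reverse ++ s) = c.toFinset ∪ headClause s ∧
    readCNF ((c.flatMap encodeLiteral).reverse ++ s) = readCNF s := by
  induction c using List.reverseRecOn with
  | nil => simp [hs, hc]
  | append_singleton c l ih =>
    obtain ⟨h1, h2, h3, h4⟩ := ih
    rw [List.flatMap_append, List.reverse_append, List.flatMap_singleton, reverse_encodeLiteral,
      List.append_assoc]
    generalize (c.flatMap encodeLiteral).reverse ++ s = t at h1 h2 h3 h4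
    have hl : literalOf l.2 ((encodeNat l.1).reverse.map .digit ++ t) = l := by
      rw [literalOf, headDigits_append h1, List.reverse_reverse, decode_encodeNat]
    have hd : ∀ d : List Bool, (Chained (d.map .digit ++ t) ∧
        headClause (d.map .digit ++ t) = headClause t ∧
        readCNF (d.map .digit ++ t) = readCNF t) := by
      intro d
      induction d with
      | nil => exact ⟨h2, rfl, rfl⟩
      | cons b d ih => exact ⟨⟨trivial, ih.1⟩, ih.2.1, ih.2.2⟩
    obtain ⟨k1, k2, k3⟩ := hd (encodeNat l.1).reverse
    refine ⟨by simp, ⟨?_, k1⟩, ?_, ?_⟩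
    · show _ ≠ _
      have := getLast?_encodeNat l.1
      rw [← List.head?_reverse] at this
      cases h : (encodeNat l.1).reverse with
      | nil => simpa using h1 false
      | cons b d => simpa [h] using this
    · simp only [List.cons_append, headClause, hl, k2, h3]
      ext; simp
    · simp only [List.cons_append, readCNF, k3, h4]

theorem valid_reverse_encodeFormula (φ : List (List Literal)) :
    Valid (encodeFormula φ).reverse ∧ readCNF (encodeFormula φ).reverse = toCNF φ := by
  induction φ using List.reverseRecOn with
  | nil => simp [encodeFormula, Valid, Chained, readCNF, toCNF]
  | append_singleton φ c ih =>
    obtain ⟨⟨h1, h2⟩, h3⟩ := ih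
    have e : (encodeFormula (φ ++ [c])).reverse =
        .clauseEnd :: ((c.flatMap encodeLiteral).reverse ++ (encodeFormula φ).reverse) := by
      simp [encodeFormula, encodeClause, List.flatMap_append]
    obtain ⟨k1, k2, k3, k4⟩ := reverse_flatMap_append c h1.1 h2
    have h0 : headClause (encodeFormula φ).reverse = ∅ := by
      cases h : (encodeFormula φ).reverse with
      | nil => rfl
      | cons a s => cases a <;> simp_all [headClause]
    rw [e]
    refine ⟨⟨by simp, k1, k2⟩, ?_⟩
    simp only [readCNF, k3, k4, h0, h3]
    ext; simp [toCNF]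

/-- Parsing by induction on a bound for the length, since a literal is split off together with its
whole block of digits. The list `c` is the clause whose end marker has not yet been read. -/
theorem exists_encode (n : ℕ) : ∀ s : List Symb, s.length ≤ n → Chained s →
    (∀ b, s[0]? ≠ some (.digit b)) → ∃ (φ : List (List Literal)) (c : List Literal),
      s = (c.flatMap encodeLiteral).reverse ++ (encodeFormula φ).reverse := by
  induction n with
  | zero =>
    intro s hs _ _
    exact ⟨[], [], by simpa [encodeFormula] using hs⟩
  | succ n ih =>
    intro s hs hc h0
    rcases s with _ | ⟨a, s⟩
    · exact ⟨[], [], rfl⟩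
    cases a with
    | digit b => simp at h0
    | clauseEnd =>
      obtain ⟨φ, c, h⟩ := ih s (by simpa using hs) hc.2 hc.1
      exact ⟨φ ++ [c], [], by simp [h, encodeFormula, encodeClause, List.flatMap_append]⟩
    | sign b =>
      obtain ⟨t, ht, ht0⟩ := exists_eq_headDigits_append s
      have htc : ∀ d : List Bool, Chained (d.map .digit ++ t) → Chained t := by
        intro d
        induction d with
        | nil => exact id
        | cons b d ih => exact fun h => ih h.2
      have hlen : t.length ≤ n := by
        have := congrArg List.length ht
        simp at this hs
        omega
      obtain ⟨φ, c, h⟩ := ih t hlen (htc _ (ht ▸ hc.2)) ht0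
      refine ⟨φ, c ++ [(decodeNat (headDigits s).reverse, b)], ?_⟩
      rw [List.flatMap_append, List.reverse_append, List.flatMap_singleton, reverse_encodeLiteral,
        List.append_assoc, ← h]
      dsimp only
      rw [encodeNat_decodeNat, List.reverse_reverse, List.cons_append, ← ht]
      rw [List.getLast?_reverse]
      have h1 : s[0]? ≠ some (.digit false) := hc.1
      cases s with
      | nil => simp [headDigits]
      | cons a s =>
        cases a with
        | digit b => simpa [headDigits] using h1
        | sign b => simp [headDigits]
        | clauseEnd => simp [headDigits]

/-- The language in terms of reversed words. -/
theorem mem_rorMinimalUnsatTwoCNF (w : List Symb) : w ∈ rorMinimalUnsatTwoCNF ↔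
    Valid w.reverse ∧ IsTwoCNF (readCNF w.reverse) ∧ MinimalUnsat (readCNF w.reverse) ∧
      FewCubic (readCNF w.reverse) := by
  constructor
  · rintro ⟨φ, rfl, h2, hm, hr⟩
    obtain ⟨hv, e⟩ := valid_reverse_encodeFormula φ
    rw [e]
    exact ⟨hv, h2, hm, (hm.ror_iff h2).1 hr⟩
  · rintro ⟨hv, h2, hm, hr⟩
    obtain ⟨φ, c, h⟩ := exists_encode _ _ le_rfl hv.2 hv.1.1
    -- A pending clause would put a sign at the head of the reversed word.
    have hc : c = [] := by
      cases c using List.reverseRecOn with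
      | nil => rfl
      | append_singleton c l =>
        rw [List.flatMap_append, List.reverse_append, List.flatMap_singleton,
          reverse_encodeLiteral] at h
        exact absurd (by rw [h]; rfl) (hv.1.2 l.2)
    subst hc
    have e : encodeFormula φ = w := by simpa using h.symm
    refine ⟨φ, e, ?_⟩
    rw [← (valid_reverse_encodeFormula φ).2, e]
    exact ⟨h2, hm, (hm.ror_iff h2).2 hr⟩

/-! ### Positions of a word -/

theorem chained_iff (v : List Symb) :
    Chained v ↔ ∀ i a, v[i]? = some a → CanFollow a (v.drop (i + 1)) := by
  induction v with
  | nil => simp [Chained]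
  | cons a s ih =>
    rw [Chained, ih]
    constructor
    · rintro ⟨h1, h2⟩ (_ | i) b hb
      · simp at hb; subst hb; exact h1
      · exact h2 i b (by simpa using hb)
    · intro h
      exact ⟨h 0 a rfl, fun i b hb => h (i + 1) b (by simpa using hb)⟩

/-- The symbol at a position is a digit. -/
def DigitAt (v : List Symb) (i : ℕ) : Prop :=
  v[i]? = some (.digit true) ∨ v[i]? = some (.digit false)

/-- The symbol at a position is a sign. -/
def SignAt (v : List Symb) (i : ℕ) : Prop :=
  v[i]? = some (.sign true) ∨ v[i]? = some (.sign false)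

/-- The literal whose sign is at a position. -/
def litAt (v : List Symb) (i : ℕ) : Literal :=
  literalOf (decide (v[i]? = some (.sign true))) (v.drop (i + 1))

/-- The clause whose end marker is at a position. -/
def clauseAt (v : List Symb) (i : ℕ) : Clause := headClause (v.drop (i + 1))

/-- The literals whose signs occur in a word. -/
def lits (v : List Symb) : Set Literal := {l | ∃ p, SignAt v p ∧ litAt v p = l}

theorem signAt_iff {v : List Symb} {i : ℕ} : SignAt v i ↔ ∃ b, v[i]? = some (.sign b) := by
  simp [SignAt, or_comm]

theorem SignAt.lt_length {v : List Symb} {i : ℕ} (h : SignAt v i) : i < v.length := by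
  obtain ⟨b, hb⟩ := signAt_iff.1 h
  exact (List.getElem?_eq_some_iff.1 hb).1

theorem lits_subset_image (v : List Symb) : lits v ⊆ litAt v '' Set.Iio v.length := by
  rintro l ⟨p, hp, rfl⟩
  exact ⟨p, hp.lt_length, rfl⟩

theorem lits_finite (v : List Symb) : (lits v).Finite :=
  ((Set.finite_Iio _).image _).subset (lits_subset_image v)

theorem ncard_lits_le (v : List Symb) : (lits v).ncard ≤ v.length := by
  refine (Set.ncard_le_ncard (lits_subset_image v) ((Set.finite_Iio _).image _)).trans ?_
  refine (Set.ncard_image_le (Set.finite_Iio _)).trans ?_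
  rw [Set.ncard_eq_toFinset_card']
  simp

theorem mem_readCNF_iff (v : List Symb) (c : Clause) : c ∈ readCNF v ↔
    ∃ e < v.length, v[e]? = some .clauseEnd ∧ clauseAt v e = c := by
  have : c ∈ readCNF v ↔ ∃ e, v[e]? = some .clauseEnd ∧ clauseAt v e = c := by
    induction v with
    | nil => simp [readCNF]
    | cons a s ih =>
      rw [← Nat.or_exists_add_one]
      cases a <;> simp [readCNF, ih, clauseAt, eq_comm]
  rw [this]
  refine exists_congr fun e => ⟨fun h => ⟨(List.getElem?_eq_some_iff.1 h.1).1, h⟩, fun h => h.2⟩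

/-- The digits after two positions agree. -/
def SameDigits (v : List Symb) (i j : ℕ) : Prop :=
  ¬ ∃ k < v.length, (¬ ∃ m < k, ¬ DigitAt v (i + 1 + m)) ∧
    ¬ ∀ b, v[i + 1 + k]? = some (.digit b) ↔ v[j + 1 + k]? = some (.digit b)

/-- Positions are compared up to and including the first non-digit of `s`; there the condition says
that the digits of `t` stop too. -/
theorem headDigits_eq_iff (s t : List Symb) : headDigits s = headDigits t ↔
    ∀ k : ℕ, (∀ m < k, ∃ b, s[m]? = some (Symb.digit b)) →
      ∀ b, s[k]? = some (Symb.digit b) ↔ t[k]? = some (Symb.digit b) := by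
  induction s generalizing t with
  | nil =>
    cases t with
    | nil => simp
    | cons a t =>
      constructor
      · intro h k hk b
        cases k with
        | zero => cases a <;> simp_all [headDigits]
        | succ k => simpa using hk 0 (by omega)
      · intro h
        have := h 0 (by simp)
        cases a <;> simp_all [headDigits]
  | cons c s ih =>
    by_cases hc : ∃ b, c = .digit b
    · obtain ⟨b, rfl⟩ := hc
      constructor
      · intro h k hk b'
        cases t with
        | nil => simp [headDigits] at h
        | cons a t =>
          cases a with
          | digit a =>
            simp only [headDigits, List.cons.injEq] at h
            cases k with
            | zero => simp [h.1]
            | succ k =>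
              simpa using (ih t).1 h.2 k (fun m hm => by simpa using hk (m + 1) (by omega)) b'
          | sign a => simp [headDigits] at h
          | clauseEnd => simp [headDigits] at h
      · intro h
        have h0 := (h 0 (by simp) b).1 rfl
        cases t with
        | nil => simp at h0
        | cons a t =>
          simp only [List.getElem?_cons_zero, Option.some.injEq] at h0
          subst h0
          simp only [headDigits, List.cons.injEq, true_and]
          refine (ih t).2 fun k hk b' => ?_
          have := h (k + 1) (fun m hm => ?_) b'
          · simpa using this
          · cases m with
            | zero => exact ⟨b, rfl⟩
            | succ m => simpa using hk m (by omega)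
    · have e : headDigits (c :: s) = [] := by cases c <;> simp_all [headDigits]
      rw [e]
      constructor
      · intro h k hk b
        cases k with
        | zero =>
          have hcb : (c :: s)[0]? ≠ some (Symb.digit b) := fun h => hc ⟨b, by simpa using h⟩
          refine iff_of_false hcb ?_
          cases t with
          | nil => simp
          | cons a t =>
            cases a with
            | digit a => simp [headDigits] at h
            | sign a => simp
            | clauseEnd => simp
        | succ k =>
          obtain ⟨b', hb'⟩ := hk 0 (by omega)
          exact absurd ⟨b', by simpa using hb'⟩ hc
      · intro h
        have h0 := h 0 (by simp)
        cases t with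
        | nil => rfl
        | cons a t =>
          cases a with
          | digit b => exact absurd ⟨b, by simpa using (h0 b).2 rfl⟩ hc
          | sign b => rfl
          | clauseEnd => rfl

theorem digitAt_iff {v : List Symb} {i : ℕ} : DigitAt v i ↔ ∃ b, v[i]? = some (.digit b) := by
  simp [DigitAt, or_comm]

theorem sameDigits_iff_headDigits (v : List Symb) (i j : ℕ) : SameDigits v i j ↔
    headDigits (v.drop (i + 1)) = headDigits (v.drop (j + 1)) := by
  rw [headDigits_eq_iff, SameDigits]
  push Not
  simp only [List.getElem?_drop, ← digitAt_iff]
  refine ⟨fun h k hk => ?_, fun h k _ hk => h k hk⟩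
  by_cases hkn : k < v.length
  · exact h k hkn hk
  · intro b
    rw [List.getElem?_eq_none (by omega), List.getElem?_eq_none (by omega)]

theorem getLast?_reverse_headDigits {v : List Symb} (hv : Chained v) {i : ℕ} (hi : SignAt v i) :
    (headDigits (v.drop (i + 1))).reverse.getLast? ≠ some false := by
  obtain ⟨b, hb⟩ := signAt_iff.1 hi
  have h1 : (v.drop (i + 1))[0]? ≠ some (.digit false) := (chained_iff v).1 hv i _ hb
  rw [List.getLast?_reverse]
  cases h : v.drop (i + 1) with
  | nil => simp [headDigits]
  | cons a s =>
    rw [h] at h1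
    cases a with
    | digit b => simpa [headDigits] using h1
    | sign b => simp [headDigits]
    | clauseEnd => simp [headDigits]

/-- Numerals in a valid word are canonical, so variables are compared digit by digit and no
arithmetic is needed. -/
theorem sameDigits_iff {v : List Symb} (hv : Chained v) {i j : ℕ} (hi : SignAt v i)
    (hj : SignAt v j) : SameDigits v i j ↔ (litAt v i).1 = (litAt v j).1 := by
  rw [sameDigits_iff_headDigits]
  refine ⟨fun h => by simp [litAt, literalOf, h], fun h => ?_⟩
  have := congrArg encodeNat h
  simpa only [litAt, literalOf, encodeNat_decodeNat (getLast?_reverse_headDigits hv hi),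
    encodeNat_decodeNat (getLast?_reverse_headDigits hv hj), List.reverse_inj] using this

/-- A sign that belongs to the clause whose end marker is at the position `e`. -/
def SignIn (v : List Symb) (e k : ℕ) : Prop :=
  SignAt v (e + 1 + k) ∧ ¬ ∃ m < k, v[e + 1 + m]? = some .clauseEnd

theorem mem_headClause_iff (s : List Symb) (l : Literal) : l ∈ headClause s ↔
    ∃ k, (SignAt s k ∧ ∀ m < k, s[m]? ≠ some .clauseEnd) ∧ litAt s k = l := by
  induction s with
  | nil => simp [headClause, SignAt]
  | cons a s ih =>
    rw [← Nat.or_exists_add_one]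
    have e : ∀ k, (∀ m < k + 1, (a :: s)[m]? ≠ some .clauseEnd) ↔
        a ≠ .clauseEnd ∧ ∀ m < k, s[m]? ≠ some .clauseEnd := by
      intro k
      constructor
      · intro h
        exact ⟨by simpa using h 0 (by omega), fun m hm => by simpa using h (m + 1) (by omega)⟩
      · rintro ⟨h1, h2⟩ (_ | m) hm
        · simpa using h1
        · simpa using h2 m (by omega)
    simp only [e]
    cases a with
    | digit b => simp [headClause, ih, SignAt, litAt]
    | clauseEnd => simp [headClause, SignAt]
    | sign b =>
      simp only [headClause, Finset.mem_insert, ih]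
      refine or_congr ?_ ?_
      · cases b <;> simp [SignAt, litAt, eq_comm]
      · simp [SignAt, litAt]

theorem mem_clauseAt_iff (v : List Symb) (e : ℕ) (l : Literal) : l ∈ clauseAt v e ↔
    ∃ k < v.length, SignIn v e k ∧ litAt v (e + 1 + k) = l := by
  rw [clauseAt, mem_headClause_iff]
  have e1 : ∀ k, SignAt (v.drop (e + 1)) k ↔ SignAt v (e + 1 + k) := by simp [SignAt]
  have e2 : ∀ k, litAt (v.drop (e + 1)) k = litAt v (e + 1 + k) := by
    intro k
    simp only [litAt, List.getElem?_drop, List.drop_drop, add_assoc]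
  simp only [e1, e2, List.getElem?_drop]
  refine exists_congr fun k => ⟨fun h => ⟨?_, ⟨h.1.1, ?_⟩, h.2⟩, fun h => ⟨⟨h.2.1.1, ?_⟩, h.2.2⟩⟩
  · have := h.1.1.lt_length
    omega
  · push Not; exact h.1.2
  · have := h.2.1.2; push Not at this; exact this

/-- The induction over suffixes needs the literals of a clause cut open at the head; a valid word
has none. -/
theorem mem_lits_iff {v : List Symb} (hv : Valid v) (l : Literal) :
    l ∈ lits v ↔ ∃ c ∈ readCNF v, l ∈ c := by
  have key : ∀ s : List Symb, l ∈ lits s ↔ l ∈ headClause s ∨ ∃ c ∈ readCNF s, l ∈ c := by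
    intro s
    induction s with
    | nil => simp [lits, SignAt, headClause, readCNF]
    | cons a s ih =>
      have e : l ∈ lits (a :: s) ↔ (SignAt (a :: s) 0 ∧ litAt (a :: s) 0 = l) ∨ l ∈ lits s := by
        simp only [lits, Set.mem_ofPred_eq]
        rw [← Nat.or_exists_add_one]
        simp [SignAt, litAt]
      rw [e, ih]
      cases a with
      | digit b => simp [SignAt, headClause, readCNF]
      | clauseEnd => simp [SignAt, headClause, readCNF]
      | sign b =>
        simp only [headClause, readCNF, Finset.mem_insert, or_assoc]
        refine or_congr ?_ Iff.rfl
        cases b <;> simp [SignAt, litAt, eq_comm]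
  rw [key]
  have h0 : headClause v = ∅ := by
    have := hv.1
    cases v with
    | nil => rfl
    | cons a s => cases a <;> simp_all [headClause]
  simp [h0]

end ReadOnce

namespace ReadOnce

open Function

/-! ### Definable properties of valid reversed words -/

/-- A way in which the values of the variables below `depth` represent the elements of `α`. -/
structure Ctx (α : Type) where
  depth : ℕ
  Rep : List Symb → (ℕ → List Symb) → α → Prop
  valid : ∀ {v E a}, Rep v E a → Valid v
  congr : ∀ {v E E' a}, (∀ i < depth, E i = E' i) → Rep v E a → Rep v E' a

variable {α β : Type}

/-- `D` has one more component than `C`. -/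
structure Ctx.Ext (D : Ctx (α × β)) (C : Ctx α) : Prop where
  le : C.depth ≤ D.depth
  rep : ∀ {v E x}, D.Rep v E x → C.Rep v E x.1

/-- The sum of the numbers in `t` and `k`. -/
def Form.val (E : ℕ → List Symb) (t : List ℕ) (k : ℕ) : ℕ :=
  (t.map fun i => (E i).length).sum + k

/-- Properties that are expressed by a formula. -/
def Defn (C : Ctx α) (P : List Symb → α → Prop) : Prop :=
  ∃ φ : Form, ∀ v E a, C.Rep v E a → (φ.holds v C.depth E ↔ P v a)

/-- Literals that are represented by the position of a sign. -/
def LitTerm (C : Ctx α) (l : List Symb → α → Literal) : Prop :=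
  ∃ (t : List ℕ) (k : ℕ), (∀ i ∈ t, i < C.depth) ∧ ∀ v E a, C.Rep v E a →
    SignAt v (Form.val E t k) ∧ litAt v (Form.val E t k) = l v a

/-- Clauses that are represented by the position of an end marker. -/
def ClauseTerm (C : Ctx α) (c : List Symb → α → Clause) : Prop :=
  ∃ (t : List ℕ) (k : ℕ), (∀ i ∈ t, i < C.depth) ∧ ∀ v E a, C.Rep v E a →
    v[Form.val E t k]? = some .clauseEnd ∧ clauseAt v (Form.val E t k) = c v a

/-- Sets of literals that are represented by the set of the positions of their signs. -/
def SetTerm (C : Ctx α) (S : List Symb → α → Set Literal) : Prop :=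
  ∃ i < C.depth, ∀ v E a, C.Rep v E a →
    ∀ p : ℕ, (E i)[p]? = some (.sign true) ↔ SignAt v p ∧ litAt v p ∈ S v a

section terms

variable {C : Ctx α} {D : Ctx (α × β)}

theorem LitTerm.lift {l : List Symb → α → Literal} (h : LitTerm C l) (hD : D.Ext C) :
    LitTerm D fun v x => l v x.1 := by
  obtain ⟨t, k, ht, h⟩ := h
  exact ⟨t, k, fun i hi => (ht i hi).trans_le hD.le, fun v E a ha => h v E _ (hD.rep ha)⟩

theorem ClauseTerm.lift {c : List Symb → α → Clause} (h : ClauseTerm C c) (hD : D.Ext C) :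
    ClauseTerm D fun v x => c v x.1 := by
  obtain ⟨t, k, ht, h⟩ := h
  exact ⟨t, k, fun i hi => (ht i hi).trans_le hD.le, fun v E a ha => h v E _ (hD.rep ha)⟩

theorem LitTerm.mem_lits {l : List Symb → α → Literal} (h : LitTerm C l) {v : List Symb}
    {E : ℕ → List Symb} {a : α} (ha : C.Rep v E a) : l v a ∈ lits v := by
  obtain ⟨t, k, -, h⟩ := h
  exact ⟨_, h v E a ha⟩

theorem ClauseTerm.mem_readCNF {c : List Symb → α → Clause} (h : ClauseTerm C c) {v : List Symb}
    {E : ℕ → List Symb} {a : α} (ha : C.Rep v E a) : c v a ∈ readCNF v := by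
  obtain ⟨t, k, -, h⟩ := h
  obtain ⟨h1, h2⟩ := h v E a ha
  exact (mem_readCNF_iff _ _).2 ⟨_, (List.getElem?_eq_some_iff.1 h1).1, h1, h2⟩

theorem SetTerm.lift {S : List Symb → α → Set Literal} (h : SetTerm C S) (hD : D.Ext C) :
    SetTerm D fun v x => S v x.1 := by
  obtain ⟨i, hi, h⟩ := h
  exact ⟨i, hi.trans_le hD.le, fun v E a ha => h v E _ (hD.rep ha)⟩

end terms

theorem sum_map_update {t : List ℕ} {d j : ℕ} (ht : ∀ i ∈ t, i < d) (hj : d ≤ j)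
    (E : ℕ → List Symb) (x : List Symb) :
    (t.map fun i => (update E j x i).length).sum = (t.map fun i => (E i).length).sum := by
  congr 1
  refine List.map_congr_left fun i hi => ?_
  rw [update_of_ne]
  exact ((ht i hi).trans_le hj).ne

theorem sum_map_update₂ {t : List ℕ} {d : ℕ} (ht : ∀ i ∈ t, i < d)
    (E : ℕ → List Symb) (x y : List Symb) :
    (t.map fun i => (update (update E d x) (d + 1) y i).length).sum =
      (t.map fun i => (E i).length).sum := by
  rw [sum_map_update ht (Nat.le_succ d), sum_map_update ht le_rfl]

theorem Ctx.Rep.update {C : Ctx α} {v : List Symb} {E : ℕ → List Symb} {a : α}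
    (h : C.Rep v E a) (x : List Symb) : C.Rep v (update E C.depth x) a :=
  C.congr (fun i hi => by rw [update_of_ne hi.ne]) h

/-- Add a literal that is represented by the variable `depth`. -/
def Ctx.pushSign (C : Ctx α) : Ctx (α × Literal) where
  depth := C.depth + 1
  Rep v E x := C.Rep v E x.1 ∧ SignAt v (E C.depth).length ∧ litAt v (E C.depth).length = x.2
  valid h := C.valid h.1
  congr h h' := ⟨C.congr (fun i hi => h i (by omega)) h'.1, by
    rw [← h C.depth (by omega)]; exact h'.2⟩

theorem Ctx.pushSign_ext (C : Ctx α) : C.pushSign.Ext C := ⟨Nat.le_succ _, fun h => h.1⟩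

theorem Ctx.litTerm_pushSign (C : Ctx α) : LitTerm C.pushSign fun _ x => x.2 :=
  ⟨[C.depth], 0, by simp [Ctx.pushSign], fun v E a ha => by simpa [Form.val] using ha.2⟩

namespace Form

/-- The entry at a term is a digit. -/
def digitAt (t : List ℕ) (k : ℕ) : Form :=
  neg (and (neg (atom none (.digit true) t k)) (neg (atom none (.digit false) t k)))

/-- The entry at a term is a sign. -/
def signAt (t : List ℕ) (k : ℕ) : Form :=
  neg (and (neg (atom none (.sign true) t k)) (neg (atom none (.sign false) t k)))

theorem holds_atom {v : List Symb} {t : List ℕ} {k d : ℕ} {a : Symb} {E : ℕ → List Symb} :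
    (atom none a t k).holds v d E ↔ v[val E t k]? = some a := Iff.rfl

theorem holds_digitAt {v : List Symb} {t : List ℕ} {k d : ℕ} {E : ℕ → List Symb} :
    (digitAt t k).holds v d E ↔ DigitAt v (val E t k) := by
  simp only [digitAt, holds, DigitAt, val, get]; tauto

theorem holds_signAt {v : List Symb} {t : List ℕ} {k d : ℕ} {E : ℕ → List Symb} :
    (signAt t k).holds v d E ↔ SignAt v (val E t k) := by
  simp only [signAt, holds, SignAt, val, get]; tauto

/-- The same digit, if any, follows at two terms. -/
def digitIff (b : Bool) (t : List ℕ) (k : ℕ) (t' : List ℕ) (k' : ℕ) : Form :=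
  and (neg (and (atom none (.digit b) t k) (neg (atom none (.digit b) t' k'))))
    (neg (and (atom none (.digit b) t' k') (neg (atom none (.digit b) t k))))

theorem holds_digitIff {v : List Symb} {b : Bool} {t t' : List ℕ} {k k' d : ℕ}
    {E : ℕ → List Symb} : (digitIff b t k t' k').holds v d E ↔
      (v[val E t k]? = some (.digit b) ↔ v[val E t' k']? = some (.digit b)) := by
  simp only [digitIff, holds, val, get]; tauto

/-- The digits after two terms agree. -/
def sameDigits (d : ℕ) (t : List ℕ) (k : ℕ) (t' : List ℕ) (k' : ℕ) : Form :=
  neg (ex none (and (neg (ex (some d) (neg (digitAt ((d + 1) :: t) (k + 1)))))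
    (neg (and (digitIff true (d :: t) (k + 1) (d :: t') (k' + 1))
      (digitIff false (d :: t) (k + 1) (d :: t') (k' + 1))))))

theorem holds_sameDigits {v : List Symb} {t t' : List ℕ} {k k' d : ℕ} {E : ℕ → List Symb}
    (ht : ∀ i ∈ t, i < d) (ht' : ∀ i ∈ t', i < d) :
    (sameDigits d t k t' k').holds v d E ↔ SameDigits v (val E t k) (val E t' k') := by
  have e1 : ∀ s m, (∀ i ∈ s, i < d) →
      ∀ p, val (update E d (unary p)) (d :: s) (m + 1) = val E s m + 1 + p := by
    intro s m hs p
    simp only [val, List.map_cons, List.sum_cons, update_self, length_unary,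
      sum_map_update hs le_rfl]
    omega
  have e2 : ∀ p q, val (update (update E d (unary p)) (d + 1) (unary q)) ((d + 1) :: t) (k + 1) =
      val E t k + 1 + q := by
    intro p q
    simp only [val, List.map_cons, List.sum_cons, update_self, length_unary, sum_map_update₂ ht]
    omega
  simp only [sameDigits, holds, holds_digitAt, holds_digitIff, get, e1 _ _ ht, e1 _ _ ht', e2,
    SameDigits, update_self, length_unary, Bool.forall_bool, and_comm]

/-- The term that is extended by the variable `d` is the position of a sign in the clause with its
end marker at the term. -/
def signIn (d : ℕ) (t : List ℕ) (k : ℕ) : Form :=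
  and (signAt (d :: t) (k + 1)) (neg (ex (some d) (atom none .clauseEnd ((d + 1) :: t) (k + 1))))

theorem holds_signIn {v : List Symb} {t : List ℕ} {k d p : ℕ} {E : ℕ → List Symb}
    (ht : ∀ i ∈ t, i < d) :
    (signIn d t k).holds v (d + 1) (update E d (unary p)) ↔ SignIn v (val E t k) p := by
  have e1 : val (update E d (unary p)) (d :: t) (k + 1) = val E t k + 1 + p := by
    simp only [val, List.map_cons, List.sum_cons, update_self, length_unary,
      sum_map_update ht le_rfl]
    omega
  have e2 : ∀ q, val (update (update E d (unary p)) (d + 1) (unary q)) ((d + 1) :: t) (k + 1) =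
      val E t k + 1 + q := by
    intro q
    simp only [val, List.map_cons, List.sum_cons, update_self, length_unary, sum_map_update₂ ht]
    omega
  simp only [signIn, holds, holds_signAt, e1, Form.get, SignIn, update_self, length_unary]
  refine and_congr_right fun _ => not_congr (exists_congr fun q => and_congr_right fun _ => ?_)
  rw [← e2 q, val]

end Form

open Form

namespace Defn

variable {C : Ctx α} {P Q : List Symb → α → Prop}

theorem congr_of_rep (h : Defn C P) (e : ∀ v E a, C.Rep v E a → (P v a ↔ Q v a)) : Defn C Q := by
  obtain ⟨φ, h⟩ := h
  exact ⟨φ, fun v E a ha => (h v E a ha).trans (e v E a ha)⟩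

theorem congr (h : Defn C P) (e : ∀ v a, Valid v → (P v a ↔ Q v a)) : Defn C Q :=
  h.congr_of_rep fun v _ a ha => e v a (C.valid ha)

theorem not (h : Defn C P) : Defn C fun v a => ¬ P v a := by
  obtain ⟨φ, h⟩ := h
  exact ⟨.neg φ, fun v E a ha => not_congr (h v E a ha)⟩

theorem and (h : Defn C P) (h' : Defn C Q) : Defn C fun v a => P v a ∧ Q v a := by
  obtain ⟨φ, h⟩ := h
  obtain ⟨ψ, h'⟩ := h'
  exact ⟨.and φ ψ, fun v E a ha => and_congr (h v E a ha) (h' v E a ha)⟩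

theorem or (h : Defn C P) (h' : Defn C Q) : Defn C fun v a => P v a ∨ Q v a :=
  (h.not.and h'.not).not.congr fun v a _ => by tauto

theorem imp (h : Defn C P) (h' : Defn C Q) : Defn C fun v a => P v a → Q v a :=
  (h.not.or h').congr fun v a _ => by tauto

theorem iff (h : Defn C P) (h' : Defn C Q) : Defn C fun v a => P v a ↔ Q v a :=
  ((h.imp h').and (h'.imp h)).congr fun v a _ => by tauto

/-- A clause is named by the position of its end marker, held by a fresh variable. Quantifying over
all extensions `D` hides the numbering of variables from later uses. -/
theorem exClause {R : List Symb → α → Clause → Prop}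
    (h : ∀ D : Ctx (α × Clause), D.Ext C → ClauseTerm D (fun _ x => x.2) →
      Defn D fun v x => R v x.1 x.2) :
    Defn C fun v a => ∃ c ∈ readCNF v, R v a c := by
  let D : Ctx (α × Clause) :=
    { depth := C.depth + 1
      Rep := fun v E x => C.Rep v E x.1 ∧ v[(E C.depth).length]? = some .clauseEnd ∧
        clauseAt v (E C.depth).length = x.2
      valid := fun h => C.valid h.1
      congr := fun h h' => ⟨C.congr (fun i hi => h i (by omega)) h'.1, by
        rw [← h C.depth (by omega)]; exact h'.2⟩ }
  obtain ⟨φ, h⟩ := h D ⟨Nat.le_succ _, fun h => h.1⟩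
    ⟨[C.depth], 0, by simp [D], fun v E a ha => by simpa [Form.val] using ha.2⟩
  refine ⟨.ex none (.and (.atom none .clauseEnd [C.depth] 0) φ), fun v E a ha => ?_⟩
  have key : ∀ p, v[p]? = some .clauseEnd →
      (φ.holds v (C.depth + 1) (update E C.depth (unary p)) ↔ R v a (clauseAt v p)) :=
    fun p hp => h v _ (a, clauseAt v p) ⟨ha.update _, by simpa using hp⟩
  simp only [mem_readCNF_iff, holds, Form.get, List.map_cons, List.map_nil, update_self,
    length_unary,
    List.sum_cons, List.sum_nil, add_zero]
  constructor
  · rintro ⟨p, hp, hc, hφ⟩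
    exact ⟨_, ⟨p, hp, hc, rfl⟩, (key p hc).1 hφ⟩
  · rintro ⟨_, ⟨p, hp, hc, rfl⟩, hR⟩
    exact ⟨p, hp, hc, (key p hc).2 hR⟩

theorem exOccurring {R : List Symb → α → Literal → Prop}
    (h : ∀ D : Ctx (α × Literal), D.Ext C → LitTerm D (fun _ x => x.2) →
      Defn D fun v x => R v x.1 x.2) :
    Defn C fun v a => ∃ l ∈ lits v, R v a l := by
  obtain ⟨φ, h⟩ := h C.pushSign C.pushSign_ext C.litTerm_pushSign
  refine ⟨.ex none (.and (.signAt [C.depth] 0) φ), fun v E a ha => ?_⟩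
  have key : ∀ p, SignAt v p →
      (φ.holds v (C.depth + 1) (update E C.depth (unary p)) ↔ R v a (litAt v p)) :=
    fun p hp => h v _ (a, litAt v p) ⟨ha.update _, by simpa using hp, by simp⟩
  simp only [holds, holds_signAt, Form.get, Form.val, List.map_cons, List.map_nil, update_self,
    length_unary, List.sum_cons, List.sum_nil, add_zero]
  constructor
  · rintro ⟨p, _, hp, hφ⟩
    exact ⟨_, ⟨p, hp, rfl⟩, (key p hp).1 hφ⟩
  · rintro ⟨_, ⟨p, hp, rfl⟩, hR⟩
    exact ⟨p, hp.lt_length, hp, (key p hp).2 hR⟩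

/-- The bound variable holds the offset of a sign from the end marker of the clause, so the sign
sits at a sum. This is why atoms address sums of variables. -/
theorem exLit {c : List Symb → α → Clause} (hc : ClauseTerm C c)
    {R : List Symb → α → Literal → Prop}
    (h : ∀ D : Ctx (α × Literal), D.Ext C → LitTerm D (fun _ x => x.2) →
      Defn D fun v x => R v x.1 x.2) :
    Defn C fun v a => ∃ l ∈ c v a, R v a l := by
  obtain ⟨t, k, ht, hc⟩ := hc
  have hval : ∀ {E E' : ℕ → List Symb}, (∀ i < C.depth + 1, E i = E' i) →
      Form.val E (C.depth :: t) (k + 1) = Form.val E' (C.depth :: t) (k + 1) := by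
    intro E E' h
    rw [Form.val, Form.val]
    congr 2
    refine List.map_congr_left fun i hi => ?_
    rw [h]
    rcases List.mem_cons.1 hi with rfl | hi
    · omega
    · have := ht i hi; omega
  let D : Ctx (α × Literal) :=
    { depth := C.depth + 1
      Rep := fun v E x => C.Rep v E x.1 ∧ SignAt v (Form.val E (C.depth :: t) (k + 1)) ∧
        litAt v (Form.val E (C.depth :: t) (k + 1)) = x.2
      valid := fun h => C.valid h.1
      congr := fun h h' => ⟨C.congr (fun i hi => h i (by omega)) h'.1, by
        rw [← hval h]; exact h'.2⟩ }
  obtain ⟨φ, h⟩ := h D ⟨Nat.le_succ _, fun h => h.1⟩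
    ⟨C.depth :: t, k + 1, by
      intro i hi
      rcases List.mem_cons.1 hi with rfl | hi
      · exact Nat.lt_succ_self _
      · exact (ht i hi).trans (Nat.lt_succ_self _), fun v E a ha => ha.2⟩
  refine ⟨.ex none (.and (.signIn C.depth t k) φ), fun v E a ha => ?_⟩
  obtain ⟨-, he⟩ := hc v E a ha
  have hv : ∀ p, Form.val (update E C.depth (unary p)) (C.depth :: t) (k + 1) =
      Form.val E t k + 1 + p := by
    intro p
    simp only [Form.val, List.map_cons, List.sum_cons, update_self, length_unary,
      sum_map_update ht le_rfl]
    omega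
  have key : ∀ p, SignIn v (Form.val E t k) p →
      (φ.holds v (C.depth + 1) (update E C.depth (unary p)) ↔
        R v a (litAt v (Form.val E t k + 1 + p))) :=
    fun p hp => h v _ (a, litAt v _) ⟨ha.update _, by rw [hv]; exact hp.1, by rw [hv]⟩
  simp only [holds, holds_signIn ht, Form.get, ← he, mem_clauseAt_iff]
  constructor
  · rintro ⟨p, hp, hc, hφ⟩
    exact ⟨_, ⟨p, hp, hc, rfl⟩, (key p hc).1 hφ⟩
  · rintro ⟨_, ⟨p, hp, hc, rfl⟩, hR⟩
    exact ⟨p, hp, hc, (key p hc).2 hR⟩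

theorem allClause {R : List Symb → α → Clause → Prop}
    (h : ∀ D : Ctx (α × Clause), D.Ext C → ClauseTerm D (fun _ x => x.2) →
      Defn D fun v x => R v x.1 x.2) :
    Defn C fun v a => ∀ c ∈ readCNF v, R v a c :=
  (exClause (R := fun v a c => ¬ R v a c) fun D hD hx => (h D hD hx).not).not.congr
    fun v a _ => by push Not; rfl

theorem allLit {c : List Symb → α → Clause} (hc : ClauseTerm C c)
    {R : List Symb → α → Literal → Prop}
    (h : ∀ D : Ctx (α × Literal), D.Ext C → LitTerm D (fun _ x => x.2) →
      Defn D fun v x => R v x.1 x.2) :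
    Defn C fun v a => ∀ l ∈ c v a, R v a l :=
  (exLit hc (R := fun v a l => ¬ R v a l) fun D hD hx => (h D hD hx).not).not.congr
    fun v a _ => by push Not; rfl

section literals

variable {l m : List Symb → α → Literal} {c c' : List Symb → α → Clause}
  {S : List Symb → α → Set Literal}

theorem varEq (hl : LitTerm C l) (hm : LitTerm C m) :
    Defn C fun v a => (l v a).1 = (m v a).1 := by
  obtain ⟨t, k, ht, hl⟩ := hl
  obtain ⟨t', k', ht', hm⟩ := hm
  refine ⟨.sameDigits C.depth t k t' k', fun v E a ha => ?_⟩
  rw [holds_sameDigits ht ht', sameDigits_iff (C.valid ha).2 (hl v E a ha).1 (hm v E a ha).1,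
    (hl v E a ha).2, (hm v E a ha).2]

theorem positive (hl : LitTerm C l) : Defn C fun v a => (l v a).2 = true := by
  obtain ⟨t, k, ht, hl⟩ := hl
  refine ⟨.atom none (.sign true) t k, fun v E a ha => ?_⟩
  dsimp only
  rw [holds_atom, ← (hl v E a ha).2]
  simp [litAt, literalOf]

theorem litEq (hl : LitTerm C l) (hm : LitTerm C m) : Defn C fun v a => l v a = m v a :=
  ((varEq hl hm).and ((positive hl).iff (positive hm))).congr fun v a _ => by
    rw [Prod.ext_iff]; exact and_congr_right fun _ => Bool.eq_iff_iff.symm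

theorem oppEq (hl : LitTerm C l) (hm : LitTerm C m) : Defn C fun v a => l v a = (m v a).opp :=
  ((varEq hl hm).and ((positive hl).iff (positive hm).not)).congr fun v a _ => by
    rw [Prod.ext_iff, Bool.eq_iff_iff (a := (l v a).2)]; simp [Literal.opp]

theorem memClause (hl : LitTerm C l) (hc : ClauseTerm C c) : Defn C fun v a => l v a ∈ c v a :=
  (exLit hc (R := fun v a m => m = l v a) fun _ hD hx => litEq hx (hl.lift hD)).congr
    fun v a _ => by simp

theorem clauseEq (hc : ClauseTerm C c) (hc' : ClauseTerm C c') :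
    Defn C fun v a => c v a = c' v a :=
  ((allLit hc (R := fun v a l => l ∈ c' v a) fun _ hD hx => memClause hx (hc'.lift hD)).and
    (allLit hc' (R := fun v a l => l ∈ c v a) fun _ hD hx => memClause hx (hc.lift hD))).congr
    fun v a _ => by
      rw [Finset.Subset.antisymm_iff]; rfl

theorem memSet (hl : LitTerm C l) (hS : SetTerm C S) : Defn C fun v a => l v a ∈ S v a := by
  obtain ⟨t, k, ht, hl⟩ := hl
  obtain ⟨i, hi, hS⟩ := hS
  refine ⟨.atom (some i) (.sign true) t k, fun v E a ha => ?_⟩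
  have := hS v E a ha (Form.val E t k)
  simp only [holds, Form.get]
  rw [← Form.val, this, (hl v E a ha).2]
  exact and_iff_right (hl v E a ha).1

end literals

/-- A set of literals is coded by marking every occurrence of its members. The coding is preserved
from one iterate to the next, by induction on the number of rounds. -/
theorem iter {T : List Symb → α → Set Literal → Literal → Prop}
    {R : List Symb → α → Set Literal → Prop}
    (hT : ∀ D : Ctx (α × Set Literal), D.Ext C → SetTerm D (fun _ x => x.2) →
      ∀ D' : Ctx ((α × Set Literal) × Literal), D'.Ext D → LitTerm D' (fun _ x => x.2) →
        Defn D' fun v x => T v x.1.1 x.1.2 x.2)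
    (hR : ∀ D : Ctx (α × Set Literal), D.Ext C → SetTerm D (fun _ x => x.2) →
      Defn D fun v x => R v x.1 x.2) :
    Defn C fun v a => R v a ((fun S => {l | l ∈ lits v ∧ T v a S l})^[v.length] ∅) := by
  let D : Ctx (α × Set Literal) :=
    { depth := C.depth + 1
      Rep := fun v E x => C.Rep v E x.1 ∧ ∀ p : ℕ, (E C.depth)[p]? = some (.sign true) ↔
        SignAt v p ∧ litAt v p ∈ x.2
      valid := fun h => C.valid h.1
      congr := fun h h' => ⟨C.congr (fun i hi => h i (by omega)) h'.1, by
        rw [← h C.depth (by omega)]; exact h'.2⟩ }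
  have hD : D.Ext C := ⟨Nat.le_succ _, fun h => h.1⟩
  have hDS : SetTerm D fun _ x => x.2 := ⟨C.depth, Nat.lt_succ_self _, fun v E a ha => ha.2⟩
  obtain ⟨φ, hφ⟩ := hT D hD hDS D.pushSign D.pushSign_ext D.litTerm_pushSign
  obtain ⟨ψ, hψ⟩ := hR D hD hDS
  refine ⟨.iter (.and (.signAt [C.depth + 1] 0) φ) ψ, fun v E a ha => ?_⟩
  simp only [holds]
  refine hψ v _ (a, _) ⟨ha.update _, ?_⟩
  rw [update_self]
  have key : ∀ (n : ℕ) (p : ℕ),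
      ((fun L => bits v.length fun p => (Form.and (.signAt [C.depth + 1] 0) φ).holds v
        (C.depth + 2) (update (update E C.depth L) (C.depth + 1) (unary p)))^[n] [])[p]? =
          some (.sign true) ↔
      SignAt v p ∧ litAt v p ∈ (fun S => {l | l ∈ lits v ∧ T v a S l})^[n] ∅ := by
    intro n
    induction n with
    | zero => simp
    | succ n ih =>
      intro p
      rw [iterate_succ_apply', iterate_succ_apply']
      generalize (fun S => {l | l ∈ lits v ∧ T v a S l})^[n] ∅ = S at ih ⊢
      generalize (fun L => bits v.length _)^[n] [] = L at ih ⊢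
      have h1 : SignAt v p → (φ.holds v (C.depth + 2)
          (update (update E C.depth L) (C.depth + 1) (unary p)) ↔ T v a S (litAt v p)) := by
        intro hp
        refine hφ v _ ((a, S), litAt v p) ⟨?_, by simpa [D] using hp, by simp [D]⟩
        exact Ctx.Rep.update (C := D) (a := (a, S)) ⟨ha.update _, by simpa using ih⟩ _
      have h3 : ∀ P : ℕ → Prop, (bits v.length P)[p]? = some (.sign true) ↔ p < v.length ∧ P p := by
        intro P
        by_cases hp : p < v.length <;> simp [bits, hp]
      rw [h3]
      simp only [holds, holds_signAt, Form.val, List.map_cons, List.map_nil, List.sum_cons,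
        List.sum_nil, update_self, length_unary, add_zero, Set.mem_ofPred_eq]
      constructor
      · rintro ⟨_, hp, h⟩
        exact ⟨hp, ⟨p, hp, rfl⟩, (h1 hp).1 h⟩
      · rintro ⟨hp, _, h⟩
        exact ⟨hp.lt_length, hp, (h1 hp).2 h⟩
  exact key v.length

end Defn

end ReadOnce

namespace ReadOnce

open Function Literal

/-! ### The formula of the language -/

/-- A monotone operator on the subsets of a finite set reaches a fixed point. -/
theorem iterate_fixed {γ : Type} {F : Set γ → Set γ} (hF : Monotone F) {A : Set γ} (hA : A.Finite)
    (hFA : ∀ S, F S ⊆ A) {n : ℕ} (hn : A.ncard ≤ n) : F (F^[n] ∅) = F^[n] ∅ := by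
  have hle : ∀ k, F^[k] ∅ ⊆ F (F^[k] ∅) := by
    intro k
    induction k with
    | zero => exact Set.empty_subset _
    | succ k ih => rw [iterate_succ_apply']; exact hF ih
  have hsub : ∀ k, F^[k] ∅ ⊆ A := fun k => (hle k).trans (hFA _)
  -- Until the fixed point is reached, each round adds an element.
  have key : ∀ k, F (F^[k] ∅) = F^[k] ∅ ∨ k ≤ (F^[k] ∅).ncard := by
    intro k
    induction k with
    | zero => exact .inr (Nat.zero_le _)
    | succ k ih =>
      rw [iterate_succ_apply']
      by_cases h : F (F^[k] ∅) = F^[k] ∅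
      · exact .inl (by rw [h, h])
      · have h1 := ih.resolve_left h
        have h2 := Set.ncard_lt_ncard ((hle k).ssubset_of_ne (Ne.symm h)) (hA.subset (hFA _))
        exact .inr (by omega)
  refine (key n).elim id fun h => (Set.Subset.antisymm (hle n) ?_).symm
  rw [Set.eq_of_subset_of_ncard_le (hsub n) (hn.trans h) hA]
  exact hFA _

variable {α β : Type}

/-- The subformulas `readCNF v` and those with one clause removed. -/
def SubTerm (C : Ctx α) (Ψ : List Symb → α → CNF) : Prop :=
  (∀ v a, Ψ v a = readCNF v) ∨
    ∃ r, ClauseTerm C r ∧ ∀ v a, Ψ v a = (readCNF v).erase (r v a)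

theorem SubTerm.lift {C : Ctx α} {D : Ctx (α × β)} {Ψ : List Symb → α → CNF} (h : SubTerm C Ψ)
    (hD : D.Ext C) : SubTerm D fun v x => Ψ v x.1 := by
  rcases h with h | ⟨r, hr, h⟩
  · exact .inl fun v x => h v x.1
  · exact .inr ⟨_, hr.lift hD, fun v x => h v x.1⟩

theorem SubTerm.subset {C : Ctx α} {Ψ : List Symb → α → CNF} (h : SubTerm C Ψ) (v : List Symb)
    (a : α) : Ψ v a ⊆ readCNF v := by
  rcases h with h | ⟨r, hr, h⟩
  · rw [h]
  · rw [h]; exact Finset.erase_subset _ _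

/-- The literals that follow from `s` or from a literal in `S` by a clause in `Ψ`. -/
def Next (v : List Symb) (Ψ : CNF) (s : Literal) (S : Set Literal) (l : Literal) : Prop :=
  l = s ∨ ∃ c ∈ readCNF v, c ∈ Ψ ∧ l ∈ c ∧ ∃ m ∈ c, (∃ q ∈ lits v, q = opp m ∧ q ∈ S) ∧
    ∀ m' ∈ c, m' = l ∨ m' = m

/-- The operator is monotone on the literals that occur, of which there are at most as many as
symbols in the word. So `v.length` rounds reach its fixed point, which contains `s` and is closed
under edges; conversely, every stage contains only reachable literals. -/
theorem reach_iff {v : List Symb} (hv : Valid v) {Ψ : CNF} (hΨ : Ψ ⊆ readCNF v) {s : Literal}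
    (hs : s ∈ lits v) (l : Literal) :
    l ∈ (fun S => {l | l ∈ lits v ∧ Next v Ψ s S l})^[v.length] ∅ ↔ Reach Ψ s l := by
  set F : Set Literal → Set Literal := fun S => {l | l ∈ lits v ∧ Next v Ψ s S l} with hF
  have hFS : ∀ S l, l ∈ F S ↔ l ∈ lits v ∧ Next v Ψ s S l := fun S l => Iff.rfl
  constructor
  · generalize v.length = n
    induction n generalizing l with
    | zero => simp
    | succ n ih =>
      rw [iterate_succ_apply', hFS]
      rintro ⟨-, rfl | ⟨c, -, hc, hl, m, hm, ⟨q, -, rfl, hq⟩, hlm⟩⟩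
      · exact .refl
      · refine (ih _ hq).tail ?_
        have : ({opp (opp m), l} : Clause) = c := by
          ext x
          simp only [opp_opp, Finset.mem_insert, Finset.mem_singleton]
          constructor
          · rintro (rfl | rfl)
            · exact hm
            · exact hl
          · exact fun hx => (hlm x hx).symm
        rw [Edge, this]
        exact hc
  · have hfix : F (F^[v.length] ∅) = F^[v.length] ∅ := by
      refine iterate_fixed ?_ (lits_finite v) (fun S l h => h.1) (ncard_lits_le v)
      rintro S S' hS l ⟨h, h'⟩
      refine ⟨h, h'.imp_right ?_⟩
      rintro ⟨c, h1, h2, h3, m, hm, ⟨q, h4, h5, hq⟩, h6⟩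
      exact ⟨c, h1, h2, h3, m, hm, ⟨q, h4, h5, hS hq⟩, h6⟩
    intro h
    induction h with
    | refl => rw [← hfix]; exact ⟨hs, .inl rfl⟩
    | @tail p q _ he ih =>
      rw [← hfix]
      have hq : q ∈ lits v := (mem_lits_iff hv q).2 ⟨_, hΨ he, by simp⟩
      have hp : p ∈ lits v := by
        rw [← hfix] at ih
        exact ih.1
      refine ⟨hq, .inr ⟨_, hΨ he, he, by simp, opp p, by simp, ⟨p, hp, by simp, ih⟩, ?_⟩⟩
      intro m hm
      simpa [or_comm] using hm

/-- A formula contains the empty clause or two complementary literals that imply each other. -/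
def Conflict (v : List Symb) (Ψ : CNF) : Prop :=
  (∃ c ∈ readCNF v, c ∈ Ψ ∧ ∀ l ∈ c, ¬ l = l) ∨
    ∃ p ∈ lits v, ∃ q ∈ lits v, q = opp p ∧ Reach Ψ p q ∧ Reach Ψ q p

/-- This is the criterion by contradictory literals, with quantifiers restricted to what positions
can name. A literal reached from its complement is the end of an edge and therefore occurs.
Emptiness of a clause is expressed by the absurd condition on its literals. -/
theorem conflict_iff {v : List Symb} (hv : Valid v) {Ψ : CNF} (hΨ : Ψ ⊆ readCNF v)
    (h2 : IsTwoCNF Ψ) : Conflict v Ψ ↔ ¬ Satisfiable Ψ := by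
  have hl : ∀ {p q : Literal}, Reach Ψ p q → q ≠ p → q ∈ lits v := by
    intro p q h hne
    rcases h.cases_tail with rfl | ⟨r, -, he⟩
    · exact absurd rfl hne
    · exact (mem_lits_iff hv q).2 ⟨_, hΨ he, by simp⟩
  have ho : ∀ p : Literal, opp p ≠ p := by
    rintro ⟨x, _ | _⟩ <;> simp [opp]
  rw [not_satisfiable_iff h2, Conflict]
  refine or_congr ?_ ?_
  · constructor
    · rintro ⟨c, -, hc, h⟩
      have : c = ∅ := Finset.eq_empty_of_forall_notMem fun l hl => h l hl rfl
      exact this ▸ hc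
    · exact fun h => ⟨∅, hΨ h, h, by simp⟩
  · constructor
    · rintro ⟨p, -, _, -, rfl, h⟩
      exact ⟨p, h⟩
    · rintro ⟨p, h, h'⟩
      exact ⟨p, hl h' (ho p).symm, _, hl h (ho p), rfl, h, h'⟩

/-- Three clauses are those that contain the variable `x`. -/
def Cubic (Φ : CNF) (x : ℕ) : Prop :=
  ∃ c₁ ∈ Φ, ∃ c₂ ∈ Φ, ∃ c₃ ∈ Φ, (¬ c₁ = c₂ ∧ ¬ c₁ = c₃ ∧ ¬ c₂ = c₃) ∧
    ((∃ l ∈ c₁, l.1 = x) ∧ (∃ l ∈ c₂, l.1 = x) ∧ ∃ l ∈ c₃, l.1 = x) ∧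
    ∀ c ∈ Φ, (∃ l ∈ c, l.1 = x) → c = c₁ ∨ c = c₂ ∨ c = c₃

theorem deg_eq_three_iff (Φ : CNF) (x : ℕ) : deg Φ x = 3 ↔ Cubic Φ x := by
  rw [deg, Finset.card_eq_three]
  constructor
  · rintro ⟨c₁, c₂, c₃, h12, h13, h23, h⟩
    have hc : ∀ c, (c ∈ Φ ∧ ∃ l ∈ c, l.1 = x) ↔ c = c₁ ∨ c = c₂ ∨ c = c₃ := by
      intro c
      simpa using Finset.ext_iff.1 h c
    have h1 := (hc c₁).2 (by simp)
    have h2 := (hc c₂).2 (by simp)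
    have h3 := (hc c₃).2 (by simp)
    exact ⟨c₁, h1.1, c₂, h2.1, c₃, h3.1, ⟨h12, h13, h23⟩, ⟨h1.2, h2.2, h3.2⟩,
      fun c h h' => (hc c).1 ⟨h, h'⟩⟩
  · rintro ⟨c₁, h1, c₂, h2, c₃, h3, ⟨h12, h13, h23⟩, ⟨k1, k2, k3⟩, h⟩
    refine ⟨c₁, c₂, c₃, h12, h13, h23, ?_⟩
    ext c
    simp only [Finset.mem_filter, Finset.mem_insert, Finset.mem_singleton]
    constructor
    · exact fun hc => h c hc.1 hc.2
    · rintro (rfl | rfl | rfl)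
      exacts [⟨h1, k1⟩, ⟨h2, k2⟩, ⟨h3, k3⟩]

theorem fewCubic_iff {v : List Symb} (hv : Valid v) : FewCubic (readCNF v) ↔
    ¬ ∃ l₁ ∈ lits v, Cubic (readCNF v) l₁.1 ∧ ∃ l₂ ∈ lits v, Cubic (readCNF v) l₂.1 ∧
      ¬ l₁.1 = l₂.1 ∧ ∃ l₃ ∈ lits v, Cubic (readCNF v) l₃.1 ∧ ¬ l₁.1 = l₃.1 ∧ ¬ l₂.1 = l₃.1 := by
  have hocc : ∀ x, Cubic (readCNF v) x → ∃ l ∈ lits v, l.1 = x := by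
    rintro x ⟨c, hc, _, -, _, -, -, ⟨⟨l, hl, rfl⟩, -⟩, -⟩
    exact ⟨l, (mem_lits_iff hv l).2 ⟨c, hc, hl⟩, rfl⟩
  constructor
  · rintro h ⟨l₁, -, h1, l₂, -, h2, h12, l₃, -, h3, h13, h23⟩
    have := h {l₁.1, l₂.1, l₃.1} (by
      simp only [Finset.mem_insert, Finset.mem_singleton, deg_eq_three_iff]
      rintro x (rfl | rfl | rfl) <;> assumption)
    rw [Finset.card_eq_three.2 ⟨_, _, _, h12, h13, h23, rfl⟩] at this
    omega
  · intro h V hV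
    by_contra hc
    obtain ⟨x, y, z, hx, hy, hz, hxy, hxz, hyz⟩ := Finset.two_lt_card_iff.1 (not_le.1 hc)
    have h1 := (deg_eq_three_iff _ _).1 (hV x hx)
    have h2 := (deg_eq_three_iff _ _).1 (hV y hy)
    have h3 := (deg_eq_three_iff _ _).1 (hV z hz)
    obtain ⟨l₁, k1, rfl⟩ := hocc _ h1
    obtain ⟨l₂, k2, rfl⟩ := hocc _ h2
    obtain ⟨l₃, k3, rfl⟩ := hocc _ h3
    exact h ⟨l₁, k1, h1, l₂, k2, h2, hxy, l₃, k3, h3, hxz, hyz⟩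

namespace Defn

variable {C : Ctx α} {Ψ : List Symb → α → CNF}

theorem memSub (hΨ : SubTerm C Ψ) {c : List Symb → α → Clause} (hc : ClauseTerm C c) :
    Defn C fun v a => c v a ∈ Ψ v a := by
  rcases hΨ with h | ⟨r, hr, h⟩
  -- Membership in the whole formula is automatic for a represented clause; any formula that always
  -- holds will do.
  · refine (clauseEq hc hc).congr_of_rep fun v E a ha => ?_
    simp [h, hc.mem_readCNF ha]
  · refine (clauseEq hc hr).not.congr_of_rep fun v E a ha => ?_
    simp [h, hc.mem_readCNF ha]

theorem next (hΨ : SubTerm C Ψ) {s l : List Symb → α → Literal} (hs : LitTerm C s)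
    (hl : LitTerm C l) {S : List Symb → α → Set Literal} (hS : SetTerm C S) :
    Defn C fun v a => Next v (Ψ v a) (s v a) (S v a) (l v a) := by
  refine (litEq hl hs).or (exClause (R := fun v a c => c ∈ Ψ v a ∧ l v a ∈ c ∧ ∃ m ∈ c,
    (∃ q ∈ lits v, q = opp m ∧ q ∈ S v a) ∧ ∀ m' ∈ c, m' = l v a ∨ m' = m) fun D hD hc => ?_)
  refine (memSub (hΨ.lift hD) hc).and ((memClause (hl.lift hD) hc).and (exLit hc
    (R := fun v x m => (∃ q ∈ lits v, q = opp m ∧ q ∈ S v x.1) ∧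
      ∀ m' ∈ x.2, m' = l v x.1 ∨ m' = m) fun D' hD' hm => ?_))
  refine (exOccurring (R := fun v x q => q = opp x.2 ∧ q ∈ S v x.1.1) fun D'' hD'' hq => ?_).and
    (allLit (hc.lift hD') (R := fun v x m' => m' = l v x.1.1 ∨ m' = x.2) fun D'' hD'' hm' => ?_)
  · exact (oppEq hq (hm.lift hD'')).and (memSet hq (((hS.lift hD).lift hD').lift hD''))
  · exact (litEq hm' (((hl.lift hD).lift hD').lift hD'')).or (litEq hm' (hm.lift hD''))

theorem reach (hΨ : SubTerm C Ψ) {s l : List Symb → α → Literal} (hs : LitTerm C s)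
    (hl : LitTerm C l) : Defn C fun v a => Reach (Ψ v a) (s v a) (l v a) := by
  refine (iter (T := fun v a S l => Next v (Ψ v a) (s v a) S l) (R := fun v a S => l v a ∈ S)
    (fun D hD hS D' hD' hm => next ((hΨ.lift hD).lift hD') ((hs.lift hD).lift hD') hm
      (hS.lift hD')) fun D hD hS => memSet (hl.lift hD) hS).congr_of_rep fun v E a ha => ?_
  exact reach_iff (C.valid ha) (hΨ.subset v a) (hs.mem_lits ha) _

theorem conflict (hΨ : SubTerm C Ψ) : Defn C fun v a => Conflict v (Ψ v a) := by
  refine (exClause (R := fun v a c => c ∈ Ψ v a ∧ ∀ l ∈ c, ¬ l = l) fun D hD hc =>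
    (memSub (hΨ.lift hD) hc).and (allLit hc (R := fun v a l => ¬ l = l) fun D' hD' hl =>
      (litEq hl hl).not)).or ?_
  refine exOccurring (R := fun v a p => ∃ q ∈ lits v, q = opp p ∧ Reach (Ψ v a) p q ∧
    Reach (Ψ v a) q p) fun D hD hp => ?_
  refine exOccurring (R := fun v (x : α × Literal) q => q = opp x.2 ∧ Reach (Ψ v x.1) x.2 q ∧
    Reach (Ψ v x.1) q x.2) fun D' hD' hq => ?_
  have hΨ' := (hΨ.lift hD).lift hD'
  exact (oppEq hq (hp.lift hD')).and ((reach hΨ' (hp.lift hD') hq).and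
    (reach hΨ' hq (hp.lift hD')))

theorem hasVar {c : List Symb → α → Clause} {l : List Symb → α → Literal} (hc : ClauseTerm C c)
    (hl : LitTerm C l) : Defn C fun v a => ∃ m ∈ c v a, m.1 = (l v a).1 :=
  exLit hc (R := fun v a m => m.1 = (l v a).1) fun _ hD hm => varEq hm (hl.lift hD)

theorem cubic {l : List Symb → α → Literal} (hl : LitTerm C l) :
    Defn C fun v a => Cubic (readCNF v) (l v a).1 := by
  refine exClause (R := fun v a c₁ => ∃ c₂ ∈ readCNF v, ∃ c₃ ∈ readCNF v,
    (¬ c₁ = c₂ ∧ ¬ c₁ = c₃ ∧ ¬ c₂ = c₃) ∧ ((∃ m ∈ c₁, m.1 = (l v a).1) ∧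
      (∃ m ∈ c₂, m.1 = (l v a).1) ∧ ∃ m ∈ c₃, m.1 = (l v a).1) ∧
    ∀ c ∈ readCNF v, (∃ m ∈ c, m.1 = (l v a).1) → c = c₁ ∨ c = c₂ ∨ c = c₃) fun D hD h1 => ?_
  refine exClause (R := fun v (x : α × Clause) c₂ => ∃ c₃ ∈ readCNF v,
    (¬ x.2 = c₂ ∧ ¬ x.2 = c₃ ∧ ¬ c₂ = c₃) ∧ ((∃ m ∈ x.2, m.1 = (l v x.1).1) ∧
      (∃ m ∈ c₂, m.1 = (l v x.1).1) ∧ ∃ m ∈ c₃, m.1 = (l v x.1).1) ∧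
    ∀ c ∈ readCNF v, (∃ m ∈ c, m.1 = (l v x.1).1) → c = x.2 ∨ c = c₂ ∨ c = c₃)
    fun D' hD' h2 => ?_
  refine exClause (R := fun v (x : (α × Clause) × Clause) c₃ =>
    (¬ x.1.2 = x.2 ∧ ¬ x.1.2 = c₃ ∧ ¬ x.2 = c₃) ∧ ((∃ m ∈ x.1.2, m.1 = (l v x.1.1).1) ∧
      (∃ m ∈ x.2, m.1 = (l v x.1.1).1) ∧ ∃ m ∈ c₃, m.1 = (l v x.1.1).1) ∧
    ∀ c ∈ readCNF v, (∃ m ∈ c, m.1 = (l v x.1.1).1) → c = x.1.2 ∨ c = x.2 ∨ c = c₃)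
    fun D'' hD'' h3 => ?_
  have h1' := (h1.lift hD').lift hD''
  have h2' := h2.lift hD''
  have hl' := ((hl.lift hD).lift hD').lift hD''
  refine ((clauseEq h1' h2').not.and ((clauseEq h1' h3).not.and (clauseEq h2' h3).not)).and
    (((hasVar h1' hl').and ((hasVar h2' hl').and (hasVar h3 hl'))).and ?_)
  exact allClause (R := fun v x c => (∃ m ∈ c, m.1 = (l v x.1.1.1).1) →
    c = x.1.1.2 ∨ c = x.1.2 ∨ c = x.2) fun E hE hc => (hasVar hc (hl'.lift hE)).imp
      ((clauseEq hc (h1'.lift hE)).or ((clauseEq hc (h2'.lift hE)).or (clauseEq hc (h3.lift hE))))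

theorem fewCubic : Defn C fun v _ => FewCubic (readCNF v) := by
  refine Defn.congr ?_ fun v a hv => (fewCubic_iff hv).symm
  refine (exOccurring (R := fun v _ l₁ => Cubic (readCNF v) l₁.1 ∧ ∃ l₂ ∈ lits v,
    Cubic (readCNF v) l₂.1 ∧ ¬ l₁.1 = l₂.1 ∧ ∃ l₃ ∈ lits v, Cubic (readCNF v) l₃.1 ∧
      ¬ l₁.1 = l₃.1 ∧ ¬ l₂.1 = l₃.1) fun D hD h1 => (cubic h1).and ?_).not
  refine exOccurring (R := fun v x l₂ => Cubic (readCNF v) l₂.1 ∧ ¬ x.2.1 = l₂.1 ∧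
    ∃ l₃ ∈ lits v, Cubic (readCNF v) l₃.1 ∧ ¬ x.2.1 = l₃.1 ∧ ¬ l₂.1 = l₃.1) fun D' hD' h2 =>
      (cubic h2).and ((varEq (h1.lift hD') h2).not.and ?_)
  exact exOccurring (R := fun v x l₃ => Cubic (readCNF v) l₃.1 ∧ ¬ x.1.2.1 = l₃.1 ∧
    ¬ x.2.1 = l₃.1) fun D'' hD'' h3 => (cubic h3).and
      ((varEq ((h1.lift hD').lift hD'') h3).not.and (varEq (h2.lift hD'') h3).not)

theorem isTwoCNF : Defn C fun v _ => IsTwoCNF (readCNF v) := by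
  refine (allClause (R := fun v _ c => ¬ ∃ l₁ ∈ c, ∃ l₂ ∈ c, ∃ l₃ ∈ c,
    ¬ l₁ = l₂ ∧ ¬ l₁ = l₃ ∧ ¬ l₂ = l₃) fun D hD hc => ?_).congr fun v a _ =>
      forall₂_congr fun c _ => by rw [← not_lt, Finset.two_lt_card]
  refine (exLit hc (R := fun v x l₁ => ∃ l₂ ∈ x.2, ∃ l₃ ∈ x.2,
    ¬ l₁ = l₂ ∧ ¬ l₁ = l₃ ∧ ¬ l₂ = l₃) fun D1 hD1 h1 => ?_).not
  refine exLit (hc.lift hD1) (R := fun v x l₂ => ∃ l₃ ∈ x.1.2,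
    ¬ x.2 = l₂ ∧ ¬ x.2 = l₃ ∧ ¬ l₂ = l₃) fun D2 hD2 h2 => ?_
  refine exLit ((hc.lift hD1).lift hD2) (R := fun v x l₃ =>
    ¬ x.1.2 = x.2 ∧ ¬ x.1.2 = l₃ ∧ ¬ x.2 = l₃) fun D3 hD3 h3 => ?_
  have h1' := (h1.lift hD2).lift hD3
  have h2' := h2.lift hD3
  exact (litEq h1' h2').not.and ((litEq h1' h3).not.and (litEq h2' h3).not)

/-- The two properties are defined together because `Conflict` expresses unsatisfiability only for
2CNF formulas. -/
theorem minimalUnsat : Defn C fun v _ => IsTwoCNF (readCNF v) ∧ MinimalUnsat (readCNF v) := by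
  refine (isTwoCNF.and ((conflict (.inl fun _ _ => rfl)).and (allClause
    (R := fun v _ r => ¬ Conflict v ((readCNF v).erase r)) fun D hD hr =>
      (conflict (.inr ⟨_, hr, fun _ _ => rfl⟩)).not))).congr fun v a hv => ?_
  refine and_congr_right fun h2 => ?_
  rw [conflict_iff hv subset_rfl h2]
  constructor
  · rintro ⟨h, h'⟩
    refine minimalUnsat_of_erase h fun r hr => ?_
    have := h' r hr
    rw [conflict_iff hv (Finset.erase_subset _ _) (h2.mono (Finset.erase_subset _ _)),
      not_not] at this
    obtain ⟨w, hw⟩ := this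
    exact ⟨w, fun d hd hdr => hw d (Finset.mem_erase.2 ⟨hdr, hd⟩)⟩
  · rintro ⟨h, h'⟩
    refine ⟨h, fun r hr => ?_⟩
    rw [conflict_iff hv (Finset.erase_subset _ _) (h2.mono (Finset.erase_subset _ _)), not_not]
    exact h' _ (Finset.erase_ssubset hr)

end Defn

/-- The formula that describes valid reversed words. -/
def Form.valid : Form :=
  .and (.and (.neg (digitAt [] 0)) (.neg (signAt [] 0)))
    (.and (.neg (.ex none (.and (.atom none .clauseEnd [0] 0) (digitAt [0] 1))))
      (.neg (.ex none (.and (signAt [0] 0) (.atom none (.digit false) [0] 1)))))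

theorem Form.holds_valid (v : List Symb) (E : ℕ → List Symb) : valid.holds v 0 E ↔ Valid v := by
  simp only [valid, holds, holds_digitAt, holds_signAt, get, val, List.map_nil, List.sum_nil,
    List.map_cons, List.sum_cons, update_self, length_unary, add_zero, Valid]
  refine and_congr (by rw [digitAt_iff, signAt_iff]; push Not; rfl) ?_
  rw [chained_iff]
  have hd : ∀ i, (v.drop (i + 1))[0]? = v[i + 1]? := fun i => by simp
  constructor
  · rintro ⟨h1, h2⟩ i a ha
    have hi := (List.getElem?_eq_some_iff.1 ha).1
    cases a with
    | digit b => trivial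
    | sign b =>
      intro h
      exact h2 ⟨i, hi, signAt_iff.2 ⟨b, ha⟩, hd i ▸ h⟩
    | clauseEnd =>
      intro b h
      exact h1 ⟨i, hi, ha, digitAt_iff.2 ⟨b, hd i ▸ h⟩⟩
  · intro h
    constructor
    · rintro ⟨i, hi, ha, hb⟩
      obtain ⟨b, hb⟩ := digitAt_iff.1 hb
      exact h i _ ha b (by rw [hd]; exact hb)
    · rintro ⟨i, hi, ha, hb⟩
      obtain ⟨b, ha⟩ := signAt_iff.1 ha
      exact h i _ ha (by rw [hd]; exact hb)

/-- The context without variables. -/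
def Ctx.empty : Ctx Unit where
  depth := 0
  Rep v _ _ := Valid v
  valid h := h
  congr _ h := h

end ReadOnce

theorem mainTheorem7 : ReadOnce.InP ReadOnce.rorMinimalUnsatTwoCNF := by
  obtain ⟨φ, h⟩ := (ReadOnce.Defn.minimalUnsat (C := .empty)).and ReadOnce.Defn.fewCubic
  refine ReadOnce.Form.inP_of_holds _ (.and .valid φ) fun w => ?_
  simp only [ReadOnce.Form.holds, ReadOnce.Form.holds_valid]
  rw [ReadOnce.mem_rorMinimalUnsatTwoCNF]
  -- The definability results speak about valid words only; the first conjunct provides this.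
  refine and_congr_right fun hv => ?_
  rw [← and_assoc]
  exact (h w.reverse _ () hv).symm
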